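/- **Setting.** Let $f_{abc}$ ($1\le a,b,c\le r$) be real and totally antisymmetric. Consider the massless free fields $v_a^\mu$ (Bose), $u_a,\tilde u_a$ (Fermi) on Minkowski space ($\eta=\mathrm{diag}(1,-1,-1,-1)$), acting on the algebraic Fock space $\mathcal F_0$ (finitely many particles, graded symmetric, continuous, rapidly decreasing wave functions on products of light cones), with non-zero graded commutators $$[v_a^\mu(x),v_b^\nu(y)]=i\,\delta_{ab}\,\eta^{\mu\nu}D_0(x-y)\mathbf 1,\qquad [u_a(x),\tilde u_b(y)]=-i\,\delta_{ab}\,D_0(x-y)\mathbf 1,$$ where $D_0$ is the massless Pauli–Jordan distribution. Let $\xi_p$ denote these fields and their derivatives (jet variables), $|\xi_p|$ the Fermi parity, $\Xi$ the free graded commutative algebra on the jet variables, and $D_{pq}$ the distributions with $[\xi_p(x),\xi_q(y)]=-iD_{pq}(x-y)\mathbf 1$. For $A\in\Xi$ put $\xi_q\cdot A=(-1)^{|\xi_q||A|}\,\partial A/\partial\xi_q$ (left derivative). The gauge charge $Q$ is given by $Q\Omega=0$, $[Q,v_a^\mu]=i\partial^\mu u_a$, $[Q,u_a]=0$, $[Q,\tilde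 u_a]=-i\partial_\mu v_a^\mu$; $d_Q=[Q,\cdot]$ on operators, and $d_Q$ also denotes the corresponding odd derivation of $\Xi$. With $F_a^{\mu\nu}=\partial^\mu v_a^\nu-\partial^\nu v_a^\mu$ let $$T^{\emptyset}=f_{abc}\big(\tfrac12 v_{a\mu}v_{b\nu}F_c^{\nu\mu}+u_av_b^\mu\partial_\mu\tilde u_c\big),\quad T^{\mu}=f_{abc}\big(u_av_{b\nu}F_c^{\nu\mu}-\tfrac12u_au_b\partial^\mu\tilde u_c\big),\quad T^{\mu\nu}=\tfrac12f_{abc}u_au_bF_c^{\mu\nu},$$ and $T^I=0$ for $|I|>2$. Let $T(A_1(x_1),\dots,A_n(x_n))$, $A_l\in\Xi$, be chronological products: multilinear in the $A_l$, depending on the $A_l$ only modulo the field equations, operator-valued tempered distributions on $\mathcal F_0$ of Fermi parity $\sum_l|A_l|$ which have adjoints on $\mathcal F_0$, and obeying skew-symmetry, causality, the initial condition $T(A(x))={:}A(x){:}$ and the Wick expansion property $$[\xi_p(y),T(A_1(x_1),\dots,A_n(x_n))]=-i\sum_{m=1}^n\prod_{l\le m}(-1)^{|\xi_p||A_l|}\sum_qD_{pq}(y-x_m)\,T(A_1(x_1),\dots,\xi_q\cdot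 A_m(x_m),\dots,A_n(x_n)).$$ For $A_l^{I}=T^{I}$ or $A_l^I=\xi_{q}\cdot T^{I}$, let $f_l$ be the Fermi parity of $A_l^{I_l}$ ($|I_l|$, resp. $|\xi_q|+|I_l|$), and put $sA^I=d_QA^I-i\,\partial_\mu A^{I\mu}$ (in $\Xi$, formal derivatives) and $$sT(A_1^{I_1}(x_1),\dots,A_n^{I_n}(x_n))=d_QT(\dots)-i\sum_{l=1}^n(-1)^{f_1+\dots+f_{l-1}}\frac{\partial}{\partial x_l^\mu}T(A_1^{I_1}(x_1),\dots,A_l^{I_l\mu}(x_l),\dots,A_n^{I_n}(x_n)).$$ The rank-one gauge identities $G(1,n)$ state that, whenever exactly one of the $A_l$ is of the form $\xi_q\cdot T$ and the others are $T$, $$sT(A_1^{I_1}(x_1),\dots,A_n^{I_n}(x_n))=\sum_{m=1}^n\prod_{l<m}(-1)^{f_l}\,T(A_1^{I_1}(x_1),\dots,sA_m^{I_m}(x_m),\dots,A_n^{I_n}(x_n)).$$ **Theorem.** Let $n\ge1$. For all $p$ and all index collections $I_1,\dots,I_n$, $$\begin{aligned}{}[\xi_p(y),\,sT(T^{I_1}(x_1),\dots,T^{I_n}(x_n))]=-i(-1)^{|\xi_p|}\sum_{m=1}^n\sum_q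 D_{pq}(y-x_m)\prod_{l<m}(-1)^{|I_l||I_m|}\,(-1)^{|\xi_p||I_m|}\\ \times\big[\,sT(\xi_q\cdot T^{I_m}(x_m),T^{I_1}(x_1),\dots,\widehat m,\dots,T^{I_n}(x_n))-T(s(\xi_q\cdot T^{I_m})(x_m),T^{I_1}(x_1),\dots,\widehat m,\dots,T^{I_n}(x_n))\big].\end{aligned}$$ Consequently, if $G(1,n)$ holds, then for all $I_1,\dots,I_n$ the gauge anomaly $sT(T^{I_1}(x_1),\dots,T^{I_n}(x_n))$ of $G(0,n)$ is a numerical distribution: there is a tempered distribution $\mathcal A^{I_1,\dots,I_n}(x_1,\dots,x_n)$ with $$sT(T^{I_1}(x_1),\dots,T^{I_n}(x_n))=\mathcal A^{I_1,\dots,I_n}(x_1,\dots,x_n)\,\mathbf 1 .$$ -/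

import Mathlib

open MeasureTheory
open scoped SchwartzMap FourierTransform LineDeriv

namespace YangMills

noncomputable section

/-! ## Minkowski space, test functions and the jet variables -/

/-- Minkowski space with coordinates `x^0, …, x^3`; the Minkowski metric is `eta` below. -/
abbrev Mink : Type := EuclideanSpace ℝ (Fin 4)

/-- Spatial momenta; they parametrize the forward light cone. -/
abbrev Mom : Type := EuclideanSpace ℝ (Fin 3)

/-- Diagonal entries of the Minkowski metric `diag(1, -1, -1, -1)`. -/
def eta (μ : Fin 4) : ℂ := if μ = 0 then 1 else -1

/-- The basic fields of `r` copies of the photon system: the vector fields `v_a^μ` (upper index),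
the ghosts `u_a` and the anti-ghosts `ũ_a`. -/
inductive Species (r : ℕ) : Type
  | v (a : Fin r) (μ : Fin 4) : Species r
  | u (a : Fin r) : Species r
  | ut (a : Fin r) : Species r
  deriving DecidableEq, Fintype

variable {r : ℕ}

/-- Fermi parity: `v` is even, `u` and `ũ` are odd. -/
def Species.parity : Species r → ℕ
  | .v _ _ => 0
  | .u _ => 1
  | .ut _ => 1

/-- A jet variable `ξ_{s; μ₁ … μ_k}`: a basic field with a symmetric collection of (lower)
derivative indices. -/
abbrev Jet (r : ℕ) : Type := Species r × Multiset (Fin 4)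

/-- Fermi parity of a jet variable. -/
def Jet.parity (p : Jet r) : ℕ := p.1.parity

/-! ## The algebra `Ξ` of Grassmann polynomials in the jet variables -/

/-- Graded commutativity of the generators. -/
inductive SuperComm (r : ℕ) : FreeAlgebra ℂ (Jet r) → FreeAlgebra ℂ (Jet r) → Prop
  | swap (p q : Jet r) : SuperComm r (FreeAlgebra.ι ℂ p * FreeAlgebra.ι ℂ q)
      ((-1 : ℂ) ^ (p.parity * q.parity) • (FreeAlgebra.ι ℂ q * FreeAlgebra.ι ℂ p))

/-- The free graded commutative algebra on the jet variables (the squares of odd variables vanish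
because `2` is invertible). -/
abbrev Xi (r : ℕ) : Type := RingQuot (SuperComm r)

/-- The jet variable `ξ_p` as an element of `Ξ`. -/
def xi (p : Jet r) : Xi r := RingQuot.mkAlgHom ℂ (SuperComm r) (FreeAlgebra.ι ℂ p)

theorem xi_mul_xi (p q : Jet r) :
    xi p * xi q = (-1 : ℂ) ^ (p.parity * q.parity) • (xi q * xi p) := by
  have h := RingQuot.mkAlgHom_rel ℂ (SuperComm.swap p q)
  simpa [xi, map_mul, map_smul] using h

/-- The automorphism of `Ξ` that multiplies a monomial `A` by `(-1)^{|A|}`. -/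
def gradeAut : Xi r →ₐ[ℂ] Xi r :=
  RingQuot.liftAlgHom ℂ ⟨FreeAlgebra.lift ℂ fun p : Jet r => (-1 : ℂ) ^ p.parity • xi p, by
    rintro _ _ ⟨p, q⟩
    simp only [map_mul, map_smul, FreeAlgebra.lift_ι_apply, smul_mul_smul_comm]
    rw [xi_mul_xi p q, smul_smul, smul_smul]
    congr 1
    ring⟩

/-- `A` is homogeneous of Fermi parity `a` (mod 2). -/
def HasParity (A : Xi r) (a : ℕ) : Prop := gradeAut A = (-1 : ℂ) ^ a • A

/-- Auxiliary homomorphism `A ↦ [[γ^ε A, D A], [0, A]]` that encodes a graded derivation `D`. -/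
def derivHom (ε : ℕ) (d : Jet r → Xi r)
    (hd : ∀ p q, xi p * d q = (-1 : ℂ) ^ (p.parity * (q.parity + ε)) • (d q * xi p)) :
    Xi r →ₐ[ℂ] Matrix (Fin 2) (Fin 2) (Xi r) :=
  RingQuot.liftAlgHom ℂ
    ⟨FreeAlgebra.lift ℂ fun p : Jet r =>
      !![(-1 : ℂ) ^ (ε * p.parity) • xi p, d p; 0, xi p], by
    rintro _ _ ⟨p, q⟩
    simp only [map_mul, map_smul, FreeAlgebra.lift_ι_apply]
    have h1 := xi_mul_xi p q
    have h2 := hd p q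
    have h3 := hd q p
    have e : ∀ n : ℕ, ((-1 : ℂ) ^ n) * (-1) ^ n = 1 := fun n => by
      rw [← mul_pow]; norm_num
    have h3' : d p * xi q = (-1 : ℂ) ^ (q.parity * (p.parity + ε)) • (xi q * d p) := by
      rw [h3, smul_smul, e, one_smul]
    ext i j
    fin_cases i <;> fin_cases j <;>
      simp [Matrix.mul_apply, Fin.sum_univ_two]
    · rw [h1]; simp only [smul_smul]; congr 1; ring
    · rw [h2, h3', smul_smul, add_comm, smul_smul]
      congr 2
      · ring
      · rw [show ε * p.parity = p.parity * ε from mul_comm _ _, mul_add, pow_add]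
        rw [mul_comm, mul_assoc, e]; ring
    · exact h1⟩

/-- The graded derivation of `Ξ` of parity `ε` with prescribed values on the jet variables:
`D (A B) = (D A) B + (-1)^{ε |A|} A (D B)`. -/
def gradedDerivation (ε : ℕ) (d : Jet r → Xi r)
    (hd : ∀ p q, xi p * d q = (-1 : ℂ) ^ (p.parity * (q.parity + ε)) • (d q * xi p)) :
    Xi r →ₗ[ℂ] Xi r where
  toFun A := derivHom ε d hd A 0 1
  map_add' A B := by simp
  map_smul' c A := by simp

/-- The left derivative `∂/∂ξ_q`. -/
def pd (q : Jet r) : Xi r →ₗ[ℂ] Xi r :=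
  gradedDerivation q.parity (fun p => if p = q then 1 else 0) (by
    intro p p'
    split_ifs with h
    · subst h
      rw [← two_mul, mul_left_comm, pow_mul]; simp
    · simp)

/-- The product `ξ_q · A = (-1)^{|ξ_q| |A|} ∂A/∂ξ_q`. -/
def dot (q : Jet r) : Xi r →ₗ[ℂ] Xi r :=
  pd q ∘ₗ ((gradeAut ^ q.parity : Xi r →ₐ[ℂ] Xi r) : Xi r →ₗ[ℂ] Xi r)

/-- The formal derivative `∂_μ` on `Ξ`. -/
def formalD (μ : Fin 4) : Xi r →ₗ[ℂ] Xi r :=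
  gradedDerivation 0 (fun p => xi (p.1, μ ::ₘ p.2)) (fun p q => xi_mul_xi p (q.1, μ ::ₘ q.2))

/-- Values of `d_Q` on the jet variables:
`d_Q v_a^μ = i η^{μν} u_{a;ν}`, `d_Q u_a = 0`, `d_Q ũ_a = - i v^μ_{a;μ}`, and `d_Q` commutes with
the formal derivatives. -/
def dQGen : Jet r → Xi r
  | (.v a μ, M) => (Complex.I * eta μ) • xi (.u a, μ ::ₘ M)
  | (.u _, _) => 0
  | (.ut a, M) => (-Complex.I) • ∑ μ : Fin 4, xi (.v a μ, μ ::ₘ M)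

/-- The odd derivation `d_Q` of `Ξ`. -/
def dQ : Xi r →ₗ[ℂ] Xi r :=
  gradedDerivation 1 dQGen (by
    rintro p ⟨s, M⟩
    cases s with
    | v a μ =>
      simp only [dQGen, mul_smul_comm, smul_mul_assoc]
      rw [xi_mul_xi, smul_comm]
      rfl
    | u a => simp [dQGen]
    | ut a =>
      simp only [dQGen, mul_smul_comm, smul_mul_assoc, Finset.mul_sum, Finset.sum_mul]
      rw [smul_comm]
      refine congrArg (fun X : Xi r => (-Complex.I) • X) ?_
      rw [Finset.smul_sum]
      refine Finset.sum_congr rfl fun μ _ => ?_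
      rw [xi_mul_xi]
      congr 1
      simp [Jet.parity, Species.parity, pow_mul, mul_comm])

/-- The field equation polynomial `K ξ_{s;M}`, with `K = ∂_μ ∂^μ`. -/
def boxXi (p : Jet r) : Xi r := ∑ μ, eta μ • xi (p.1, μ ::ₘ μ ::ₘ p.2)

/-! ## The Fock space -/

/-- A one-particle label: a basic field and a point of the light cone. -/
abbrev Label (r : ℕ) : Type := Species r × Mom

/-- The light-like momentum `p^μ = (‖𝐩‖, 𝐩)`. -/
def onShell (p : Mom) : Fin 4 → ℝ := Fin.cons ‖p‖ p

/-- The covariant components `p_μ`. -/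
def onShellLow (p : Mom) (μ : Fin 4) : ℂ := eta μ * onShell p μ

/-- The Minkowski product `p · x` of a light-like momentum with a point. -/
def phase (p : Mom) (x : Mink) : ℝ := ‖p‖ * x 0 - ∑ i : Fin 3, p i * x i.succ

/-- The vector `(-‖𝐩‖, 𝐩) / 2π`, for which `exp (-2 π i ⟪x, k⟫) = exp (i p · x)`. -/
def waveVector (p : Mom) : Mink :=
  WithLp.toLp 2 (Fin.cons (-(2 * Real.pi)⁻¹ * ‖p‖) fun i : Fin 3 => (2 * Real.pi)⁻¹ * p i)

/-- `∫ g(x) exp (i p · x) dx`. -/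
def hatPos (g : 𝓢(Mink, ℂ)) (p : Mom) : ℂ := (𝓕 g) (waveVector p)

/-- `∫ g(x) exp (- i p · x) dx`. -/
def hatNeg (g : 𝓢(Mink, ℂ)) (p : Mom) : ℂ := (𝓕 g) (-waveVector p)

/-- `∏_{μ ∈ M} (c p_μ)`; for `c = ± i` it represents the derivatives `∂_M` of `exp (± i p · x)`. -/
def momPoly (c : ℂ) (M : Multiset (Fin 4)) (p : Mom) : ℂ :=
  (M.map fun μ => c * onShellLow p μ).prod

/-- The invariant measure `(2π)^{-3} d𝐩 / (2 ‖𝐩‖)` of the forward light cone. -/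
def coneMeasure : Measure Mom :=
  volume.withDensity fun p => ENNReal.ofReal (((2 * Real.pi) ^ 3 * (2 * ‖p‖))⁻¹)

/-- Continuous and rapidly decreasing functions. -/
def RapidlyDecreasing {E : Type*} [NormedAddCommGroup E] (F : E → ℂ) : Prop :=
  Continuous F ∧ ∀ k : ℕ, ∃ C : ℝ, ∀ x, (1 + ‖x‖) ^ k * ‖F x‖ ≤ C

/-- Continuous functions of polynomial growth. -/
def PolyBounded {E : Type*} [NormedAddCommGroup E] (F : E → ℂ) : Prop :=
  Continuous F ∧ ∃ k : ℕ, ∃ C : ℝ, ∀ x, ‖F x‖ ≤ C * (1 + ‖x‖) ^ k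

/-- Graded symmetry of an `n`-particle wave function. -/
def GradedSymm {n : ℕ} (F : (Fin n → Label r) → ℂ) : Prop :=
  ∀ i j : Fin n, (j : ℕ) = i + 1 → ∀ z, F (z ∘ Equiv.swap i j) =
    (-1 : ℂ) ^ ((z i).1.parity * (z j).1.parity) * F z

/-- Sequences of `n`-particle functions, `n = 0, 1, 2, …`. -/
def PreFock (r : ℕ) : Type := (n : ℕ) → (Fin n → Label r) → ℂ

instance : AddCommGroup (PreFock r) :=
  inferInstanceAs (AddCommGroup ((n : ℕ) → (Fin n → Label r) → ℂ))

instance : Module ℂ (PreFock r) :=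
  inferInstanceAs (Module ℂ ((n : ℕ) → (Fin n → Label r) → ℂ))

@[simp] theorem PreFock.zero_apply (n : ℕ) : (0 : PreFock r) n = 0 := rfl

@[simp] theorem PreFock.add_apply (Ψ Φ : PreFock r) (n : ℕ) : (Ψ + Φ) n = Ψ n + Φ n := rfl

@[simp] theorem PreFock.smul_apply (c : ℂ) (Ψ : PreFock r) (n : ℕ) : (c • Ψ) n = c • Ψ n := rfl

/-- The algebraic Fock space: finite sequences of graded symmetric wave functions on the light cone
that are continuous and rapidly decreasing. The component of `ξ_s(x) Ω` at the label `(t, p)` is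
`δ_{st} exp (i p · x)`. -/
def Fock (r : ℕ) : Submodule ℂ (PreFock r) where
  carrier := {Ψ | (∃ N, ∀ n, N ≤ n → Ψ n = 0) ∧ (∀ n, GradedSymm (Ψ n)) ∧
    ∀ n (s : Fin n → Species r), RapidlyDecreasing fun p : Fin n → Mom => Ψ n fun i => (s i, p i)}
  zero_mem' := by
    refine ⟨⟨0, fun _ _ => rfl⟩, fun n i j _ z => by simp, fun n s => ⟨?_, fun k => ⟨0, fun x => ?_⟩⟩⟩
    · exact continuous_const
    · simp
  add_mem' := by
    rintro Ψ Φ ⟨⟨N, hN⟩, h2, h3⟩ ⟨⟨N', hN'⟩, h2', h3'⟩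
    refine ⟨⟨max N N', fun n hn => ?_⟩, fun n i j hij z => ?_, fun n s => ⟨?_, fun k => ?_⟩⟩
    · simp [hN n (le_trans (le_max_left _ _) hn), hN' n (le_trans (le_max_right _ _) hn)]
    · simp only [PreFock.add_apply, Pi.add_apply]
      rw [h2 n i j hij z, h2' n i j hij z]; ring
    · exact (h3 n s).1.add (h3' n s).1
    · obtain ⟨C, hC⟩ := (h3 n s).2 k
      obtain ⟨C', hC'⟩ := (h3' n s).2 k
      refine ⟨C + C', fun x => ?_⟩
      refine le_trans (mul_le_mul_of_nonneg_left (norm_add_le _ _) (by positivity)) ?_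
      rw [mul_add]
      exact add_le_add (hC x) (hC' x)
  smul_mem' := by
    rintro c Ψ ⟨⟨N, hN⟩, h2, h3⟩
    refine ⟨⟨N, fun n hn => ?_⟩, fun n i j hij z => ?_, fun n s => ⟨?_, fun k => ?_⟩⟩
    · simp [hN n hn]
    · simp only [PreFock.smul_apply, Pi.smul_apply, smul_eq_mul]
      rw [h2 n i j hij z]; ring
    · exact (h3 n s).1.const_smul c
    · obtain ⟨C, hC⟩ := (h3 n s).2 k
      refine ⟨‖c‖ * C, fun x => ?_⟩
      have := mul_le_mul_of_nonneg_left (hC x) (norm_nonneg c)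
      simp only [PreFock.smul_apply, Pi.smul_apply, smul_eq_mul, norm_mul]
      linarith

/-! ## Creation, annihilation and the gauge charge -/

/-- The part of the creation operator that maps `n`-particle to `(n+1)`-particle functions. -/
def createSum (s : Species r) (ψ : Mom → ℂ) {n : ℕ} (F : (Fin n → Label r) → ℂ)
    (z : Fin (n + 1) → Label r) : ℂ :=
  ∑ j, (∏ i, if i < j then (-1 : ℂ) ^ (s.parity * (z i).1.parity) else 1) *
    (if (z j).1 = s then ψ (z j).2 else 0) * F (z ∘ j.succAbove)

theorem createSum_succ (s : Species r) (ψ : Mom → ℂ) {n : ℕ} (F : (Fin (n + 1) → Label r) → ℂ)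
    (z : Fin (n + 2) → Label r) : createSum s ψ F z =
      (if (z 0).1 = s then ψ (z 0).2 else 0) * F (z ∘ Fin.succ) +
      (-1 : ℂ) ^ (s.parity * (z 0).1.parity) *
        createSum s ψ (fun y => F (Fin.cons (z 0) y)) (z ∘ Fin.succ) := by
  unfold createSum
  rw [Fin.sum_univ_succ]
  congr 1
  · have h : (0 : Fin (n + 2)).succAbove = Fin.succ := by ext; simp
    simp [h]
  · rw [Finset.mul_sum]
    refine Finset.sum_congr rfl fun j _ => ?_
    have h : (z ∘ j.succ.succAbove : Fin (n + 1) → Label r) =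
        Fin.cons (z 0) ((z ∘ Fin.succ) ∘ j.succAbove) := by
      ext i : 1
      refine Fin.cases ?_ (fun i => ?_) i
      · simp
      · simp
    rw [h, Fin.prod_univ_succ]
    simp [mul_assoc]

theorem createSum_const_mul (s : Species r) (ψ : Mom → ℂ) {n : ℕ} (F : (Fin n → Label r) → ℂ)
    (c : ℂ) (z : Fin (n + 1) → Label r) :
    createSum s ψ (fun y => c * F y) z = c * createSum s ψ F z := by
  unfold createSum
  rw [Finset.mul_sum]
  exact Finset.sum_congr rfl fun j _ => by ring

theorem comp_swap_succ {X : Type*} {m : ℕ} (i j : Fin m) (z : Fin (m + 1) → X) :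
    (z ∘ Equiv.swap i.succ j.succ) ∘ Fin.succ = (z ∘ Fin.succ) ∘ Equiv.swap i j := by
  funext k
  simp only [Function.comp]
  rw [(Fin.succ_injective m).swap_apply]

theorem cons_comp_swap {X : Type*} {m : ℕ} (i j : Fin m) (w : X) (y : Fin m → X) :
    (Fin.cons w (y ∘ Equiv.swap i j) : Fin (m + 1) → X) =
      (Fin.cons w y : Fin (m + 1) → X) ∘ Equiv.swap i.succ j.succ := by
  funext k
  refine Fin.cases ?_ (fun k => ?_) k
  · simp only [Function.comp]
    rw [Equiv.swap_apply_of_ne_of_ne (Fin.succ_ne_zero i).symm (Fin.succ_ne_zero j).symm]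
    simp
  · simp only [Function.comp]
    rw [(Fin.succ_injective m).swap_apply]
    simp

theorem gradedSymm_createSum (s : Species r) (ψ : Mom → ℂ) {n : ℕ}
    (F : (Fin n → Label r) → ℂ) (hF : GradedSymm F) : GradedSymm (createSum s ψ F) := by
  have sq : ∀ a : ℕ, ((-1 : ℂ) ^ a) * (-1) ^ a = 1 := fun a => by rw [← mul_pow]; norm_num
  induction n with
  | zero => intro i j hij; omega
  | succ n ih =>
    intro i j hij z
    have hj : ∃ j' : Fin (n + 1), j = j'.succ :=
      ⟨j.pred (fun h => by rw [h] at hij; simp at hij), by simp⟩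
    obtain ⟨j, rfl⟩ := hj
    have hG : ∀ w, GradedSymm fun y => F (Fin.cons w y) := by
      intro w a b hab y
      have := hF a.succ b.succ (by simp [hab]) (Fin.cons w y)
      simpa [cons_comp_swap] using this
    rcases Fin.eq_zero_or_eq_succ i with rfl | ⟨i, rfl⟩
    · have hj0 : j = 0 := by ext; simpa using hij
      subst hj0
      obtain ⟨a, z, rfl⟩ : ∃ a y, z = Fin.cons a y := ⟨z 0, z ∘ Fin.succ, (Fin.cons_self_tail z).symm⟩
      obtain ⟨b, z, rfl⟩ : ∃ a y, z = Fin.cons a y := ⟨z 0, z ∘ Fin.succ, (Fin.cons_self_tail z).symm⟩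
      have sw : ∀ {m : ℕ} (a b : Label r) (y : Fin m → Label r),
          (Fin.cons a (Fin.cons b y) : Fin (m + 2) → Label r) ∘ Equiv.swap 0 (Fin.succ 0) =
            Fin.cons b (Fin.cons a y) := by
        intro m a b y
        funext k
        refine Fin.cases ?_ (fun k => Fin.cases ?_ (fun k => ?_) k) k
        · simp
        · simp only [Function.comp, Equiv.swap_apply_right]; simp
        · simp only [Function.comp]
          rw [Equiv.swap_apply_of_ne_of_ne (Fin.succ_ne_zero _)
            (fun h => Fin.succ_ne_zero k (Fin.succ_injective _ h))]
          simp
      have cs : ∀ {m : ℕ} (a : Label r) (y : Fin m → Label r),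
          (Fin.cons a y : Fin (m + 1) → Label r) ∘ Fin.succ = y := by
        intro m a y; funext k; simp
      rw [sw]
      have ha : (if b.1 = s then ψ b.2 else 0) * (-1 : ℂ) ^ (s.parity * a.1.parity) =
          (if b.1 = s then ψ b.2 else 0) * (-1 : ℂ) ^ (a.1.parity * b.1.parity) := by
        split_ifs with h
        · rw [h, mul_comm s.parity]
        · simp
      have hb : (if a.1 = s then ψ a.2 else 0) * (-1 : ℂ) ^ (s.parity * b.1.parity) =
          (if a.1 = s then ψ a.2 else 0) * (-1 : ℂ) ^ (a.1.parity * b.1.parity) := by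
        split_ifs with h
        · rw [h]
        · simp
      have e := sq (a.1.parity * b.1.parity)
      rw [createSum_succ, createSum_succ, cs, cs]
      simp only [Fin.cons_zero, Fin.cons_succ]
      cases n with
      | zero =>
        have h1 : ∀ (G : (Fin 0 → Label r) → ℂ) (y : Fin 1 → Label r),
            createSum s ψ G y = (if (y 0).1 = s then ψ (y 0).2 else 0) * G z := by
          intro G y
          simp [createSum, Subsingleton.elim (y ∘ Fin.succ) z]
        rw [h1, h1]
        simp only [Fin.cons_zero]
        linear_combination (-(F (Fin.cons a z)) * (-1 : ℂ) ^ (a.1.parity * b.1.parity)) * ha +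
          (F (Fin.cons b z)) * hb -
          (if b.1 = s then ψ b.2 else 0) * F (Fin.cons a z) * e
      | succ m =>
        have h2 : (fun y => F (Fin.cons b (Fin.cons a y))) = fun y =>
            (-1 : ℂ) ^ (a.1.parity * b.1.parity) * F (Fin.cons a (Fin.cons b y)) := by
          funext y
          have := hF 0 (Fin.succ 0) (by simp) (Fin.cons a (Fin.cons b y))
          rw [sw] at this
          simpa using this
        rw [createSum_succ, createSum_succ, cs, cs]
        simp only [Fin.cons_zero]
        rw [h2, createSum_const_mul]
        linear_combination (-(F (Fin.cons a z)) * (-1 : ℂ) ^ (a.1.parity * b.1.parity)) * ha +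
          (F (Fin.cons b z)) * hb -
          (if b.1 = s then ψ b.2 else 0) * F (Fin.cons a z) * e
    · have hz : (z ∘ Equiv.swap i.succ j.succ) 0 = z 0 := by
        simp only [Function.comp]
        rw [Equiv.swap_apply_of_ne_of_ne (Fin.succ_ne_zero _).symm (Fin.succ_ne_zero _).symm]
      rw [createSum_succ, createSum_succ, hz, comp_swap_succ,
        hF i j (by simpa using hij), ih _ (hG _) i j (by simpa using hij)]
      simp only [Function.comp]
      ring

theorem RapidlyDecreasing.bound {E : Type*} [NormedAddCommGroup E] {F : E → ℂ}
    (h : RapidlyDecreasing F) (k : ℕ) : ∃ C : ℝ, 0 ≤ C ∧ ∀ x, (1 + ‖x‖) ^ k * ‖F x‖ ≤ C := by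
  obtain ⟨C, hC⟩ := h.2 k
  exact ⟨C, le_trans (by positivity) (hC 0), hC⟩

/-- The operator that adds one particle of species `s` with wave function `ψ`. -/
def create (s : Species r) (ψ : Mom → ℂ) (hψ : RapidlyDecreasing ψ) :
    Fock r →ₗ[ℂ] Fock r where
  toFun Ψ := ⟨fun n => match n with
    | 0 => 0
    | n + 1 => createSum s ψ (Ψ.1 n), by
    obtain ⟨Ψ, ⟨N, hN⟩, h2, h3⟩ := Ψ
    refine ⟨⟨N + 1, fun n hn => ?_⟩, fun n => ?_, fun n t => ?_⟩
    · cases n with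
      | zero => omega
      | succ n =>
        funext z
        simp [createSum, hN n (by omega)]
    · cases n with
      | zero => intro i; exact i.elim0
      | succ n => exact gradedSymm_createSum s ψ _ (h2 n)
    · cases n with
      | zero => exact ⟨continuous_const, fun k => ⟨0, fun x => by simp⟩⟩
      | succ n =>
        refine ⟨?_, fun k => ?_⟩
        · refine continuous_finsetSum _ fun j _ => ?_
          refine Continuous.mul (Continuous.mul ?_ ?_) ?_
          · dsimp only
            exact continuous_const
          · by_cases h : t j = s
            · simp only [h, if_true]
              exact hψ.1.comp (continuous_apply j)
            · simp only [h, if_false]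
              exact continuous_const
          · exact (h3 n (t ∘ j.succAbove)).1.comp
              (continuous_pi fun i => (continuous_apply (j.succAbove i) :
                Continuous fun p : Fin (n + 1) → Mom => p (j.succAbove i)))
        · obtain ⟨C, hC0, hC⟩ := hψ.bound k
          choose D hD0 hD using fun j : Fin (n + 1) => (h3 n (t ∘ j.succAbove)).bound k
          refine ⟨∑ j, C * D j, fun p => ?_⟩
          refine le_trans (mul_le_mul_of_nonneg_left (norm_sum_le _ _) (by positivity)) ?_
          rw [Finset.mul_sum]
          refine Finset.sum_le_sum fun j _ => ?_
          have hsgn : ‖∏ i, if i < j then (-1 : ℂ) ^ (s.parity * (t i).parity) else 1‖ = 1 := by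
            rw [norm_prod]
            refine Finset.prod_eq_one fun i _ => ?_
            split_ifs <;> simp
          have hif : ‖if t j = s then ψ (p j) else 0‖ ≤ ‖ψ (p j)‖ := by
            split_ifs <;> simp
          have hp : 1 + ‖p‖ ≤ (1 + ‖p j‖) * (1 + ‖p ∘ j.succAbove‖) := by
            have h1 : ‖p‖ ≤ ‖p j‖ + ‖p ∘ j.succAbove‖ := by
              refine (pi_norm_le_iff_of_nonneg (by positivity)).2 fun i => ?_
              rcases Fin.eq_self_or_eq_succAbove j i with rfl | ⟨i, rfl⟩
              · exact le_add_of_nonneg_right (norm_nonneg _)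
              · exact le_trans (norm_le_pi_norm (p ∘ j.succAbove) i)
                  (le_add_of_nonneg_left (norm_nonneg _))
            nlinarith [norm_nonneg (p j), norm_nonneg (p ∘ j.succAbove)]
          have hk : (1 + ‖p‖) ^ k ≤ (1 + ‖p j‖) ^ k * (1 + ‖p ∘ j.succAbove‖) ^ k := by
            rw [← mul_pow]
            exact pow_le_pow_left₀ (by positivity) hp k
          rw [norm_mul, norm_mul, hsgn, one_mul]
          refine le_trans (mul_le_mul hk (mul_le_mul_of_nonneg_right hif (norm_nonneg _))
            (by positivity) (by positivity)) ?_
          have e1 := hC (p j)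
          have e2 := hD j (p ∘ j.succAbove)
          refine le_trans (le_of_eq ?_) (mul_le_mul e1 e2 (by positivity) hC0)
          simp only [Function.comp_def]
          ring⟩
  map_add' Ψ Φ := by
    refine Subtype.ext (funext fun n => funext fun z => ?_)
    cases n with
    | zero => exact (add_zero (0 : ℂ)).symm
    | succ n =>
      change createSum s ψ (Ψ.1 n + Φ.1 n) z = createSum s ψ (Ψ.1 n) z + createSum s ψ (Φ.1 n) z
      simp only [createSum, Pi.add_apply, mul_add, Finset.sum_add_distrib]
  map_smul' c Ψ := by
    refine Subtype.ext (funext fun n => funext fun z => ?_)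
    cases n with
    | zero => exact (mul_zero c).symm
    | succ n => exact createSum_const_mul s ψ (Ψ.1 n) c z

theorem integrable_coneMeasure :
    Integrable (fun p : Mom => ((1 + ‖p‖) ^ 4)⁻¹) coneMeasure := by
  unfold coneMeasure
  rw [integrable_withDensity_iff_integrable_smul' (by fun_prop)
    (Filter.Eventually.of_forall fun _ => ENNReal.ofReal_lt_top)]
  have h := (integrable_fun_norm_addHaar (volume : Measure Mom)
    (f := fun y : ℝ => (ENNReal.ofReal (((2 * Real.pi) ^ 3 * (2 * y))⁻¹)).toReal •
      ((1 + y) ^ 4)⁻¹)).2 ?_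
  · exact h
  · have hb : Integrable (fun y : ℝ => (2 * (2 * Real.pi) ^ 3)⁻¹ * (1 + ‖y‖) ^ (-(2 : ℝ))) :=
      (integrable_one_add_norm (by simp)).const_mul _
    refine Integrable.mono' hb.integrableOn (Measurable.aestronglyMeasurable (by fun_prop)) ?_
    refine (ae_restrict_iff' measurableSet_Ioi).2 (Filter.Eventually.of_forall fun y hy => ?_)
    have hy : 0 < y := hy
    have hd : Module.finrank ℝ Mom - 1 = 2 := by simp
    rw [hd, ENNReal.toReal_ofReal (by positivity), Real.norm_of_nonneg (by positivity),
      Real.norm_of_nonneg hy.le, Real.rpow_neg (by positivity)]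
    simp only [smul_eq_mul]
    have h2 : (1 + y) ^ (2 : ℝ) = (1 + y) ^ 2 := by norm_cast
    rw [h2]
    have key : y ^ 2 * (((2 * Real.pi) ^ 3 * (2 * y))⁻¹ * ((1 + y) ^ 4)⁻¹) =
        (2 * (2 * Real.pi) ^ 3)⁻¹ * (y * ((1 + y) ^ 4)⁻¹) := by
      field_simp
    rw [key]
    refine mul_le_mul_of_nonneg_left ?_ (by positivity)
    rw [← div_eq_mul_inv, inv_eq_one_div, div_le_div_iff₀ (by positivity) (by positivity)]
    nlinarith [pow_pos hy 2, pow_pos hy 3, pow_pos hy 4]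

theorem integrand_bound {n : ℕ} {χ : Mom → ℂ} (hχ : PolyBounded χ) {s : Species r}
    {F : (Fin (n + 1) → Label r) → ℂ} (t : Fin n → Species r)
    (hF : RapidlyDecreasing fun p : Fin (n + 1) → Mom =>
      F fun i => ((Fin.cons s t : Fin (n + 1) → Species r) i, p i)) (m : ℕ) :
    ∃ C : ℝ, ∀ (k : Mom) (p : Fin n → Mom), (1 + ‖p‖) ^ m *
      ‖χ k * F (Fin.cons (s, k) fun i => (t i, p i))‖ ≤ C * ((1 + ‖k‖) ^ 4)⁻¹ := by
  obtain ⟨-, a, A, hA⟩ := hχ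
  have hA0 : 0 ≤ A := by simpa using le_trans (norm_nonneg _) (hA 0)
  obtain ⟨B, hB0, hB⟩ := hF.bound (a + 4 + m)
  refine ⟨A * B, fun k p => ?_⟩
  have hz : (Fin.cons (s, k) fun i => (t i, p i) : Fin (n + 1) → Label r) =
      fun i => ((Fin.cons s t : Fin (n + 1) → Species r) i,
        (Fin.cons k p : Fin (n + 1) → Mom) i) := by
    funext i
    refine Fin.cases ?_ (fun i => ?_) i <;> simp
  have h1 : ‖k‖ ≤ ‖(Fin.cons k p : Fin (n + 1) → Mom)‖ := by
    simpa using norm_le_pi_norm (Fin.cons k p : Fin (n + 1) → Mom) 0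
  have h2 : ‖p‖ ≤ ‖(Fin.cons k p : Fin (n + 1) → Mom)‖ :=
    (pi_norm_le_iff_of_nonneg (norm_nonneg _)).2 fun i => by
      simpa using norm_le_pi_norm (Fin.cons k p : Fin (n + 1) → Mom) i.succ
  rw [hz, norm_mul]
  have hb := hB (Fin.cons k p)
  set X := ‖F fun i => ((Fin.cons s t : Fin (n + 1) → Species r) i,
        (Fin.cons k p : Fin (n + 1) → Mom) i)‖ with hX
  have hX0 : 0 ≤ X := norm_nonneg _
  have h3 : (1 + ‖k‖) ^ (a + 4) * (1 + ‖p‖) ^ m * X ≤ B := by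
    refine le_trans (mul_le_mul_of_nonneg_right ?_ hX0) hb
    rw [pow_add _ (a + 4) m]
    gcongr
  rw [← div_eq_mul_inv, le_div_iff₀ (by positivity)]
  calc (1 + ‖p‖) ^ m * (‖χ k‖ * X) * (1 + ‖k‖) ^ 4
      ≤ (1 + ‖p‖) ^ m * ((A * (1 + ‖k‖) ^ a) * X) * (1 + ‖k‖) ^ 4 := by
        have := hA k
        gcongr
    _ = A * ((1 + ‖k‖) ^ (a + 4) * (1 + ‖p‖) ^ m * X) := by ring
    _ ≤ A * B := mul_le_mul_of_nonneg_left h3 hA0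

theorem continuous_integrand {n : ℕ} {s : Species r}
    {F : (Fin (n + 1) → Label r) → ℂ} (t : Fin n → Species r)
    (hF : RapidlyDecreasing fun p : Fin (n + 1) → Mom =>
      F fun i => ((Fin.cons s t : Fin (n + 1) → Species r) i, p i)) :
    Continuous fun x : Mom × (Fin n → Mom) => F (Fin.cons (s, x.1) fun i => (t i, x.2 i)) := by
  have hc : Continuous fun x : Mom × (Fin n → Mom) => (Fin.cons x.1 x.2 : Fin (n + 1) → Mom) := by
    refine continuous_pi fun i => ?_
    refine Fin.cases ?_ (fun i => ?_) i
    · simpa using continuous_fst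
    · simp only [Fin.cons_succ]
      exact (continuous_apply i).comp continuous_snd
  convert hF.1.comp hc using 2 with x
  simp only [Function.comp]
  congr 1
  funext i
  refine Fin.cases ?_ (fun i => ?_) i <;> simp

theorem Fock.cons_regular (Ψ : Fock r) (n : ℕ) (s : Species r) (t : Fin n → Species r) :
    RapidlyDecreasing fun p : Fin (n + 1) → Mom =>
      Ψ.1 (n + 1) fun i => ((Fin.cons s t : Fin (n + 1) → Species r) i, p i) :=
  Ψ.2.2.2 (n + 1) (Fin.cons s t)

theorem Fock.integrable (Ψ : Fock r) {χ : Mom → ℂ} (hχ : PolyBounded χ) {n : ℕ} (s : Species r)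
    (z : Fin n → Label r) :
    Integrable (fun k => χ k * Ψ.1 (n + 1) (Fin.cons (s, k) z)) coneMeasure := by
  obtain ⟨C, hC⟩ := integrand_bound hχ (fun i => (z i).1) (Fock.cons_regular Ψ n s _) 0
  have hc := continuous_integrand (fun i => (z i).1) (Fock.cons_regular Ψ n s _)
  refine Integrable.mono' (integrable_coneMeasure.const_mul C) ?_
    (Filter.Eventually.of_forall fun k => by simpa using hC k fun i => (z i).2)
  exact (hχ.1.mul (hc.comp (Continuous.prodMk_left fun i => (z i).2))).aestronglyMeasurable

/-- The operator that contracts the first particle of a state with the functions `χ t`. -/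
def annihilate (χ : Species r → Mom → ℂ) (hχ : ∀ t, PolyBounded (χ t)) :
    Fock r →ₗ[ℂ] Fock r where
  toFun Ψ := ⟨fun n z => ∑ t, ∫ k, χ t k * Ψ.1 (n + 1) (Fin.cons (t, k) z) ∂coneMeasure, by
    refine ⟨?_, fun n i j hij z => ?_, fun n s => ⟨?_, fun m => ?_⟩⟩
    · obtain ⟨N, hN⟩ := Ψ.2.1
      refine ⟨N, fun n hn => ?_⟩
      funext z
      simp [hN (n + 1) (by omega)]
    · rw [Finset.mul_sum]
      refine Finset.sum_congr rfl fun t _ => ?_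
      rw [← integral_const_mul]
      congr 1
      funext k
      rw [cons_comp_swap, Ψ.2.2.1 (n + 1) i.succ j.succ (by simp [hij])]
      simp only [Fin.cons_succ]
      ring
    · refine continuous_finsetSum _ fun t _ => ?_
      obtain ⟨C, hC⟩ := integrand_bound (hχ t) s (Fock.cons_regular Ψ n t s) 0
      have hc := continuous_integrand s (Fock.cons_regular Ψ n t s)
      refine continuous_of_dominated (bound := fun k => C * ((1 + ‖k‖) ^ 4)⁻¹) (fun p => ?_)
        (fun p => Filter.Eventually.of_forall fun k => ?_)
        (integrable_coneMeasure.const_mul C) (Filter.Eventually.of_forall fun k => ?_)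
      · exact (Fock.integrable Ψ (hχ t) t _).1
      · simpa using hC k p
      · exact continuous_const.mul (hc.comp (Continuous.prodMk_right k))
    · choose C hC using fun t => integrand_bound (hχ t) s (Fock.cons_regular Ψ n t s) m
      refine ⟨∑ t, ∫ k, C t * ((1 + ‖k‖) ^ 4)⁻¹ ∂coneMeasure, fun p => ?_⟩
      refine le_trans (mul_le_mul_of_nonneg_left (norm_sum_le _ _) (by positivity)) ?_
      rw [Finset.mul_sum]
      refine Finset.sum_le_sum fun t _ => ?_
      refine le_trans (mul_le_mul_of_nonneg_left (norm_integral_le_integral_norm _)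
        (by positivity)) ?_
      rw [← integral_const_mul]
      exact integral_mono ((Fock.integrable Ψ (hχ t) t _).norm.const_mul _)
        (integrable_coneMeasure.const_mul _) fun k => hC t k p⟩
  map_add' Ψ Φ := by
    refine Subtype.ext (funext fun n => funext fun z => ?_)
    change ∑ t, ∫ k, χ t k * (Ψ.1 (n + 1) (Fin.cons (t, k) z) + Φ.1 (n + 1) (Fin.cons (t, k) z))
        ∂coneMeasure = (∑ t, ∫ k, χ t k * Ψ.1 (n + 1) (Fin.cons (t, k) z) ∂coneMeasure) +
          ∑ t, ∫ k, χ t k * Φ.1 (n + 1) (Fin.cons (t, k) z) ∂coneMeasure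
    rw [← Finset.sum_add_distrib]
    refine Finset.sum_congr rfl fun t _ => ?_
    rw [← integral_add (Fock.integrable Ψ (hχ t) t z) (Fock.integrable Φ (hχ t) t z)]
    congr 1
    funext k
    ring
  map_smul' c Ψ := by
    refine Subtype.ext (funext fun n => funext fun z => ?_)
    change ∑ t, ∫ k, χ t k * (c * Ψ.1 (n + 1) (Fin.cons (t, k) z)) ∂coneMeasure =
      c * ∑ t, ∫ k, χ t k * Ψ.1 (n + 1) (Fin.cons (t, k) z) ∂coneMeasure
    rw [Finset.mul_sum]
    refine Finset.sum_congr rfl fun t _ => ?_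
    rw [← integral_const_mul]
    congr 1
    funext k
    ring

/-- Matrix elements of the gauge charge between basic fields: on one-particle states
`Q v_a^μ(x) Ω = i ∂^μ u_a(x) Ω`, `Q u_a(x) Ω = 0`, `Q ũ_a(x) Ω = - i ∂_μ v_a^μ(x) Ω`.
`gaugeCoeff s t p` is the amplitude for the species `t` to go into `s`. -/
def gaugeCoeff : Species r → Species r → Mom → ℂ
  | .u a, .v b μ, p => if a = b then -(onShell p μ : ℂ) else 0
  | .v a μ, .ut b, p => if a = b then onShellLow p μ else 0
  | _, _, _ => 0

theorem gaugeCoeff_parity (s t : Species r) (p : Mom) (h : s.parity + t.parity ≠ 1) :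
    gaugeCoeff s t p = 0 := by
  cases s <;> cases t <;> simp_all [gaugeCoeff, Species.parity]

theorem polyBounded_onShell (μ : Fin 4) : PolyBounded fun p => (onShell p μ : ℂ) := by
  refine Fin.cases ?_ (fun i => ?_) μ
  · refine ⟨?_, 1, 1, fun x => ?_⟩
    · simp only [onShell, Fin.cons_zero]
      fun_prop
    · simp [onShell]
  · refine ⟨?_, 1, 1, fun x => ?_⟩
    · simp only [onShell, Fin.cons_succ]
      fun_prop
    · have := PiLp.norm_apply_le x i
      simp only [onShell, Fin.cons_succ, Complex.norm_real, pow_one, one_mul]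
      linarith

theorem PolyBounded.mul {F G : Mom → ℂ} (hF : PolyBounded F) (hG : PolyBounded G) :
    PolyBounded fun p => F p * G p := by
  obtain ⟨hF, k, C, hC⟩ := hF
  obtain ⟨hG, l, D, hD⟩ := hG
  refine ⟨hF.mul hG, k + l, C * D, fun x => ?_⟩
  rw [norm_mul]
  refine le_trans (mul_le_mul (hC x) (hD x) (norm_nonneg _) (le_trans (norm_nonneg _) (hC x))) ?_
  rw [pow_add]
  exact le_of_eq (by ring)

theorem polyBounded_const (c : ℂ) : PolyBounded fun _ : Mom => c :=
  ⟨continuous_const, 0, ‖c‖, fun x => by simp⟩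

theorem polyBounded_onShellLow (μ : Fin 4) : PolyBounded fun p => onShellLow p μ :=
  (polyBounded_const _).mul (polyBounded_onShell μ)

theorem polyBounded_gaugeCoeff (s t : Species r) : PolyBounded (gaugeCoeff s t) := by
  have h0 := polyBounded_const 0
  cases s <;> cases t <;> try exact h0
  · rename_i a μ b
    by_cases h : a = b
    · convert polyBounded_onShellLow μ using 2 with p
      simp [gaugeCoeff, h]
    · convert h0 using 2 with p
      simp [gaugeCoeff, h]
  · rename_i a b μ
    by_cases h : a = b
    · convert (polyBounded_const (-1)).mul (polyBounded_onShell μ) using 2 with p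
      simp [gaugeCoeff, h]
    · convert h0 using 2 with p
      simp [gaugeCoeff, h]

/-- The action of the gauge charge on `n`-particle functions: `gaugeCoeff` acts as an odd
derivation on the tensor factors. -/
def gaugeSum {n : ℕ} (F : (Fin n → Label r) → ℂ) (z : Fin n → Label r) : ℂ :=
  ∑ j, (∏ i, if i < j then (-1 : ℂ) ^ (z i).1.parity else 1) *
    ∑ t, gaugeCoeff (z j).1 t (z j).2 * F (Function.update z j (t, (z j).2))

theorem gradedSymm_gaugeSum {n : ℕ} (F : (Fin n → Label r) → ℂ) (hF : GradedSymm F) :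
    GradedSymm (gaugeSum F) := by
  intro a b hab z
  have hne : a ≠ b := fun h => by rw [h] at hab; omega
  have sq : ∀ a : ℕ, ((-1 : ℂ) ^ a) * (-1) ^ a = 1 := fun a => by rw [← mul_pow]; norm_num
  unfold gaugeSum
  rw [← Equiv.sum_comp (Equiv.swap a b), Finset.mul_sum]
  refine Finset.sum_congr rfl fun j _ => ?_
  rw [Finset.mul_sum, Finset.mul_sum, Finset.mul_sum]
  refine Finset.sum_congr rfl fun t _ => ?_
  have hu : Function.update (z ∘ Equiv.swap a b) (Equiv.swap a b j) (t, (z j).2) =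
      Function.update z j (t, (z j).2) ∘ Equiv.swap a b := by
    funext i
    by_cases h : Equiv.swap a b i = j
    · have : i = Equiv.swap a b j := by rw [← h]; simp
      subst this
      simp
    · have h' : i ≠ Equiv.swap a b j := fun h' => h (by rw [h']; simp)
      simp [Function.update_of_ne h, Function.update_of_ne h']
  simp only [Function.comp_apply, Equiv.swap_apply_self]
  rw [hu, hF a b hab]
  by_cases hp : (z j).1.parity + t.parity = 1
  swap
  · rw [gaugeCoeff_parity _ _ _ hp]; simp
  have hS : (∏ i, if i < Equiv.swap a b j then
        (-1 : ℂ) ^ (z (Equiv.swap a b i)).1.parity else 1) =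
      ∏ i, if Equiv.swap a b i < Equiv.swap a b j then (-1 : ℂ) ^ (z i).1.parity else 1 := by
    rw [← Equiv.prod_comp (Equiv.swap a b)]
    simp
  rw [hS]
  have hlt : a < b := by rw [Fin.lt_def]; omega
  rcases eq_or_ne j a with rfl | hja
  · have h1 : (∏ i, if Equiv.swap j b i < Equiv.swap j b j then
          (-1 : ℂ) ^ (z i).1.parity else 1) =
        (-1 : ℂ) ^ (z b).1.parity * ∏ i, if i < j then (-1 : ℂ) ^ (z i).1.parity else 1 := by
      have h2 : ∀ i, (if Equiv.swap j b i < Equiv.swap j b j then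
            (-1 : ℂ) ^ (z i).1.parity else 1) =
          (if i = b then (-1 : ℂ) ^ (z i).1.parity else 1) *
            (if i < j then (-1 : ℂ) ^ (z i).1.parity else 1) := by
        intro i
        rw [Equiv.swap_apply_left]
        rcases eq_or_ne i j with rfl | hij
        · simp [hne]
        rcases eq_or_ne i b with rfl | hib
        · simp [hlt, hlt.not_gt]
        · rw [Equiv.swap_apply_of_ne_of_ne hij hib]
          have : i < b ↔ i < j := by
            rw [Fin.lt_def, Fin.lt_def]
            have := Fin.val_ne_of_ne hij
            have := Fin.val_ne_of_ne hib
            omega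
          simp [hib, this]
      rw [Finset.prod_congr rfl fun i _ => h2 i, Finset.prod_mul_distrib]
      simp
    have h3 : (-1 : ℂ) ^ (z b).1.parity * (-1) ^ (t.parity * (z b).1.parity) =
        (-1) ^ ((z j).1.parity * (z b).1.parity) := by
      rcases (by omega : (z j).1.parity = 0 ∧ t.parity = 1 ∨ (z j).1.parity = 1 ∧ t.parity = 0)
        with ⟨h, h'⟩ | ⟨h, h'⟩ <;> simp [h, h', sq]
    rw [h1, Function.update_self, Function.update_of_ne hne.symm, ← h3]
    ring
  · rcases eq_or_ne j b with rfl | hjb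
    · have h1 : (∏ i, if i < j then (-1 : ℂ) ^ (z i).1.parity else 1) =
          (-1 : ℂ) ^ (z a).1.parity * ∏ i, if Equiv.swap a j i < Equiv.swap a j j then
            (-1 : ℂ) ^ (z i).1.parity else 1 := by
        have h2 : ∀ i, (if i < j then (-1 : ℂ) ^ (z i).1.parity else 1) =
            (if i = a then (-1 : ℂ) ^ (z i).1.parity else 1) *
            (if Equiv.swap a j i < Equiv.swap a j j then
              (-1 : ℂ) ^ (z i).1.parity else 1) := by
          intro i
          rw [Equiv.swap_apply_right]
          rcases eq_or_ne i a with rfl | hia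
          · simp [hlt, hlt.not_gt]
          rcases eq_or_ne i j with rfl | hij
          · simp [hne.symm]
          · rw [Equiv.swap_apply_of_ne_of_ne hia hij]
            have : i < a ↔ i < j := by
              rw [Fin.lt_def, Fin.lt_def]
              have := Fin.val_ne_of_ne hia
              have := Fin.val_ne_of_ne hij
              omega
            simp [hia, this]
        rw [Finset.prod_congr rfl fun i _ => h2 i, Finset.prod_mul_distrib]
        simp
      have h3 : (-1 : ℂ) ^ ((z a).1.parity * (z j).1.parity) * (-1) ^ (z a).1.parity =
          (-1) ^ ((z a).1.parity * t.parity) := by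
        rcases (by omega : (z j).1.parity = 0 ∧ t.parity = 1 ∨ (z j).1.parity = 1 ∧ t.parity = 0)
          with ⟨h, h'⟩ | ⟨h, h'⟩ <;> simp [h, h', sq]
      rw [h1, Function.update_self, Function.update_of_ne hne, ← h3]
      ring
    · have h1 : ∀ i, Equiv.swap a b i < Equiv.swap a b j ↔ i < j := by
        intro i
        rw [Equiv.swap_apply_of_ne_of_ne hja hjb]
        have := Fin.val_ne_of_ne hja
        have := Fin.val_ne_of_ne hjb
        rcases eq_or_ne i a with rfl | hia
        · rw [Equiv.swap_apply_left, Fin.lt_def, Fin.lt_def]; omega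
        rcases eq_or_ne i b with rfl | hib
        · rw [Equiv.swap_apply_right, Fin.lt_def, Fin.lt_def]; omega
        · rw [Equiv.swap_apply_of_ne_of_ne hia hib]
      simp only [h1]
      rw [Function.update_of_ne hja.symm, Function.update_of_ne hjb.symm]
      ring

/-- The gauge charge `Q`; it annihilates the vacuum. -/
def gaugeCharge : Fock r →ₗ[ℂ] Fock r where
  toFun Ψ := ⟨fun n => gaugeSum (Ψ.1 n), by
    obtain ⟨Ψ, ⟨N, hN⟩, h2, h3⟩ := Ψ
    refine ⟨⟨N, fun n hn => ?_⟩, fun n => gradedSymm_gaugeSum _ (h2 n), fun n s => ?_⟩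
    · funext z
      simp [gaugeSum, hN n hn]
    · have hu : ∀ (j : Fin n) (t : Species r) (p : Fin n → Mom),
          Function.update (fun i => (s i, p i)) j (t, p j) =
            fun i => (Function.update s j t i, p i) := by
        intro j t p
        funext i
        rcases eq_or_ne i j with rfl | h
        · simp
        · simp [h]
      have hterm : ∀ (j : Fin n) (t : Species r), RapidlyDecreasing fun p : Fin n → Mom =>
          gaugeCoeff (s j) t (p j) * Ψ n (fun i => (Function.update s j t i, p i)) := by
        intro j t
        obtain ⟨hc, k, C, hC⟩ := polyBounded_gaugeCoeff (s j) t
        have hd := h3 n (Function.update s j t)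
        refine ⟨(hc.comp (continuous_apply j)).mul hd.1, fun m => ?_⟩
        obtain ⟨D, hD0, hD⟩ := hd.bound (m + k)
        have hC0 : 0 ≤ C := by simpa using le_trans (norm_nonneg _) (hC 0)
        refine ⟨C * D, fun p => ?_⟩
        rw [norm_mul]
        have h4 : (1 + ‖p j‖) ^ k ≤ (1 + ‖p‖) ^ k :=
          pow_le_pow_left₀ (by positivity) (by linarith [norm_le_pi_norm p j]) k
        have h5 := hC (p j)
        have h6 := hD p
        set X := ‖Ψ n fun i => (Function.update s j t i, p i)‖
        calc (1 + ‖p‖) ^ m * (‖gaugeCoeff (s j) t (p j)‖ * X)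
            ≤ (1 + ‖p‖) ^ m * ((C * (1 + ‖p‖) ^ k) * X) := by
              gcongr
              exact le_trans h5 (mul_le_mul_of_nonneg_left h4 hC0)
          _ = C * ((1 + ‖p‖) ^ (m + k) * X) := by ring
          _ ≤ C * D := mul_le_mul_of_nonneg_left h6 hC0
      have hrd : ∀ {ι : Type} (S : Finset ι) (G : ι → (Fin n → Mom) → ℂ),
          (∀ i ∈ S, RapidlyDecreasing (G i)) → RapidlyDecreasing fun p => ∑ i ∈ S, G i p := by
        intro ι S G hG
        refine ⟨continuous_finsetSum _ fun i hi => (hG i hi).1, fun k => ?_⟩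
        choose! D hD using fun i (hi : i ∈ S) => (hG i hi).2 k
        refine ⟨∑ i ∈ S, D i, fun p => ?_⟩
        refine le_trans (mul_le_mul_of_nonneg_left (norm_sum_le _ _) (by positivity)) ?_
        rw [Finset.mul_sum]
        exact Finset.sum_le_sum fun i hi => hD i hi p
      have hmul : ∀ (c : ℂ) (G : (Fin n → Mom) → ℂ), RapidlyDecreasing G →
          RapidlyDecreasing fun p => c * G p := by
        intro c G hG
        refine ⟨continuous_const.mul hG.1, fun k => ?_⟩
        obtain ⟨D, hD⟩ := hG.2 k
        refine ⟨‖c‖ * D, fun p => ?_⟩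
        rw [norm_mul, mul_left_comm]
        exact mul_le_mul_of_nonneg_left (hD p) (norm_nonneg c)
      have := hrd Finset.univ (fun (j : Fin n) p =>
        (∏ i, if i < j then (-1 : ℂ) ^ (s i).parity else 1) *
          ∑ t, gaugeCoeff (s j) t (p j) * Ψ n (fun i => (Function.update s j t i, p i)))
        fun j _ => hmul _ _ (hrd Finset.univ _ fun t _ => hterm j t)
      convert this using 2 with p
      simp only [gaugeSum, hu]⟩
  map_add' Ψ Φ := by
    refine Subtype.ext (funext fun n => funext fun z => ?_)
    change gaugeSum (Ψ.1 n + Φ.1 n) z = gaugeSum (Ψ.1 n) z + gaugeSum (Φ.1 n) z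
    simp only [gaugeSum, Pi.add_apply, mul_add, Finset.sum_add_distrib]
  map_smul' c Ψ := by
    refine Subtype.ext (funext fun n => funext fun z => ?_)
    change gaugeSum (c • Ψ.1 n) z = c * gaugeSum (Ψ.1 n) z
    simp only [gaugeSum, Pi.smul_apply, smul_eq_mul, Finset.mul_sum]
    exact Finset.sum_congr rfl fun j _ => Finset.sum_congr rfl fun t _ => by ring

theorem PolyBounded.mul_rapid {F G : Mom → ℂ} (hF : PolyBounded F) (hG : RapidlyDecreasing G) :
    RapidlyDecreasing fun p => F p * G p := by
  obtain ⟨hF, k, C, hC⟩ := hF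
  have hC0 : 0 ≤ C := by simpa using le_trans (norm_nonneg _) (hC 0)
  refine ⟨hF.mul hG.1, fun m => ?_⟩
  obtain ⟨D, hD⟩ := hG.2 (m + k)
  refine ⟨C * D, fun p => ?_⟩
  rw [norm_mul]
  calc (1 + ‖p‖) ^ m * (‖F p‖ * ‖G p‖)
      ≤ (1 + ‖p‖) ^ m * ((C * (1 + ‖p‖) ^ k) * ‖G p‖) := by
        have := hC p
        gcongr
    _ = C * ((1 + ‖p‖) ^ (m + k) * ‖G p‖) := by ring
    _ ≤ C * D := mul_le_mul_of_nonneg_left (hD p) hC0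

theorem RapidlyDecreasing.polyBounded {F : Mom → ℂ} (h : RapidlyDecreasing F) : PolyBounded F := by
  obtain ⟨C, hC⟩ := h.2 0
  exact ⟨h.1, 0, C, fun x => by simpa using hC x⟩

theorem continuous_waveVector : Continuous waveVector := by
  refine (PiLp.continuous_toLp 2 _).comp (continuous_pi fun i => ?_)
  refine Fin.cases ?_ (fun i => ?_) i
  · simp only [Fin.cons_zero]; fun_prop
  · simp only [Fin.cons_succ]; fun_prop

theorem norm_le_waveVector (p : Mom) : 1 + ‖p‖ ≤ 2 * Real.pi * (1 + ‖waveVector p‖) := by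
  have h := PiLp.norm_apply_le (waveVector p) 0
  have hpi : (1 : ℝ) ≤ 2 * Real.pi := by linarith [Real.pi_gt_three]
  have h0 : ‖waveVector p 0‖ = (2 * Real.pi)⁻¹ * ‖p‖ := by
    simp [waveVector, abs_of_pos Real.pi_pos]
  rw [h0] at h
  have h1 : ‖p‖ ≤ 2 * Real.pi * ‖waveVector p‖ := by
    calc ‖p‖ = 2 * Real.pi * ((2 * Real.pi)⁻¹ * ‖p‖) := by field_simp
      _ ≤ _ := by gcongr
  linarith

theorem rapid_comp (g : 𝓢(Mink, ℂ)) (w : Mom → Mink) (hw : Continuous w)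
    (hn : ∀ p, 1 + ‖p‖ ≤ 2 * Real.pi * (1 + ‖w p‖)) : RapidlyDecreasing fun p => g (w p) := by
  refine ⟨g.continuous.comp hw, fun k => ?_⟩
  have h1 := SchwartzMap.one_add_le_sup_seminorm_apply (𝕜 := ℝ) (m := (k, 0)) (le_refl k)
    (le_refl 0) g
  obtain ⟨C, h⟩ : ∃ C : ℝ, ∀ x, (1 + ‖x‖) ^ k * ‖g x‖ ≤ C :=
    ⟨_, fun x => by simpa using h1 x⟩
  refine ⟨(2 * Real.pi) ^ k * C, fun p => ?_⟩
  refine le_trans (mul_le_mul_of_nonneg_right (pow_le_pow_left₀ (by positivity) (hn p) k)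
    (norm_nonneg _)) ?_
  rw [mul_pow, mul_assoc]
  exact mul_le_mul_of_nonneg_left (h (w p)) (by positivity)

theorem rapid_hatPos (g : 𝓢(Mink, ℂ)) : RapidlyDecreasing (hatPos g) :=
  rapid_comp (𝓕 g) waveVector continuous_waveVector norm_le_waveVector

theorem rapid_hatNeg (g : 𝓢(Mink, ℂ)) : RapidlyDecreasing (hatNeg g) :=
  rapid_comp (𝓕 g) (fun p => -waveVector p) continuous_waveVector.neg fun p => by
    simpa using norm_le_waveVector p

theorem polyBounded_momPoly (c : ℂ) (M : Multiset (Fin 4)) : PolyBounded (momPoly c M) := by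
  induction M using Multiset.induction_on with
  | empty => simpa [momPoly] using! polyBounded_const 1
  | cons μ M ih =>
    have := ((polyBounded_const c).mul (polyBounded_onShellLow μ)).mul ih
    convert this using 2 with p
    simp [momPoly]

theorem polyBounded_exp_phase (x : Mink) :
    PolyBounded fun p => Complex.exp (-Complex.I * phase p x) := by
  refine ⟨?_, 0, 1, fun p => ?_⟩
  · unfold phase
    fun_prop
  · rw [Complex.norm_exp]
    simp

/-! ## The free fields -/

/-- The matrix `w` of the two-point functions
`⟨Ω, ξ_s(x) ξ_t(y) Ω⟩ = w_{st} ∫ exp (- i p · (x - y)) dμ(p)`, with `μ` the cone measure: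
`⟨v^μ v^ν⟩ ~ - η^{μν}`, `⟨u ũ⟩ ~ 1`, `⟨ũ u⟩ ~ -1`. -/
def twoPoint : Species r → Species r → ℂ
  | .v a μ, .v b ν => if a = b ∧ μ = ν then -eta μ else 0
  | .u a, .ut b => if a = b then 1 else 0
  | .ut a, .u b => if a = b then -1 else 0
  | _, _ => 0

/-- The smeared creation part `∫ g(x) ξ_p^{(+)}(x) dx`. -/
def fieldPlus (p : Jet r) (g : 𝓢(Mink, ℂ)) : Fock r →ₗ[ℂ] Fock r :=
  create p.1 (fun k => momPoly Complex.I p.2 k * hatPos g k)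
    ((polyBounded_momPoly _ _).mul_rapid (rapid_hatPos g))

/-- The smeared annihilation part `∫ g(x) ξ_p^{(-)}(x) dx`. -/
def fieldMinus (p : Jet r) (g : 𝓢(Mink, ℂ)) : Fock r →ₗ[ℂ] Fock r :=
  annihilate (fun t k => twoPoint p.1 t * (momPoly (-Complex.I) p.2 k * hatNeg g k))
    fun _ => (polyBounded_const _).mul
      ((polyBounded_momPoly _ _).mul_rapid (rapid_hatNeg g)).polyBounded

/-- The annihilation part `ξ_p^{(-)}(x)` at a point. -/
def fieldMinusAt (p : Jet r) (x : Mink) : Fock r →ₗ[ℂ] Fock r :=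
  annihilate (fun t k => twoPoint p.1 t *
      (momPoly (-Complex.I) p.2 k * Complex.exp (-Complex.I * phase k x)))
    fun _ => (polyBounded_const _).mul ((polyBounded_momPoly _ _).mul (polyBounded_exp_phase x))

/-- The smeared free field `ξ_p(g) = ∫ g(x) ξ_p(x) dx`, `ξ_{s;M} = ∂_M ξ_s`. -/
def field (p : Jet r) (g : 𝓢(Mink, ℂ)) : Module.End ℂ (Fock r) :=
  fieldPlus p g + fieldMinus p g

/-- The function `x ↦ ∫ D_{pq}(y - x) g(y) dy`. Here `[ξ_p(y), ξ_q(x)] = - i D_{pq}(y - x)`, i.e.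
`D_{st} = w_{st} D_0` for basic fields, with the Pauli-Jordan distribution of zero mass
`D_0(x) = i ∫ (exp (- i p · x) - exp (i p · x)) dμ(p)`, and `D_{pq}(y - x)` for the jets `(s; M)` and
`(t; N)` is `∂_M` in `y` and `∂_N` in `x` of `D_{st}(y - x)`. -/
def pauliJordan (p q : Jet r) (g : 𝓢(Mink, ℂ)) (x : Mink) : ℂ :=
  twoPoint p.1 q.1 * Complex.I * ∫ k,
    (momPoly (-Complex.I) p.2 k * momPoly Complex.I q.2 k * hatNeg g k *
        Complex.exp (Complex.I * phase k x) -
      momPoly Complex.I p.2 k * momPoly (-Complex.I) q.2 k * hatPos g k *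
        Complex.exp (-Complex.I * phase k x)) ∂coneMeasure

/-! ## The sesquilinear form and Wick monomials -/

/-- Gram matrix of the one-particle states for the indefinite sesquilinear form defined by the
two-point functions and the conjugation `v† = v`, `u† = u`, `ũ† = -ũ`. -/
def gram : Species r → Species r → ℂ
  | .v a μ, .v b ν => if a = b ∧ μ = ν then -eta μ else 0
  | .u a, .ut b => if a = b then 1 else 0
  | .ut a, .u b => if a = b then 1 else 0
  | _, _ => 0

/-- The sesquilinear form of the Fock space (conjugate linear in the first argument). -/
def form (Φ Ψ : Fock r) : ℂ :=
  ∑ᶠ n : ℕ, ((n.factorial : ℂ))⁻¹ * ∑ s : Fin n → Species r, ∑ t : Fin n → Species r,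
    ∫ p : Fin n → Mom, starRingEnd ℂ (Φ.1 n fun i => (s i, p i)) * (∏ i, gram (s i) (t i)) *
      Ψ.1 n (fun i => (t i, p i)) ∂(Measure.pi fun _ => coneMeasure)

/-- `ξ_s† = conjSign s ξ_s`. -/
def conjSign : Species r → ℂ
  | .ut _ => -1
  | _ => 1

/-- The matrix element `⟨Φ, :ξ_{q₁} ⋯ ξ_{q_k}:(x) Ψ⟩` of a Wick monomial, by
`:ξ_q W: = ξ_q^{(+)} :W: + (-1)^{|ξ_q| |W|} :W: ξ_q^{(-)}`. -/
def wickElement (x : Mink) : List (Jet r) → Fock r → Fock r → ℂ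
  | [], Φ, Ψ => form Φ Ψ
  | q :: W, Φ, Ψ => wickElement x W (conjSign q.1 • fieldMinusAt q x Φ) Ψ +
      (-1 : ℂ) ^ (q.parity * (W.map Jet.parity).sum) * wickElement x W Φ (fieldMinusAt q x Ψ)

/-! ## Operator-valued distributions and chronological products -/

/-- Configurations of `n` points. -/
abbrev Conf (n : ℕ) : Type := Fin n → Mink

/-- Operators on the algebraic Fock space smeared with test functions of `n` points. -/
abbrev OpDist (r n : ℕ) : Type := 𝓢(Conf n, ℂ) →ₗ[ℂ] Module.End ℂ (Fock r)

/-- The graded commutator of operators of Fermi parities `a` and `b`. -/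
def gradedComm (a b : ℕ) (A B : Module.End ℂ (Fock r)) : Module.End ℂ (Fock r) :=
  A * B - (-1 : ℂ) ^ (a * b) • (B * A)

/-- The graded commutator `d_Q E = [Q, E]` for `E` of parity `a`. -/
def dQOp {n : ℕ} (a : ℕ) (E : OpDist r n) : OpDist r n :=
  LinearMap.mulLeft ℂ (gaugeCharge : Module.End ℂ (Fock r)) ∘ₗ E -
    (-1 : ℂ) ^ a • (LinearMap.mulRight ℂ (gaugeCharge : Module.End ℂ (Fock r)) ∘ₗ E)

/-- The distribution `E(x_{σ 1}, …, x_{σ n})` in the variables `x_1, …, x_n`. -/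
def reorder {n : ℕ} (σ : Equiv.Perm (Fin n)) (E : OpDist r n) : OpDist r n :=
  E ∘ₗ (SchwartzMap.compCLMOfContinuousLinearEquiv ℂ
    (LinearEquiv.funCongrLeft ℝ Mink σ.symm).toContinuousLinearEquiv :
      𝓢(Conf n, ℂ) →L[ℂ] 𝓢(Conf n, ℂ)).toLinearMap

/-- The distributional derivative `∂E/∂x_l^μ`. -/
def pderivDist {n : ℕ} (l : Fin n) (μ : Fin 4) (E : OpDist r n) : OpDist r n :=
  -(E ∘ₗ (LineDeriv.lineDerivOpCLM ℂ 𝓢(Conf n, ℂ)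
    (Pi.single l (EuclideanSpace.single μ 1) : Conf n)).toLinearMap)

/-- The product `G(x_m) E(x_1, …, x_n)` with a function `G`. -/
def mulAt {n : ℕ} (m : Fin n) (G : Mink → ℂ) (E : OpDist r n) : OpDist r n :=
  E ∘ₗ (SchwartzMap.smulLeftCLM ℂ fun x : Conf n => G (x m)).toLinearMap

/-- `x ⪰ y`: the difference `x - y` lies in the (closed) upper causal cone. -/
def CausalGE (x y : Mink) : Prop :=
  0 ≤ x 0 - y 0 ∧ ∑ i : Fin 3, (x i.succ - y i.succ) ^ 2 ≤ (x 0 - y 0) ^ 2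

/-- States of Fermi parity `b` (mod 2). -/
def StateParity (Ψ : Fock r) (b : ℕ) : Prop :=
  ∀ n z, Ψ.1 n z ≠ 0 → (∑ i, (z i).1.parity) % 2 = b % 2

/-- Chronological products of Wick polynomials of the free fields, as operator-valued distributions
on the algebraic Fock space, with the Bogoliubov axioms of skew-symmetry, causality, the initial
condition and the Wick expansion property. (Poincaré covariance, the expression of the adjoints by
anti-chronological products and power counting, which restrict the choice further, are not imposed
here: of unitarity only the existence of adjoints is kept.) -/
structure ChronologicalProducts (r : ℕ) where
  /-- `T(A_1(x_1), …, A_n(x_n))`, extended to polynomials by linearity. -/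
  T : (n : ℕ) → MultilinearMap ℂ (fun _ : Fin n => Xi r) (OpDist r n)
  /-- The entries are Wick polynomials of the quantum fields, which obey the wave equation. -/
  onShell : ∀ (n : ℕ) (A : Fin n → Xi r) (l : Fin n) (B : Xi r) (p : Jet r),
    A l = B * boxXi p → T n A = 0
  /-- Matrix elements are tempered distributions. -/
  tempered : ∀ (n : ℕ) (A : Fin n → Xi r) (Φ Ψ : Fock r), Continuous fun φ => form Φ (T n A φ Ψ)
  /-- The operators have adjoints on the algebraic Fock space. -/
  adjoint : ∀ (n : ℕ) (A : Fin n → Xi r) (φ : 𝓢(Conf n, ℂ)), ∃ C : Module.End ℂ (Fock r),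
    ∀ Φ Ψ, form (C Φ) Ψ = form Φ (T n A φ Ψ)
  /-- The Fermi parity of `T(A_1, …, A_n)` is `|A_1| + ⋯ + |A_n|`. -/
  parity : ∀ (n : ℕ) (A : Fin n → Xi r) (a : Fin n → ℕ), (∀ l, HasParity (A l) (a l)) →
    ∀ φ Ψ b, StateParity Ψ b → StateParity (T n A φ Ψ) (b + ∑ l, a l)
  /-- Skew-symmetry. -/
  skew : ∀ (n : ℕ) (A : Fin n → Xi r) (a : Fin n → ℕ), (∀ l, HasParity (A l) (a l)) →
    ∀ i j : Fin n, (j : ℕ) = i + 1 →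
      T n A = (-1 : ℂ) ^ (a i * a j) • reorder (Equiv.swap i j) (T n (A ∘ Equiv.swap i j))
  /-- Causality: `T(A, B) = T(A) T(B)` when all the points of `A` are `⪰` all those of `B`. -/
  causal : ∀ (k l : ℕ), 0 < k → 0 < l → ∀ (A : Fin k → Xi r) (B : Fin l → Xi r)
    (φ : 𝓢(Conf k, ℂ)) (ψ : 𝓢(Conf l, ℂ)) (χ : 𝓢(Conf (k + l), ℂ)),
    (∀ x y, χ (Fin.append x y) = φ x * ψ y) →
    (∀ x ∈ tsupport φ, ∀ y ∈ tsupport ψ, ∀ i j, CausalGE (x i) (y j)) →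
      T (k + l) (Fin.append A B) χ = T k A φ * T l B ψ
  /-- Initial condition: `T(A(x))` is the Wick monomial of `A`. -/
  initial : ∀ (W : List (Jet r)) (φ : 𝓢(Conf 1, ℂ)) (Φ Ψ : Fock r),
    form Φ (T 1 (fun _ => (W.map xi).prod) φ Ψ) =
      ∫ x : Mink, φ (fun _ => x) * wickElement x W Φ Ψ
  /-- Wick expansion property. -/
  wick : ∀ (n : ℕ) (A : Fin n → Xi r) (a : Fin n → ℕ), (∀ l, HasParity (A l) (a l)) →
    ∀ (p : Jet r) (g : 𝓢(Mink, ℂ)) (φ : 𝓢(Conf n, ℂ)),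
      gradedComm p.parity (∑ l, a l) (field p g) (T n A φ) =
        -Complex.I • ∑ m, (∏ l, if l ≤ m then (-1 : ℂ) ^ (p.parity * a l) else 1) •
          ∑ᶠ q : Jet r,
            mulAt m (pauliJordan p q g) (T n (Function.update A m (dot q (A m)))) φ

/-! ## The interaction Lagrangian and its companions -/

/-- The field strength `F_a^{μν} = ∂^μ v_a^ν - ∂^ν v_a^μ`. -/
def fieldStrength (a : Fin r) (μ ν : Fin 4) : Xi r :=
  eta μ • xi (.v a ν, {μ}) - eta ν • xi (.v a μ, {ν})

/-- The polynomials `T^I`: `T = T^∅`, `T^μ`, `T^{μν}`, and `T^I = 0` for `|I| > 2`.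
A collection of indices is a list; `f` are the structure constants. -/
def lagr (f : Fin r → Fin r → Fin r → ℝ) : List (Fin 4) → Xi r
  | [] => ∑ a, ∑ b, ∑ c, (f a b c : ℂ) •
      ((1 / 2 : ℂ) • ∑ μ, ∑ ν, (eta μ * eta ν) •
          (xi (.v a μ, 0) * xi (.v b ν, 0) * fieldStrength c ν μ)
        + ∑ μ, xi (.u a, 0) * xi (.v b μ, 0) * xi (.ut c, {μ}))
  | [μ] => ∑ a, ∑ b, ∑ c, (f a b c : ℂ) •
      (∑ ν, eta ν • (xi (.u a, 0) * xi (.v b ν, 0) * fieldStrength c ν μ)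
        - (1 / 2 : ℂ) • eta μ • (xi (.u a, 0) * xi (.u b, 0) * xi (.ut c, {μ})))
  | [μ, ν] => ∑ a, ∑ b, ∑ c, (f a b c : ℂ) •
      ((1 / 2 : ℂ) • (xi (.u a, 0) * xi (.u b, 0) * fieldStrength c μ ν))
  | _ => 0

/-- The two kinds of expressions `A^I` in the gauge identities: `T^I` and `ξ_q · T^I`. -/
inductive Entry (r : ℕ) : Type
  | lag : Entry r
  | sub (q : Jet r) : Entry r

/-- The polynomial `A^I`. -/
def Entry.poly (f : Fin r → Fin r → Fin r → ℝ) : Entry r → List (Fin 4) → Xi r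
  | .lag, I => lagr f I
  | .sub q, I => dot q (lagr f I)

/-- The Fermi parity of `A^I` is `A.parity + |I|`. -/
def Entry.parity : Entry r → ℕ
  | .lag => 0
  | .sub q => q.parity

/-- `s A^I = d_Q A^I - i δ A^I`, with `δ A^I = ∂_μ A^{Iμ}`. -/
def sPoly (f : Fin r → Fin r → Fin r → ℝ) (A : Entry r) (I : List (Fin 4)) : Xi r :=
  dQ (A.poly f I) - Complex.I • ∑ μ, formalD μ (A.poly f (I ++ [μ]))

/-! ## The gauge identities -/

/-- The Fermi parity `f_l = |A_l| + |I_l|` of the entry `A_l^{I_l}`. -/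
def entryParity {n : ℕ} (A : Fin n → Entry r) (I : Fin n → List (Fin 4)) (l : Fin n) : ℕ :=
  (A l).parity + (I l).length

/-- The polynomials `A_1^{I_1}, …, A_n^{I_n}`. -/
def entries (f : Fin r → Fin r → Fin r → ℝ) {n : ℕ} (A : Fin n → Entry r)
    (I : Fin n → List (Fin 4)) (l : Fin n) : Xi r := (A l).poly f (I l)

/-- `δ T(A_1^{I_1}(x_1), …) = ∑_l (-1)^{s_l} ∂/∂x_l^μ T(…, A_l^{I_l μ}(x_l), …)`, where
`s_l = f_1 + ⋯ + f_{l-1}`. -/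
def deltaT (f : Fin r → Fin r → Fin r → ℝ) (𝒯 : ChronologicalProducts r) {n : ℕ}
    (A : Fin n → Entry r) (I : Fin n → List (Fin 4)) : OpDist r n :=
  ∑ l, (∏ j, if j < l then (-1 : ℂ) ^ entryParity A I j else 1) • ∑ μ,
    pderivDist l μ (𝒯.T n (Function.update (entries f A I) l ((A l).poly f (I l ++ [μ]))))

/-- `s T(A_1^{I_1}(x_1), …, A_n^{I_n}(x_n))`, with `s = d_Q - i δ`. -/
def sT (f : Fin r → Fin r → Fin r → ℝ) (𝒯 : ChronologicalProducts r) {n : ℕ}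
    (A : Fin n → Entry r) (I : Fin n → List (Fin 4)) : OpDist r n :=
  dQOp (∑ l, entryParity A I l) (𝒯.T n (entries f A I)) - Complex.I • deltaT f 𝒯 A I

/-- The gauge identities of rank one `G(1,n)`: exactly one entry is of the form `ξ_q · T^I`, and
`s T(A_1, …, A_n) = ∑_m (∏_{l<m} (-1)^{f_l}) T(A_1, …, s A_m, …, A_n)`. -/
def GaugeRankOne (f : Fin r → Fin r → Fin r → ℝ) (𝒯 : ChronologicalProducts r) (n : ℕ) : Prop :=
  ∀ (k : Fin n) (q : Jet r) (I : Fin n → List (Fin 4)),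
    let A : Fin n → Entry r := Function.update (fun _ => .lag) k (.sub q)
    sT f 𝒯 A I = ∑ m, (∏ l, if l < m then (-1 : ℂ) ^ entryParity A I l else 1) •
      𝒯.T n (Function.update (entries f A I) m (sPoly f (A m) (I m)))

end

end YangMills

open YangMills

namespace YangMills

noncomputable section

variable {r : ℕ}

/-! Commute a free field through both parts of `s T = d_Q T - i δ T`. For the first part, the graded
Jacobi identity (`commL_dQOpL`) gives, up to an overall sign, `d_Q [ξ_p, T] - [d_Q ξ_p, T]`. Here
`d_Q ξ_p` is again a linear combination of fields, because the charge on Fock space implements the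
formal derivation (`gaugeCharge_field`). For the second part, the commutator passes through the
derivatives `∂/∂x_l`. The Wick expansion then turns everything into contractions `D_{pq}(y - x_m)
T(…, ξ_q · A_m, …)`.

Compared with `∑_q D_{pq} s T(ξ_q · T^{I_m}, …)`, two terms are in excess: the commutator with `d_Q
ξ_p`, and the derivatives `∂/∂x_m` that fall on `D_{pq}(y - x_m)`. They are exactly what `∑_q D_{pq}
T(s(ξ_q · T^{I_m}), …)` supplies (`finsum_wickMap_sPoly`). By the chain rule, `ξ_q ·` commutes with
`d_Q` and `∂_μ` up to a change of the index `q`. That change moves onto `D_{pq}`: for `∂_μ` it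
differentiates the distribution, and for `d_Q` it becomes `d_Q ξ_p` because `[Q, [ξ_p, ξ_q]] = 0`
(`sum_dQCoeff_pauliJordan`). What is left is the contraction with `s T^{I_m}`. It vanishes because
`s T^I` is a combination of multiples of the field equations (`sPoly_lag_mem`), which chronological
products do not see, and because `□ D = 0` (`contraction_wickMap_of_mem`). This gives the commutator
formula, after bookkeeping of signs.

If `G(1,n)` holds, every bracket on the right vanishes: the other terms of the gauge identity
contain `s T^I`, hence field equations. So `s T` graded commutes with all free fields, and
irreducibility of the fields on Fock space makes it a number (`eq_smul_one_of_gradedComm`). Test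
functions whose Fourier transform meets only one half of the light cone isolate creation and
annihilation operators. The functional `⟨Ω, s T ·⟩` is represented by a state because `T` has
adjoints and `Q` is symmetric. Commuting with creators forces that state to be a multiple of the
vacuum; commuting with annihilators then determines all higher components by induction on the
particle number. The number is the vacuum expectation value of `s T`, a finite sum of derivatives of
tempered distributions, since `QΩ = 0`. -/

theorem neg_one_pow_congr {a b : ℕ} (h : a % 2 = b % 2) : (-1 : ℂ) ^ a = (-1) ^ b := by
  rw [← Nat.mod_add_div a 2, ← Nat.mod_add_div b 2, h]
  simp [pow_add, pow_mul]

theorem neg_one_pow_mul_self (a : ℕ) : (-1 : ℂ) ^ a * (-1) ^ a = 1 := by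
  rw [← mul_pow]; norm_num

/-! ### Parity, graded derivations and the products `ξ_q ·` on `Ξ`. -/

/-- Every element is a combination of words in the jet variables, and words are built by prepending
one letter. Leibniz rules for a single generator on the left therefore suffice for all that follows.
In the proof the claim is strengthened to stability of `P` under left multiplication, so that
products in the free algebra can be handled. -/
theorem Xi.induction {P : Xi r → Prop} (one : P 1) (mul : ∀ p X, P X → P (xi p * X))
    (add : ∀ X Y, P X → P Y → P (X + Y)) (smul : ∀ (c : ℂ) X, P X → P (c • X)) (X : Xi r) :
    P X := by
  obtain ⟨x, rfl⟩ := RingQuot.mkAlgHom_surjective ℂ (SuperComm r) X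
  suffices h : ∀ Y, P Y → P (RingQuot.mkAlgHom ℂ (SuperComm r) x * Y) by
    simpa using h 1 one
  induction x using FreeAlgebra.induction with
  | grade0 c => intro Y hY; simpa [Algebra.algebraMap_eq_smul_one] using smul c Y hY
  | grade1 p => intro Y hY; exact mul p Y hY
  | mul a b ha hb => intro Y hY; rw [map_mul, mul_assoc]; exact ha _ (hb _ hY)
  | add a b ha hb => intro Y hY; rw [map_add, add_mul]; exact add _ _ (ha _ hY) (hb _ hY)

@[simp] theorem gradeAut_xi (p : Jet r) : gradeAut (xi p) = (-1 : ℂ) ^ p.parity • xi p := by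
  simp [gradeAut, xi, RingQuot.liftAlgHom_mkAlgHom_apply]

theorem gradeAut_gradeAut (X : Xi r) : gradeAut (gradeAut X) = X := by
  induction X using Xi.induction with
  | one => simp
  | mul p X h => simp [h, smul_smul, neg_one_pow_mul_self]
  | add X Y hX hY => simp [hX, hY]
  | smul c X h => simp [h]

theorem gradeAut_pow_congr {a b : ℕ} (h : a % 2 = b % 2) :
    (gradeAut : Xi r →ₐ[ℂ] Xi r) ^ a = gradeAut ^ b := by
  have h2 : (gradeAut : Xi r →ₐ[ℂ] Xi r) ^ 2 = 1 := by
    ext X; simp [pow_two, AlgHom.mul_apply, gradeAut_gradeAut]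
  rw [← Nat.mod_add_div a 2, ← Nat.mod_add_div b 2, h]
  simp [pow_add, pow_mul, h2]

theorem gradeAut_pow_xi (k : ℕ) (p : Jet r) :
    (gradeAut ^ k) (xi p) = (-1 : ℂ) ^ (k * p.parity) • xi p := by
  induction k with
  | zero => simp
  | succ k ih =>
    rw [pow_succ, AlgHom.mul_apply, gradeAut_xi, map_smul, ih, smul_smul, ← pow_add]
    congr 2; ring

theorem HasParity.congr {X : Xi r} {a b : ℕ} (h : HasParity X a) (hab : a % 2 = b % 2) :
    HasParity X b := by
  rw [HasParity, ← neg_one_pow_congr hab]; exact h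

theorem HasParity.mul {X Y : Xi r} {a b : ℕ} (hX : HasParity X a) (hY : HasParity Y b) :
    HasParity (X * Y) (a + b) := by
  simp only [HasParity] at *
  rw [map_mul, hX, hY, smul_mul_smul_comm, pow_add]

theorem HasParity.add {X Y : Xi r} {a : ℕ} (hX : HasParity X a) (hY : HasParity Y a) :
    HasParity (X + Y) a := by
  simp only [HasParity] at *
  rw [map_add, hX, hY, smul_add]

theorem HasParity.smul {X : Xi r} {a : ℕ} (c : ℂ) (hX : HasParity X a) :
    HasParity (c • X) a := by
  simp only [HasParity] at *
  rw [map_smul, hX, smul_comm]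

theorem HasParity.sub {X Y : Xi r} {a : ℕ} (hX : HasParity X a) (hY : HasParity Y a) :
    HasParity (X - Y) a := by
  simp only [HasParity] at *
  rw [map_sub, hX, hY, smul_sub]

theorem HasParity.sum {ι : Type*} {S : Finset ι} {X : ι → Xi r} {a : ℕ}
    (h : ∀ i ∈ S, HasParity (X i) a) : HasParity (∑ i ∈ S, X i) a := by
  simp only [HasParity] at *
  rw [map_sum, Finset.smul_sum]
  exact Finset.sum_congr rfl h

theorem hasParity_zero (a : ℕ) : HasParity (0 : Xi r) a := by simp [HasParity]

theorem hasParity_xi (p : Jet r) : HasParity (xi p) p.parity := gradeAut_xi p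

section derivation

variable {ε : ℕ} {d : Jet r → Xi r}
  {hd : ∀ p q, xi p * d q = (-1 : ℂ) ^ (p.parity * (q.parity + ε)) • (d q * xi p)}

theorem derivHom_xi (p : Jet r) :
    derivHom ε d hd (xi p) = !![(-1 : ℂ) ^ (ε * p.parity) • xi p, d p; 0, xi p] := by
  simp [derivHom, xi, RingQuot.liftAlgHom_mkAlgHom_apply]

theorem derivHom_one_one (X : Xi r) : derivHom ε d hd X 1 1 = X := by
  induction X using Xi.induction with
  | one => simp
  | mul p X h => simp [derivHom_xi, Matrix.mul_apply, Fin.sum_univ_two, h]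
  | add X Y hX hY => simp [hX, hY]
  | smul c X h => simp [h]

theorem gradedDerivation_one : gradedDerivation ε d hd 1 = 0 := by
  simp [gradedDerivation]

/-- The Leibniz rule is the upper right entry of the product of two matrices; the lower diagonal
entry carries `X` itself by `derivHom_one_one`. -/
theorem gradedDerivation_xi_mul (p : Jet r) (X : Xi r) :
    gradedDerivation ε d hd (xi p * X) =
      d p * X + (-1 : ℂ) ^ (ε * p.parity) • (xi p * gradedDerivation ε d hd X) := by
  change (derivHom ε d hd (xi p * X)) 0 1 = _
  rw [map_mul, Matrix.mul_apply, Fin.sum_univ_two, derivHom_xi, derivHom_one_one]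
  simp [gradedDerivation, add_comm]

theorem gradedDerivation_xi (p : Jet r) : gradedDerivation ε d hd (xi p) = d p := by
  have := gradedDerivation_xi_mul (hd := hd) p 1
  simpa [gradedDerivation_one] using this

end derivation

theorem pd_xi_mul (q p : Jet r) (X : Xi r) : pd q (xi p * X) =
    (if p = q then X else 0) + (-1 : ℂ) ^ (q.parity * p.parity) • (xi p * pd q X) := by
  rw [pd, gradedDerivation_xi_mul]
  split_ifs <;> simp

theorem dot_apply (q : Jet r) (X : Xi r) : dot q X = pd q ((gradeAut ^ q.parity) X) := rfl

@[simp] theorem dot_one (q : Jet r) : dot q (1 : Xi r) = 0 := by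
  rw [dot_apply, map_one]; exact gradedDerivation_one

/-- The prefactor `(-1)^{|ξ_q||A|}` cancels the sign that the left derivative acquires when it
passes `ξ_p`. So `ξ_q ·` behaves like a derivation acting from the right: the sign appears in the
term where the first factor is hit. -/
theorem dot_xi_mul (q p : Jet r) (X : Xi r) : dot q (xi p * X) =
    (if p = q then (-1 : ℂ) ^ q.parity • (gradeAut ^ q.parity) X else 0) + xi p * dot q X := by
  rw [dot_apply, map_mul, gradeAut_pow_xi, smul_mul_assoc, map_smul, pd_xi_mul, smul_add,
    smul_smul, neg_one_pow_mul_self, one_smul, ← dot_apply]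
  congr 1
  split_ifs with h
  · subst h
    congr 1
    -- A parity is 0 or 1 and equals its own square, so `(-1)^{|q||q|} = (-1)^{|q|}`.
    rcases p with ⟨_ | _ | _, M⟩ <;> simp [Jet.parity, Species.parity]
  · simp

/-- Prepending `ξ_p` adds at most the index `p`. This makes the sums over infinitely many jet
variables in the Wick expansion finite. -/
theorem finite_support_dot (X : Xi r) : (Function.support fun q => dot q X).Finite := by
  induction X using Xi.induction with
  | one => simp
  | mul p X h =>
    refine (h.insert p).subset fun q hq => ?_
    by_contra hn
    simp only [Set.mem_insert_iff, Function.mem_support, not_or, not_not] at hn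
    refine hq ?_
    dsimp only
    rw [dot_xi_mul, if_neg fun h => hn.1 h.symm, hn.2]; simp
  | add X Y hX hY =>
    refine (hX.union hY).subset fun q hq => ?_
    by_contra hn
    simp only [Set.mem_union, Function.mem_support, not_or, not_not] at hn
    exact hq (by simp [hn])
  | smul c X h =>
    refine h.subset fun q hq hn => hq ?_
    simp only at hn
    simp [hn]

/-- The version with the generator on the right is needed for multiples `B * boxXi p` of the field
equations, where the linear factor stands last. -/
theorem dot_mul_xi (q p : Jet r) (X : Xi r) : dot q (X * xi p) =
    (-1 : ℂ) ^ (q.parity * p.parity) • (dot q X * xi p) +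
      (if p = q then (-1 : ℂ) ^ q.parity • X else 0) := by
  induction X using Xi.induction with
  | one => have := dot_xi_mul q p 1; simpa using this
  | mul p' X h =>
    rw [mul_assoc, dot_xi_mul, h, dot_xi_mul, map_mul]
    simp only [mul_add, add_mul, mul_smul_comm, smul_add, mul_assoc]
    rw [gradeAut_pow_xi]
    split_ifs <;> simp only [smul_mul_assoc, mul_smul_comm, mul_zero, zero_mul] <;> module
  | add X Y hX hY =>
    rw [add_mul, map_add, map_add, hX, hY]
    split_ifs <;> simp [add_mul]
    abel
  | smul c X h =>
    rw [smul_mul_assoc, map_smul, map_smul, h]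
    simp only [smul_add, smul_mul_assoc]
    rw [smul_comm c]
    congr 1
    split_ifs
    · rw [smul_comm]
    · rw [smul_zero]

theorem gradeAut_dot (q : Jet r) (X : Xi r) :
    gradeAut (dot q X) = (-1 : ℂ) ^ q.parity • dot q (gradeAut X) := by
  induction X using Xi.induction with
  | one => simp
  | mul p X h =>
    rw [dot_xi_mul, map_mul, gradeAut_xi, smul_mul_assoc, map_smul, dot_xi_mul, map_add, map_mul, h,
      gradeAut_xi]
    have hc : gradeAut ((gradeAut ^ q.parity) X) = (gradeAut ^ q.parity) (gradeAut X) := by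
      rw [← AlgHom.mul_apply, ← AlgHom.mul_apply, ← pow_succ, ← pow_succ']
    simp only [smul_add, smul_mul_assoc, mul_smul_comm, smul_smul]
    congr 1
    split_ifs with hp
    · subst hp
      rw [map_smul, hc, smul_smul, mul_assoc, neg_one_pow_mul_self, mul_one]
    · simp
  | add X Y hX hY => simp [hX, hY]
  | smul c X h => rw [map_smul, map_smul, h, map_smul, map_smul, smul_comm]

theorem HasParity.dot {X : Xi r} {a : ℕ} (h : HasParity X a) (q : Jet r) :
    HasParity (dot q X) (q.parity + a) := by
  simp only [HasParity] at *
  rw [gradeAut_dot, h, map_smul, smul_smul, pow_add]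

/-- The linear form `∑ c_q ξ_q` in the jet variables. -/
def linXi : (Jet r →₀ ℂ) →ₗ[ℂ] Xi r := Finsupp.linearCombination ℂ xi

theorem linXi_single (q : Jet r) (c : ℂ) : linXi (Finsupp.single q c) = c • xi q := by
  simp [linXi]

theorem dot_linXi_mul (q : Jet r) (c : Jet r →₀ ℂ) (X : Xi r) : dot q (linXi c * X) =
    ((-1 : ℂ) ^ q.parity * c q) • (gradeAut ^ q.parity) X + linXi c * dot q X := by
  induction c using Finsupp.induction_linear with
  | zero => simp
  | add c d hc hd =>
    rw [map_add, add_mul, map_add, hc, hd, add_mul, Finsupp.add_apply, mul_add, add_smul]; abel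
  | single p a =>
    rw [linXi_single, smul_mul_assoc, map_smul, dot_xi_mul, Finsupp.single_apply]
    split_ifs <;> simp [smul_smul, mul_comm]

theorem gradeAut_linXi {c : Jet r →₀ ℂ} {k : ℕ}
    (hc : ∀ q, c q ≠ 0 → q.parity % 2 = k % 2) : gradeAut (linXi c) = (-1 : ℂ) ^ k • linXi c := by
  rw [linXi, Finsupp.linearCombination_apply, Finsupp.sum, map_sum, Finset.smul_sum]
  refine Finset.sum_congr rfl fun q hq => ?_
  rw [map_smul, gradeAut_xi, smul_comm, neg_one_pow_congr (hc q (Finsupp.mem_support_iff.1 hq))]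

/-- The operator `∑ c_q (ξ_q ·)`. -/
def dotSum (c : Jet r → ℂ) : Xi r →ₗ[ℂ] Xi r where
  toFun X := ∑ᶠ q, c q • dot q X
  map_add' X Y := by
    have fin : ∀ Y : Xi r, (Function.support fun q' => c q' • dot q' Y).Finite := fun Y =>
      (finite_support_dot Y).subset fun q' h h' => h (by simp only at h'; simp [h'])
    simp only [map_add, smul_add]
    exact finsum_add_distrib (fin X) (fin Y)
  map_smul' a X := by
    have fin : ∀ Y : Xi r, (Function.support fun q' => c q' • dot q' Y).Finite := fun Y =>
      (finite_support_dot Y).subset fun q' h h' => h (by simp only at h'; simp [h'])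
    simp only [map_smul, RingHom.id_apply]
    rw [smul_finsum' a (fin X)]
    exact finsum_congr fun q => smul_comm _ _ _

theorem dotSum_apply (c : Jet r → ℂ) (X : Xi r) : dotSum c X = ∑ᶠ q, c q • dot q X := rfl

theorem dotSum_one (c : Jet r → ℂ) : dotSum c (1 : Xi r) = 0 := by
  simp [dotSum_apply]

theorem dotSum_xi_mul (c : Jet r → ℂ) (p : Jet r) (X : Xi r) : dotSum c (xi p * X) =
    (c p * (-1) ^ p.parity) • (gradeAut ^ p.parity) X + xi p * dotSum c X := by
  have fin : (Function.support fun q' => c q' • dot q' X).Finite :=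
    (finite_support_dot X).subset fun q' h h' => h (by simp only at h'; simp [h'])
  have e : ∀ q, c q • dot q (xi p * X) = (if q = p then (c p * (-1) ^ p.parity) •
      (gradeAut ^ p.parity) X else 0) + xi p * (c q • dot q X) := by
    intro q
    rw [dot_xi_mul, smul_add, mul_smul_comm]
    congr 1
    by_cases h : q = p
    · subst h
      simp only [if_true, smul_smul]
    · rw [if_neg h, if_neg fun h' => h h'.symm, smul_zero]
  rw [dotSum_apply, finsum_congr e, finsum_add_distrib, dotSum_apply, mul_finsum' _ _ fin]
  · congr 1
    rw [finsum_eq_single _ p fun q hq => if_neg hq, if_pos rfl]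
  · refine (Set.finite_singleton p).subset fun q hq => ?_
    by_contra h
    exact hq (if_neg h)
  · exact fin.subset fun q' h h' => h (by simp only at h'; simp only [h', mul_zero])

section chain

variable {ε : ℕ} {K : Jet r → Jet r →₀ ℂ}
  (hd : ∀ p q, xi p * linXi (K q) = (-1 : ℂ) ^ (p.parity * (q.parity + ε)) • (linXi (K q) * xi p))
  (hK : ∀ p q, K p q ≠ 0 → q.parity % 2 = (p.parity + ε) % 2)

include hK in
theorem gradedDerivation_gradeAut (X : Xi r) :
    gradedDerivation ε _ hd (gradeAut X) = (-1 : ℂ) ^ ε • gradeAut (gradedDerivation ε _ hd X) := by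
  induction X using Xi.induction with
  | one => simp [gradedDerivation_one]
  | mul p X h =>
    rw [map_mul, gradeAut_xi, smul_mul_assoc, map_smul, gradedDerivation_xi_mul,
      gradedDerivation_xi_mul, h, map_add, map_smul, map_mul, map_mul, gradeAut_xi,
      gradeAut_linXi (hK p)]
    simp only [smul_add, smul_mul_assoc, mul_smul_comm, smul_smul]
    congr 2
    · rw [add_comm, pow_add, ← mul_assoc, neg_one_pow_mul_self, one_mul]
    · ring
  | add X Y hX hY => simp [hX, hY]
  | smul c X h => rw [map_smul, map_smul, h, map_smul, map_smul, smul_comm]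

include hK in
theorem gradedDerivation_gradeAut_pow (k : ℕ) (X : Xi r) :
    gradedDerivation ε _ hd ((gradeAut ^ k) X) =
      (-1 : ℂ) ^ (ε * k) • (gradeAut ^ k) (gradedDerivation ε _ hd X) := by
  induction k with
  | zero => simp
  | succ k ih =>
    rw [pow_succ', AlgHom.mul_apply, gradedDerivation_gradeAut hd hK, ih, map_smul, smul_smul,
      AlgHom.mul_apply, ← pow_add]
    congr 2; ring

include hK in
/-- The chain rule for the products `ξ_q ·` and a graded derivation with linear values on the
jet variables. -/
theorem dot_gradedDerivation (q : Jet r) (X : Xi r) :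
    dot q (gradedDerivation ε _ hd X) = gradedDerivation ε _ hd (dot q X) +
      (-1 : ℂ) ^ (ε * q.parity) • dotSum (fun q' => K q' q) ((gradeAut ^ ε) X) := by
  induction X using Xi.induction with
  | one => simp only [gradedDerivation_one, dot_one, map_zero, map_one, dotSum_one, smul_zero,
      add_zero]
  | mul p X h =>
    -- Unless the coefficient vanishes, `|q| ≡ |p| + ε`, so the two powers of the involution
    -- `gradeAut` agree and only a sign has to be compared.
    have h2 : ((-1 : ℂ) ^ (ε * q.parity) * ((-1 : ℂ) ^ (ε * p.parity) * (K p q * (-1) ^ p.parity))) •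
        (gradeAut ^ p.parity) ((gradeAut ^ ε) X) =
          ((-1 : ℂ) ^ q.parity * K p q) • (gradeAut ^ q.parity) X := by
      by_cases h : K p q = 0
      · simp only [h, zero_mul, mul_zero, zero_smul]
      · have hp := hK p q h
        rw [← AlgHom.mul_apply, ← pow_add, gradeAut_pow_congr hp]
        congr 1
        have e : (-1 : ℂ) ^ (ε * q.parity + (ε * p.parity + p.parity)) = (-1 : ℂ) ^ q.parity := by
          refine neg_one_pow_congr ?_
          rw [Nat.add_mod, Nat.mul_mod, hp]
          rcases Nat.mod_two_eq_zero_or_one ε with h | h <;>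
          rcases Nat.mod_two_eq_zero_or_one p.parity with h' | h' <;>
          simp [Nat.add_mod, Nat.mul_mod, h, h']
        rw [← e]; ring
    have h3 : gradedDerivation ε _ hd (if p = q then (-1 : ℂ) ^ q.parity • (gradeAut ^ q.parity) X else 0) =
        (-1 : ℂ) ^ (ε * p.parity) • (if p = q then (-1 : ℂ) ^ q.parity • (gradeAut ^ q.parity)
          (gradedDerivation ε _ hd X) else 0) := by
      split_ifs with h
      · subst h
        rw [map_smul, gradedDerivation_gradeAut_pow hd hK, smul_comm]
      · simp
    rw [gradedDerivation_xi_mul, map_add, map_smul, dot_linXi_mul, dot_xi_mul, h, dot_xi_mul,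
      map_add, gradedDerivation_xi_mul, map_mul, gradeAut_pow_xi, smul_mul_assoc, map_smul,
      dotSum_xi_mul, h3, ← h2]
    simp only [mul_add, mul_smul_comm]
    module
  | add X Y hX hY =>
    simp only [map_add, hX, hY, smul_add]
    abel
  | smul c X h =>
    simp only [map_smul, h, smul_add]
    rw [smul_comm c]

end chain

/-! ### The chain rules for `d_Q` and `∂_μ`. -/

theorem Xi.neg_smul (c : ℂ) (X : Xi r) : (-c) • X = -(c • X) := by
  rw [eq_neg_iff_add_eq_zero, ← add_smul, neg_add_cancel, zero_smul]

theorem Xi.smul_neg (c : ℂ) (X : Xi r) : c • (-X) = -(c • X) := by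
  rw [eq_neg_iff_add_eq_zero, ← smul_add, neg_add_cancel, smul_zero]

/-- The coefficients of `d_Q ξ_p` as a linear form in the jet variables. -/
def dQCoeff : Jet r → Jet r →₀ ℂ
  | (.v a μ, M) => Finsupp.single (.u a, μ ::ₘ M) (Complex.I * eta μ)
  | (.u _, _) => 0
  | (.ut a, M) => ∑ μ : Fin 4, Finsupp.single (.v a μ, μ ::ₘ M) (-Complex.I)

theorem linXi_dQCoeff (p : Jet r) : linXi (dQCoeff p) = dQGen p := by
  rcases p with ⟨_ | _ | _, M⟩
  · rw [dQCoeff, dQGen, linXi_single]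
  · simp [dQCoeff, dQGen]
  · simp [dQCoeff, dQGen, linXi_single, Finset.smul_sum]

theorem dQCoeff_parity (p q : Jet r) (h : dQCoeff p q ≠ 0) :
    q.parity % 2 = (p.parity + 1) % 2 := by
  rcases p with ⟨⟨a, μ⟩ | a | a, M⟩
  · rcases eq_or_ne ((.u a, μ ::ₘ M) : Jet r) q with rfl | hq
    · simp [Jet.parity, Species.parity]
    · exact (h (by rw [dQCoeff, Finsupp.single_apply, if_neg hq])).elim
  · simp [dQCoeff] at h
  · rw [dQCoeff, Finsupp.finsetSum_apply] at h
    obtain ⟨μ, -, hμ⟩ := Finset.exists_ne_zero_of_sum_ne_zero h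
    rcases eq_or_ne ((.v a μ, μ ::ₘ M) : Jet r) q with rfl | hq
    · simp [Jet.parity, Species.parity]
    · exact (hμ (by rw [Finsupp.single_apply, if_neg hq])).elim

theorem dQ_xi_mul (p : Jet r) (X : Xi r) :
    dQ (xi p * X) = dQGen p * X + (-1 : ℂ) ^ p.parity • (xi p * dQ X) := by
  rw [dQ, gradedDerivation_xi_mul, one_mul]

theorem dQ_xi (p : Jet r) : dQ (xi p) = dQGen p := gradedDerivation_xi p

theorem formalD_xi_mul (μ : Fin 4) (p : Jet r) (X : Xi r) :
    formalD μ (xi p * X) = xi (p.1, μ ::ₘ p.2) * X + xi p * formalD μ X := by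
  have := gradedDerivation_xi_mul (ε := 0) (d := fun p : Jet r => xi (p.1, μ ::ₘ p.2))
    (hd := fun p q => xi_mul_xi p (q.1, μ ::ₘ q.2)) p X
  rw [zero_mul, pow_zero, one_smul] at this
  exact this

theorem formalD_xi (μ : Fin 4) (p : Jet r) : formalD μ (xi p) = xi (p.1, μ ::ₘ p.2) :=
  gradedDerivation_xi p

theorem gradedDerivation_congr {ε : ℕ} {d d' : Jet r → Xi r} (h : d = d')
    (hd : ∀ p q, xi p * d q = (-1 : ℂ) ^ (p.parity * (q.parity + ε)) • (d q * xi p)) :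
    gradedDerivation ε d hd = gradedDerivation ε d' (h ▸ hd) := by
  subst h; rfl

/-- Brings `d_Q` into the shape required by `dot_gradedDerivation`: its values on generators are
linear forms with explicit coefficients. The same is done for `∂_μ` in `formalD_eq`. -/
theorem dQ_eq : ∃ hd, dQ = gradedDerivation (r := r) 1 (fun q => linXi (dQCoeff q)) hd :=
  ⟨_, gradedDerivation_congr (funext fun p => (linXi_dQCoeff p).symm) _⟩

theorem formalD_eq (μ : Fin 4) : ∃ hd, formalD μ = gradedDerivation (r := r) 0
    (fun q => linXi (Finsupp.single (q.1, μ ::ₘ q.2) 1)) hd :=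
  ⟨_, gradedDerivation_congr (funext fun p => by rw [linXi_single, one_smul]) _⟩

theorem HasParity.dQ {X : Xi r} {a : ℕ} (h : HasParity X a) : HasParity (dQ X) (a + 1) := by
  obtain ⟨hd, e⟩ := dQ_eq (r := r)
  have := gradedDerivation_gradeAut hd dQCoeff_parity X
  rw [← e, h, map_smul, pow_one] at this
  rw [HasParity, pow_succ, mul_neg, mul_one, Xi.neg_smul, this, Xi.neg_smul]
  simp

theorem HasParity.formalD {X : Xi r} {a : ℕ} (h : HasParity X a) (μ : Fin 4) :
    HasParity (formalD μ X) a := by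
  obtain ⟨hd, e⟩ := formalD_eq (r := r) μ
  have := gradedDerivation_gradeAut hd (fun p q hq => ?_) X
  · rw [← e, h, map_smul, pow_zero, one_smul] at this
    exact this.symm
  · rcases eq_or_ne ((p.1, μ ::ₘ p.2) : Jet r) q with rfl | h
    · rfl
    · exact (hq (by rw [Finsupp.single_apply, if_neg h])).elim

theorem dot_dQ (q : Jet r) {X : Xi r} {a : ℕ} (h : HasParity X a) :
    dot q (dQ X) = dQ (dot q X) +
      (-1 : ℂ) ^ (q.parity + a) • dotSum (fun q' => dQCoeff q' q) X := by
  obtain ⟨hd, e⟩ := dQ_eq (r := r)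
  have := dot_gradedDerivation hd dQCoeff_parity q X
  rw [← e, pow_one, h, map_smul, smul_smul, one_mul, ← pow_add] at this
  exact this

theorem dot_formalD (μ : Fin 4) (q : Jet r) (X : Xi r) :
    dot q (formalD μ X) = formalD μ (dot q X) +
      dotSum (fun q' => Finsupp.single (q'.1, μ ::ₘ q'.2) 1 q) X := by
  obtain ⟨hd, e⟩ := formalD_eq (r := r) μ
  have := dot_gradedDerivation hd (fun p q hq => ?_) q X
  · rw [← e, zero_mul, pow_zero, pow_zero, one_smul] at this
    exact this
  · rcases eq_or_ne ((p.1, μ ::ₘ p.2) : Jet r) q with rfl | h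
    · rfl
    · exact (hq (by rw [Finsupp.single_apply, if_neg h])).elim

/-! ### The field equations -/

/-- The multiples of the field equations. -/
def boxSpan (r : ℕ) : Submodule ℂ (Xi r) :=
  Submodule.span ℂ {X | ∃ (B : Xi r) (p : Jet r), X = B * boxXi p}

theorem mul_boxXi_mem (B : Xi r) (p : Jet r) : B * boxXi p ∈ boxSpan r :=
  Submodule.subset_span ⟨B, p, rfl⟩

/-- The field equation is linear in the jet variables, so contracting it leaves only the coefficient
of `ξ_q` in `□ ξ_p`. The first term is again a multiple of the field equation; the second becomes `□
D` once summed against `D_{pq}`. -/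
theorem dot_mul_boxXi (q : Jet r) (B : Xi r) (p : Jet r) : dot q (B * boxXi p) =
    (-1 : ℂ) ^ (q.parity * p.parity) • (dot q B * boxXi p) +
      ((-1 : ℂ) ^ q.parity * ∑ μ, if ((p.1, μ ::ₘ μ ::ₘ p.2) : Jet r) = q then eta μ else 0) • B := by
  simp only [boxXi, Finset.mul_sum, map_sum, mul_smul_comm, map_smul, dot_mul_xi, smul_add,
    Finset.sum_add_distrib, Finset.smul_sum, Finset.sum_smul]
  congr 1
  · exact Finset.sum_congr rfl fun μ _ => smul_comm _ _ _
  · refine Finset.sum_congr rfl fun μ _ => ?_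
    split_ifs
    · rw [smul_smul, mul_comm]
    · simp

/-! ### The descent equations for the Lagrangian. -/

theorem eta_mul_eta (μ : Fin 4) : eta μ * eta μ = 1 := by
  unfold eta; split_ifs <;> norm_num

theorem fieldStrength_swap (a : Fin r) (μ ν : Fin 4) :
    fieldStrength a μ ν = -fieldStrength a ν μ := by
  rw [fieldStrength, fieldStrength, neg_sub]

/-- The field strength is gauge invariant: `d_Q` turns the potential into a gradient, and second
derivatives are symmetric. -/
theorem dQ_fieldStrength (a : Fin r) (μ ν : Fin 4) : dQ (fieldStrength a μ ν) = 0 := by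
  simp only [fieldStrength, map_sub, map_smul, dQ_xi, dQGen, smul_smul]
  rw [sub_eq_zero, ← Multiset.cons_zero, ← Multiset.cons_zero, Multiset.cons_swap]
  congr 1
  ring

theorem hasParity_fieldStrength (a : Fin r) (μ ν : Fin 4) :
    HasParity (fieldStrength a μ ν) 0 :=
  ((hasParity_xi _).smul _).sub ((hasParity_xi _).smul _)

theorem hasParity_lagr (f : Fin r → Fin r → Fin r → ℝ) (I : List (Fin 4)) :
    HasParity (lagr f I) I.length := by
  have hv : ∀ a μ M, HasParity (xi ((.v a μ, M) : Jet r)) 0 := fun _ _ _ => hasParity_xi _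
  have hu : ∀ a M, HasParity (xi ((.u a, M) : Jet r)) 1 := fun _ _ => hasParity_xi _
  have ht : ∀ a M, HasParity (xi ((.ut a, M) : Jet r)) 1 := fun _ _ => hasParity_xi _
  have hF := hasParity_fieldStrength (r := r)
  rcases I with _ | ⟨μ, _ | ⟨ν, _ | ⟨ρ, I⟩⟩⟩
  · refine HasParity.sum fun a _ => HasParity.sum fun b _ => HasParity.sum fun c _ =>
      HasParity.smul _ (HasParity.add (HasParity.smul _ (HasParity.sum fun μ _ =>
        HasParity.sum fun ν _ => HasParity.smul _ (((hv _ _ _).mul (hv _ _ _)).mul (hF _ _ _))))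
        (HasParity.sum fun μ _ => (((hu _ _).mul (hv _ _ _)).mul (ht _ _)).congr rfl))
  · refine HasParity.sum fun a _ => HasParity.sum fun b _ => HasParity.sum fun c _ =>
      HasParity.smul _ (HasParity.sub (HasParity.sum fun ν _ => HasParity.smul _
        (((hu _ _).mul (hv _ _ _)).mul (hF _ _ _)))
        (HasParity.smul _ (HasParity.smul _ ((((hu _ _).mul (hu _ _)).mul (ht _ _)).congr (by simp)))))
  · refine HasParity.sum fun a _ => HasParity.sum fun b _ => HasParity.sum fun c _ =>
      HasParity.smul _ (HasParity.smul _ ((((hu _ _).mul (hu _ _)).mul (hF _ _ _)).congr rfl))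
  · exact hasParity_zero _

theorem xi_u_mul_u (a b : Fin r) (M N : Multiset (Fin 4)) :
    xi (.u a, M) * xi (.u b, N) = -(xi (.u b, N) * xi (.u a, M)) := by
  rw [xi_mul_xi]; simp [Jet.parity, Species.parity, Xi.neg_smul]

theorem xi_u_mul_v (a b : Fin r) (μ : Fin 4) (M N : Multiset (Fin 4)) :
    xi (.v b μ, N) * xi (.u a, M) = xi (.u a, M) * xi (.v b μ, N) := by
  rw [xi_mul_xi]; simp [Jet.parity, Species.parity]

theorem xi_v_mul_v (a b : Fin r) (μ ν : Fin 4) (M N : Multiset (Fin 4)) :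
    xi (.v a μ, M) * xi (.v b ν, N) = xi (.v b ν, N) * xi (.v a μ, M) := by
  rw [xi_mul_xi]; simp [Jet.parity, Species.parity]

/-- The contraction `f_{abc} G_{abc}` with the structure constants. -/
def colorSum (f : Fin r → Fin r → Fin r → ℝ) : (Fin r → Fin r → Fin r → Xi r) →ₗ[ℂ] Xi r where
  toFun G := ∑ a, ∑ b, ∑ c, (f a b c : ℂ) • G a b c
  map_add' G H := by simp only [Pi.add_apply, smul_add, Finset.sum_add_distrib]
  map_smul' c G := by
    simp only [Pi.smul_apply, Finset.smul_sum, RingHom.id_apply, smul_comm c]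

theorem map_colorSum (f : Fin r → Fin r → Fin r → ℝ) (L : Xi r →ₗ[ℂ] Xi r)
    (G : Fin r → Fin r → Fin r → Xi r) :
    L (colorSum f G) = colorSum f fun a b c => L (G a b c) := by
  change L (∑ a, ∑ b, ∑ c, (f a b c : ℂ) • G a b c) = ∑ a, ∑ b, ∑ c, (f a b c : ℂ) • L (G a b c)
  simp only [map_sum L, map_smul L]

/-- The polynomials `T^I` without the structure constants. -/
def lagrColor : List (Fin 4) → Fin r → Fin r → Fin r → Xi r
  | [], a, b, c => (1 / 2 : ℂ) • ∑ μ, ∑ ν, (eta μ * eta ν) •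
          (xi (.v a μ, 0) * xi (.v b ν, 0) * fieldStrength c ν μ)
        + ∑ μ, xi (.u a, 0) * xi (.v b μ, 0) * xi (.ut c, {μ})
  | [μ], a, b, c => ∑ ν, eta ν • (xi (.u a, 0) * xi (.v b ν, 0) * fieldStrength c ν μ)
        - (1 / 2 : ℂ) • eta μ • (xi (.u a, 0) * xi (.u b, 0) * xi (.ut c, {μ}))
  | [μ, ν], a, b, c => (1 / 2 : ℂ) • (xi (.u a, 0) * xi (.u b, 0) * fieldStrength c μ ν)
  | _ :: _ :: _ :: _, _, _, _ => 0

theorem lagr_eq_colorSum (f : Fin r → Fin r → Fin r → ℝ) (I : List (Fin 4)) :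
    lagr f I = colorSum f (lagrColor I) := by
  rcases I with _ | ⟨μ, _ | ⟨ν, _ | ⟨ρ, I⟩⟩⟩
  · rfl
  · rfl
  · rfl
  · exact (map_zero (colorSum f)).symm

theorem sPoly_lag_eq_colorSum (f : Fin r → Fin r → Fin r → ℝ) (I : List (Fin 4)) :
    sPoly f .lag I = colorSum f (fun a b c => dQ (lagrColor I a b c)) -
      Complex.I • colorSum f (fun a b c => ∑ μ, formalD μ (lagrColor (I ++ [μ]) a b c)) := by
  change dQ (lagr f I) - Complex.I • ∑ μ, formalD μ (lagr f (I ++ [μ])) = _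
  simp only [lagr_eq_colorSum, map_colorSum]
  rw [← map_sum (colorSum f)]
  congr 3

section lagr

variable {f : Fin r → Fin r → Fin r → ℝ}
  (hf : ∀ a b c, f b a c = -f a b c ∧ f a c b = -f a b c)

include hf

theorem colorSum_swap_left (G : Fin r → Fin r → Fin r → Xi r) :
    colorSum f (fun a b c => G b a c) = -colorSum f G := by
  change ∑ a, ∑ b, ∑ c, (f a b c : ℂ) • G b a c = -∑ a, ∑ b, ∑ c, (f a b c : ℂ) • G a b c
  rw [Finset.sum_comm]
  simp only [← Finset.sum_neg_distrib]
  refine Finset.sum_congr rfl fun a _ => Finset.sum_congr rfl fun b _ =>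
    Finset.sum_congr rfl fun c _ => ?_
  rw [(hf a b c).1]; simp [Xi.neg_smul]

theorem colorSum_swap_right (G : Fin r → Fin r → Fin r → Xi r) :
    colorSum f (fun a b c => G a c b) = -colorSum f G := by
  change ∑ a, ∑ b, ∑ c, (f a b c : ℂ) • G a c b = -∑ a, ∑ b, ∑ c, (f a b c : ℂ) • G a b c
  simp only [← Finset.sum_neg_distrib]
  refine Finset.sum_congr rfl fun a _ => ?_
  rw [Finset.sum_comm]
  refine Finset.sum_congr rfl fun b _ => Finset.sum_congr rfl fun c _ => ?_
  rw [(hf a b c).2]; simp [Xi.neg_smul]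

end lagr

theorem colorSum_mem (f : Fin r → Fin r → Fin r → ℝ) {S : Submodule ℂ (Xi r)}
    {G : Fin r → Fin r → Fin r → Xi r} (h : ∀ a b c, G a b c ∈ S) : colorSum f G ∈ S := by
  change ∑ a, ∑ b, ∑ c, (f a b c : ℂ) • G a b c ∈ S
  exact Submodule.sum_mem _ fun a _ => Submodule.sum_mem _ fun b _ => Submodule.sum_mem _
    fun c _ => Submodule.smul_mem _ _ (h a b c)

theorem Xi.neg_mul (X Y : Xi r) : -X * Y = -(X * Y) := by
  rw [eq_neg_iff_add_eq_zero, ← add_mul, neg_add_cancel, zero_mul]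

theorem Xi.mul_neg (X Y : Xi r) : X * -Y = -(X * Y) := by
  rw [eq_neg_iff_add_eq_zero, ← mul_add, neg_add_cancel, mul_zero]

theorem formalD_fieldStrength (ρ : Fin 4) (c : Fin r) (μ ν : Fin 4) :
    formalD ρ (fieldStrength c μ ν) =
      eta μ • xi (.v c ν, ρ ::ₘ {μ}) - eta ν • xi (.v c μ, ρ ::ₘ {ν}) := by
  simp only [fieldStrength, map_sub, map_smul, formalD_xi]

/-- The free Yang-Mills operator differs from `-□` by the gradient of `∂_μ v^μ`. The first term on
the right is that gradient; it will cancel against `d_Q ũ`. -/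
theorem sum_formalD_fieldStrength (c : Fin r) (ν : Fin 4) :
    ∑ μ, formalD μ (fieldStrength c ν μ) =
      eta ν • ∑ μ, xi (.v c μ, μ ::ₘ {ν}) - boxXi (.v c ν, 0) := by
  simp only [formalD_fieldStrength, Finset.sum_sub_distrib, boxXi, Finset.smul_sum]
  rfl

theorem dQ_vvF (a b c : Fin r) :
    dQ ((1 / 2 : ℂ) • ∑ μ, ∑ ν, (eta μ * eta ν) •
          (xi (.v a μ, 0) * xi (.v b ν, 0) * fieldStrength c ν μ)) =
      (Complex.I / 2) • ((∑ μ, ∑ ν, eta ν • (xi (.u a, {μ}) * (xi (.v b ν, 0) * fieldStrength c ν μ)))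
        - ∑ μ, ∑ ν, eta ν • (xi (.u b, {μ}) * (xi (.v a ν, 0) * fieldStrength c ν μ))) := by
  -- Exchanging the names `μ` and `ν` costs a sign from the antisymmetry of `F`; this aligns the two
  -- terms in which `d_Q` hits `v_a` and `v_b`.
  have h2 : ∑ μ, ∑ ν, eta ν • (xi (.u b, {μ}) * (xi (.v a ν, 0) * fieldStrength c ν μ)) =
      -∑ μ, ∑ ν, eta μ • (xi (.u b, {ν}) * (xi (.v a μ, 0) * fieldStrength c ν μ)) := by
    rw [Finset.sum_comm]
    simp only [← Finset.sum_neg_distrib]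
    refine Finset.sum_congr rfl fun μ _ => Finset.sum_congr rfl fun ν _ => ?_
    rw [fieldStrength_swap]
    simp only [Xi.mul_neg, Xi.smul_neg]
  rw [h2, sub_neg_eq_add, ← Finset.sum_add_distrib, map_smul, map_sum, Finset.smul_sum,
    Finset.smul_sum]
  refine Finset.sum_congr rfl fun μ _ => ?_
  rw [← Finset.sum_add_distrib, map_sum, Finset.smul_sum, Finset.smul_sum]
  refine Finset.sum_congr rfl fun ν _ => ?_
  rw [map_smul, mul_assoc, dQ_xi_mul, dQ_xi_mul, dQ_fieldStrength]
  simp only [dQGen, Jet.parity, Species.parity, pow_zero, one_smul, mul_zero, add_zero,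
    smul_mul_assoc, mul_smul_comm, smul_add, smul_smul, Multiset.cons_zero]
  congr 2
  · linear_combination (1 / 2 * Complex.I * eta ν) * eta_mul_eta μ
  · linear_combination (1 / 2 * Complex.I * eta μ) * eta_mul_eta ν
  · rw [← mul_assoc, xi_u_mul_v, mul_assoc]

theorem dQ_uvut (a b c : Fin r) :
    dQ (∑ μ, xi (.u a, 0) * xi (.v b μ, 0) * xi (.ut c, {μ})) =
      Complex.I • (∑ μ, xi (.u a, 0) * (xi (.v b μ, 0) * ∑ ν, xi (.v c ν, ν ::ₘ {μ}))) -
        Complex.I • ∑ μ, eta μ • (xi (.u a, 0) * (xi (.u b, {μ}) * xi (.ut c, {μ}))) := by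
  rw [map_sum, Finset.smul_sum, Finset.smul_sum, ← Finset.sum_sub_distrib]
  refine Finset.sum_congr rfl fun μ _ => ?_
  rw [mul_assoc, dQ_xi_mul, dQ_xi_mul, dQ_xi]
  simp only [dQGen, Jet.parity, Species.parity, pow_zero, pow_one, zero_mul, zero_add,
    smul_mul_assoc, mul_smul_comm, smul_add, smul_smul, Multiset.cons_zero, mul_add, sub_eq_add_neg,
    ← Xi.neg_smul]
  rw [add_comm]
  congr 2 <;> ring

theorem sum_formalD_uvF (a b c : Fin r) :
    ∑ μ, formalD μ (∑ ν, eta ν • (xi (.u a, 0) * xi (.v b ν, 0) * fieldStrength c ν μ)) =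
      (∑ μ, ∑ ν, eta ν • (xi (.u a, {μ}) * (xi (.v b ν, 0) * fieldStrength c ν μ)))
      + (∑ μ, ∑ ν, eta ν • (xi (.u a, 0) * (xi (.v b ν, {μ}) * fieldStrength c ν μ)))
      + ∑ ν, eta ν • (xi (.u a, 0) * (xi (.v b ν, 0) * ∑ μ, formalD μ (fieldStrength c ν μ))) := by
  have h : ∑ ν, eta ν • (xi (.u a, 0) * (xi (.v b ν, 0) * ∑ μ, formalD μ (fieldStrength c ν μ))) =
      ∑ μ, ∑ ν, eta ν • (xi (.u a, 0) * (xi (.v b ν, 0) * formalD μ (fieldStrength c ν μ))) := by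
    rw [Finset.sum_comm]
    simp only [Finset.mul_sum, Finset.smul_sum]
  rw [h, ← Finset.sum_add_distrib, ← Finset.sum_add_distrib]
  refine Finset.sum_congr rfl fun μ _ => ?_
  rw [← Finset.sum_add_distrib, ← Finset.sum_add_distrib, map_sum]
  refine Finset.sum_congr rfl fun ν _ => ?_
  rw [map_smul, mul_assoc, formalD_xi_mul, formalD_xi_mul, mul_add, smul_add, smul_add, add_assoc]
  rfl

theorem sum_formalD_uuut (a b c : Fin r) :
    ∑ μ, formalD μ ((1 / 2 : ℂ) • eta μ • (xi (.u a, 0) * xi (.u b, 0) * xi (.ut c, {μ}))) =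
      (1 / 2 : ℂ) • ((∑ μ, eta μ • (xi (.u a, 0) * (xi (.u b, {μ}) * xi (.ut c, {μ})))) -
        (∑ μ, eta μ • (xi (.u b, 0) * (xi (.u a, {μ}) * xi (.ut c, {μ}))))
        + xi (.u a, 0) * xi (.u b, 0) * boxXi (.ut c, 0)) := by
  rw [boxXi, Finset.mul_sum, ← Finset.sum_sub_distrib, ← Finset.sum_add_distrib, Finset.smul_sum]
  refine Finset.sum_congr rfl fun μ _ => ?_
  rw [map_smul, map_smul, mul_assoc, formalD_xi_mul, formalD_xi_mul, formalD_xi]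
  rw [← mul_assoc (xi (Species.u a, _)), xi_u_mul_u]
  simp only [Multiset.cons_zero, mul_add, smul_add, mul_smul_comm, mul_assoc, Xi.neg_mul,
    Xi.smul_neg, smul_sub]
  abel

/-- Only antisymmetry of `f` is used. Contracted with `f`, the two orderings of `G1` and of `G3` add
up and compensate the factors 1/2. The term `G2` of the form `u ∂v F` vanishes, and `G4` with the
gradient of `∂v` occurs in both parts. What remains is `u v □v` and `u u □ũ`. -/
theorem sPoly_lag_nil_mem {f : Fin r → Fin r → Fin r → ℝ}
    (hf : ∀ a b c, f b a c = -f a b c ∧ f a c b = -f a b c) : sPoly f .lag [] ∈ boxSpan r := by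
  let G1 : Fin r → Fin r → Fin r → Xi r := fun a b c =>
    ∑ μ, ∑ ν, eta ν • (xi (.u a, {μ}) * (xi (.v b ν, 0) * fieldStrength c ν μ))
  let G2 : Fin r → Fin r → Fin r → Xi r := fun a b c =>
    ∑ μ, ∑ ν, eta ν • (xi (.u a, 0) * (xi (.v b ν, {μ}) * fieldStrength c ν μ))
  let G3 : Fin r → Fin r → Fin r → Xi r := fun a b c =>
    ∑ μ, eta μ • (xi (.u a, 0) * (xi (.u b, {μ}) * xi (.ut c, {μ})))
  let G4 : Fin r → Fin r → Fin r → Xi r := fun a b c =>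
    ∑ μ, xi (.u a, 0) * (xi (.v b μ, 0) * ∑ ν, xi (.v c ν, ν ::ₘ {μ}))
  let R1 : Fin r → Fin r → Fin r → Xi r := fun a b c =>
    ∑ ν, eta ν • (xi (.u a, 0) * xi (.v b ν, 0) * boxXi (.v c ν, 0))
  let R2 : Fin r → Fin r → Fin r → Xi r := fun a b c =>
    xi (.u a, 0) * xi (.u b, 0) * boxXi (.ut c, 0)
  have s1 := colorSum_swap_left hf G1
  have s3 := colorSum_swap_left hf G3
  -- Written out, `∂_μ v_b^ν F_c` is a sum of two expressions, each symmetric under exchange of `b`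
  -- and `c` after relabelling of Lorentz indices. Its contraction with the antisymmetric `f`
  -- therefore equals its own negative.
  have s2 : colorSum f G2 = 0 := by
    have h1 : (fun a b c => G2 a c b) = G2 := by
      funext a b c
      have e : ∀ b c, G2 a b c = xi (.u a, 0) * ((∑ μ, ∑ ν, xi (.v b ν, {μ}) * xi (.v c μ, {ν})) -
          ∑ μ, ∑ ν, (eta μ * eta ν) • (xi (.v b ν, {μ}) * xi (.v c ν, {μ}))) := by
        intro b c
        simp only [G2, ← Finset.sum_sub_distrib, Finset.mul_sum]
        refine Finset.sum_congr rfl fun μ _ => Finset.sum_congr rfl fun ν _ => ?_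
        rw [fieldStrength]
        simp only [mul_sub, mul_smul_comm, smul_sub, smul_smul, eta_mul_eta, one_smul]
        rw [mul_comm (eta μ)]
      rw [e, e, Finset.sum_comm]
      congr 2
      · exact Finset.sum_congr rfl fun μ _ => Finset.sum_congr rfl fun ν _ => xi_v_mul_v _ _ _ _ _ _
      · exact Finset.sum_congr rfl fun μ _ => Finset.sum_congr rfl fun ν _ => by
          rw [xi_v_mul_v]
    have h2 := colorSum_swap_right hf G2
    rw [h1] at h2
    have h3 : (2 : ℂ) • colorSum f G2 = 0 := by
      rw [two_smul]
      nth_rewrite 1 [h2]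
      rw [neg_add_cancel]
    exact (smul_eq_zero_iff_right two_ne_zero).1 h3
  have hA : (fun a b c => dQ (lagrColor [] a b c)) =
      (Complex.I / 2) • (G1 - fun a b c => G1 b a c) + (Complex.I • G4 - Complex.I • G3) := by
    funext a b c
    change dQ (_ + _) = _
    rw [map_add, dQ_vvF, dQ_uvut]
    rfl
  have hB : (fun a b c => ∑ μ, formalD μ (lagrColor ([] ++ [μ]) a b c)) =
      G1 + G2 + (G4 - R1) - (1 / 2 : ℂ) • (G3 - (fun a b c => G3 b a c) + R2) := by
    funext a b c
    have h4 : ∑ ν, eta ν • (xi (.u a, 0) * (xi (.v b ν, 0) * ∑ μ, formalD μ (fieldStrength c ν μ))) =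
        G4 a b c - R1 a b c := by
      rw [← Finset.sum_sub_distrib]
      refine Finset.sum_congr rfl fun ν _ => ?_
      rw [sum_formalD_fieldStrength, mul_sub, mul_sub, smul_sub, mul_smul_comm, mul_smul_comm,
        smul_smul, eta_mul_eta, one_smul, mul_assoc]
    change ∑ μ, formalD μ (_ - _) = _
    rw [Finset.sum_congr rfl fun μ _ => map_sub (formalD μ) _ _, Finset.sum_sub_distrib,
      sum_formalD_uvF, sum_formalD_uuut, h4]
    rfl
  have key : sPoly f .lag [] = Complex.I • (colorSum f R1 + (1 / 2 : ℂ) • colorSum f R2) := by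
    rw [sPoly_lag_eq_colorSum, hA, hB]
    simp only [map_add, map_sub, map_smul, s1, s2, s3]
    module
  rw [key]
  exact Submodule.smul_mem _ _ (Submodule.add_mem _ (colorSum_mem _ fun a b c =>
    Submodule.sum_mem _ fun ν _ => Submodule.smul_mem _ _ (mul_boxXi_mem _ _))
    (Submodule.smul_mem _ _ (colorSum_mem _ fun a b c => mul_boxXi_mem _ _)))

/-- The same cancellation one degree higher: antisymmetry in `a`, `b` of the ghost pair doubles the
term `u ∂u F`, the gradients of `∂v` cancel, and only `u u □v` is left. -/
theorem sPoly_lag_singleton_mem {f : Fin r → Fin r → Fin r → ℝ}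
    (hf : ∀ a b c, f b a c = -f a b c ∧ f a c b = -f a b c) (μ : Fin 4) :
    sPoly f .lag [μ] ∈ boxSpan r := by
  let G1 : Fin r → Fin r → Fin r → Xi r := fun a b c =>
    ∑ ν, xi (.u a, 0) * (xi (.u b, {ν}) * fieldStrength c ν μ)
  let G2 : Fin r → Fin r → Fin r → Xi r := fun a b c =>
    xi (.u a, 0) * (xi (.u b, 0) * ∑ ν, xi (.v c ν, ν ::ₘ {μ}))
  let R : Fin r → Fin r → Fin r → Xi r := fun a b c =>
    xi (.u a, 0) * xi (.u b, 0) * boxXi (.v c μ, 0)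
  have s1 := colorSum_swap_left hf G1
  have hA : (fun a b c => dQ (lagrColor [μ] a b c)) =
      -Complex.I • G1 + (Complex.I / 2 * eta μ) • G2 := by
    funext a b c
    change dQ (_ - _) = -Complex.I • G1 a b c + (Complex.I / 2 * eta μ) • G2 a b c
    have h1 : dQ (∑ ν, eta ν • (xi (.u a, 0) * xi (.v b ν, 0) * fieldStrength c ν μ)) =
        -Complex.I • G1 a b c := by
      rw [map_sum, Finset.smul_sum]
      refine Finset.sum_congr rfl fun ν _ => ?_
      rw [map_smul, mul_assoc, dQ_xi_mul, dQ_xi_mul, dQ_fieldStrength]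
      simp only [dQGen, Jet.parity, Species.parity, pow_one, mul_zero, zero_mul, zero_add,
        smul_zero, add_zero, smul_mul_assoc, mul_smul_comm, smul_smul, Multiset.cons_zero]
      congr 1
      linear_combination (-Complex.I) * eta_mul_eta ν
    have h2 : dQ ((1 / 2 : ℂ) • eta μ • (xi (.u a, 0) * xi (.u b, 0) * xi (.ut c, {μ}))) =
        -((Complex.I / 2 * eta μ) • G2 a b c) := by
      rw [map_smul, map_smul, mul_assoc, dQ_xi_mul, dQ_xi_mul, dQ_xi]
      simp only [dQGen, Jet.parity, Species.parity, pow_one, zero_mul, zero_add,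
        mul_smul_comm, smul_smul, ← Xi.neg_smul]
      congr 1
      ring
    rw [map_sub, h1, h2, sub_neg_eq_add]
  have hB : (fun a b c => ∑ ν, formalD ν (lagrColor ([μ] ++ [ν]) a b c)) =
      (1 / 2 : ℂ) • ((fun a b c => G1 b a c) - G1 + eta μ • G2 - R) := by
    funext a b c
    have h4 : ∑ ν, formalD ν (fieldStrength c μ ν) =
        eta μ • (∑ ν, xi (.v c ν, ν ::ₘ {μ})) - boxXi (.v c μ, 0) := sum_formalD_fieldStrength c μ
    change ∑ ν, formalD ν ((1 / 2 : ℂ) • (xi (.u a, 0) * xi (.u b, 0) * fieldStrength c μ ν)) =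
      (1 / 2 : ℂ) • (G1 b a c - G1 a b c + eta μ • G2 a b c - R a b c)
    have h5 : eta μ • G2 a b c - R a b c =
        ∑ ν, xi (.u a, 0) * (xi (.u b, 0) * formalD ν (fieldStrength c μ ν)) := by
      rw [← Finset.mul_sum, ← Finset.mul_sum, h4, mul_sub, mul_sub, mul_smul_comm, mul_smul_comm,
        ← mul_assoc _ _ (boxXi _)]
    rw [add_sub_assoc, h5, ← Finset.sum_sub_distrib, ← Finset.sum_add_distrib, Finset.smul_sum]
    refine Finset.sum_congr rfl fun ν _ => ?_
    rw [map_smul, mul_assoc, formalD_xi_mul, formalD_xi_mul, ← mul_assoc (xi _), xi_u_mul_u,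
      fieldStrength_swap c ν μ]
    simp only [Multiset.cons_zero, mul_add, mul_assoc, Xi.neg_mul, Xi.mul_neg]
    congr 1
    abel
  have key : sPoly f .lag [μ] = (Complex.I / 2) • colorSum f R := by
    rw [sPoly_lag_eq_colorSum, hA, hB]
    simp only [map_add, map_sub, map_smul, s1]
    module
  rw [key]
  exact Submodule.smul_mem _ _ (colorSum_mem _ fun a b c => mul_boxXi_mem _ _)

/-- The descent equations `d_Q T^I = i ∂_μ T^{Iμ}` modulo the field equations. -/
theorem sPoly_lag_mem {f : Fin r → Fin r → Fin r → ℝ}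
    (hf : ∀ a b c, f b a c = -f a b c ∧ f a c b = -f a b c) (I : List (Fin 4)) :
    sPoly f .lag I ∈ boxSpan r := by
  rcases I with _ | ⟨μ, _ | ⟨ν, _ | ⟨ρ, I⟩⟩⟩
  · exact sPoly_lag_nil_mem hf
  · exact sPoly_lag_singleton_mem hf μ
  -- Here the equation holds identically: `u` and `F` are both annihilated by `d_Q`, and there is no
  -- `T^I` with three indices.
  · have h : sPoly f .lag [μ, ν] = 0 := by
      have hA : (fun a b c => dQ (lagrColor [μ, ν] a b c)) = (0 : Fin r → Fin r → Fin r → Xi r) := by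
        funext a b c
        change dQ ((1 / 2 : ℂ) • (xi (.u a, 0) * xi (.u b, 0) * fieldStrength c μ ν)) = 0
        rw [map_smul, mul_assoc, dQ_xi_mul, dQ_xi_mul, dQ_fieldStrength]
        simp [dQGen]
      have hB : (fun a b c => ∑ ρ, formalD ρ (lagrColor ([μ, ν] ++ [ρ]) a b c)) =
          (0 : Fin r → Fin r → Fin r → Xi r) := by
        funext a b c
        exact Finset.sum_eq_zero fun ρ _ => map_zero (formalD ρ)
      rw [sPoly_lag_eq_colorSum, hA, hB]
      simp
    rw [h]
    exact Submodule.zero_mem _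
  · have h : sPoly f .lag (μ :: ν :: ρ :: I) = 0 := by
      change dQ 0 - Complex.I • ∑ μ, formalD μ 0 = 0
      simp
    rw [h]
    exact Submodule.zero_mem _

/-! ### Smoothness, derivatives and symmetries of the distributions `D_{pq}` smeared in one
variable. -/

/-- The complexified coordinate `x ↦ x^μ`. -/
def coordC (μ : Fin 4) : Mink →L[ℝ] ℂ :=
  Complex.ofRealCLM ∘L (EuclideanSpace.proj μ : Mink →L[ℝ] ℝ)

theorem coordC_apply (μ : Fin 4) (x : Mink) : coordC μ x = (x μ : ℂ) := rfl

/-- Functions whose partial derivatives of any order exist and are bounded have temperate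
growth. -/
theorem hasTemperateGrowth_of_mem {S : Set (Mink → ℂ)}
    (hb : ∀ f ∈ S, ∃ C : ℝ, ∀ x, ‖f x‖ ≤ C)
    (hd : ∀ f ∈ S, ∃ F : Fin 4 → Mink → ℂ, (∀ μ, F μ ∈ S) ∧
      ∀ x, HasFDerivAt f (∑ μ, F μ x • coordC μ) x) {f : Mink → ℂ} (hf : f ∈ S) :
    f.HasTemperateGrowth := by
  -- Since `S` is closed under partial derivatives, derivatives of order `n + 1` of a member are
  -- linear images of derivatives of order `n` of other members. Induction over all of `S` at once
  -- therefore closes.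
  have key : ∀ n : ℕ, ∀ f ∈ S, ContDiff ℝ n f ∧ ∃ C : ℝ, ∀ x, ‖iteratedFDeriv ℝ n f x‖ ≤ C := by
    intro n
    induction n with
    | zero =>
      intro f hf
      obtain ⟨F, hF, h⟩ := hd f hf
      refine ⟨contDiff_zero.2 (continuous_iff_continuousAt.2 fun x => (h x).continuousAt), ?_⟩
      simpa using hb f hf
    | succ n ih =>
      intro f hf
      obtain ⟨F, hF, h⟩ := hd f hf
      choose hc C hC using fun μ => ih (F μ) (hF μ)
      let L : Fin 4 → ℂ →L[ℝ] (Mink →L[ℝ] ℂ) := fun μ =>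
        (ContinuousLinearMap.lsmul ℝ ℂ).flip (coordC μ)
      have hfd : fderiv ℝ f = fun x => ∑ μ, L μ (F μ x) := by
        funext x
        rw [(h x).fderiv]
        rfl
      have hL : ∀ μ, ContDiff ℝ n fun x => L μ (F μ x) := fun μ => (L μ).contDiff.comp (hc μ)
      refine ⟨?_, ∑ μ, ‖L μ‖ * C μ, fun x => ?_⟩
      · have := contDiff_succ_iff_fderiv (𝕜 := ℝ) (n := (n : WithTop ℕ∞)) (f := f)
        push_cast
        rw [this]
        refine ⟨fun x => (h x).differentiableAt, by simp, ?_⟩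
        rw [hfd]
        exact ContDiff.sum fun μ _ => hL μ
      · rw [← norm_iteratedFDeriv_fderiv, hfd,
          iteratedFDeriv_fun_sum_apply fun μ _ => (hL μ).contDiffAt]
        refine (norm_sum_le _ _).trans (Finset.sum_le_sum fun μ _ => ?_)
        refine ((L μ).norm_iteratedFDeriv_comp_left (hc μ).contDiffAt le_rfl).trans ?_
        gcongr
        exact hC μ x
  refine ⟨contDiff_infty.2 fun n => (key n f hf).1, fun n => ?_⟩
  obtain ⟨C, hC⟩ := (key n f hf).2
  exact ⟨0, C, fun x => by simpa using hC x⟩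

theorem RapidlyDecreasing.integrable {A : Mom → ℂ} (hA : RapidlyDecreasing A) :
    Integrable A coneMeasure := by
  obtain ⟨C, hC⟩ := hA.2 4
  refine (integrable_coneMeasure.const_mul C).mono' hA.1.aestronglyMeasurable
    (Filter.Eventually.of_forall fun k => ?_)
  rw [← div_eq_mul_inv, le_div_iff₀ (by positivity), mul_comm]
  exact hC k

theorem phase_eq_sum (k : Mom) (x : Mink) : (phase k x : ℂ) = ∑ μ, onShellLow k μ * x μ := by
  rw [Fin.sum_univ_succ]
  simp [phase, onShellLow, onShell, eta, Finset.sum_neg_distrib, sub_eq_add_neg]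

/-- `∫ A(k) exp (c k · x)` over the light cone. -/
def coneFourier (c : ℂ) (A : Mom → ℂ) (x : Mink) : ℂ :=
  ∫ k, A k * Complex.exp (c * phase k x) ∂coneMeasure

theorem norm_exp_phase {c : ℂ} (hc : c.re = 0) (k : Mom) (x : Mink) :
    ‖Complex.exp (c * phase k x)‖ = 1 := by
  rw [Complex.norm_exp]; simp [hc]

theorem integrable_coneFourier {c : ℂ} (hc : c.re = 0) {A : Mom → ℂ} (hA : RapidlyDecreasing A)
    (x : Mink) : Integrable (fun k => A k * Complex.exp (c * phase k x)) coneMeasure := by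
  refine hA.integrable.norm.mono' ?_ (Filter.Eventually.of_forall fun k => ?_)
  · refine (hA.1.mul ?_).aestronglyMeasurable
    unfold phase; fun_prop
  · rw [norm_mul, norm_exp_phase hc, mul_one]

theorem RapidlyDecreasing.momentum {A : Mom → ℂ} (hA : RapidlyDecreasing A) (c : ℂ) (μ : Fin 4) :
    RapidlyDecreasing fun k => c * onShellLow k μ * A k :=
  ((polyBounded_const c).mul (polyBounded_onShellLow μ)).mul_rapid hA

theorem integrable_sum_smul {α V ι : Type*} [Fintype ι] [MeasurableSpace α] {m : Measure α}
    [NormedAddCommGroup V] [NormedSpace ℂ V] {F : ι → α → ℂ} (hF : ∀ i, Integrable (F i) m)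
    (v : ι → V) : Integrable (fun a => ∑ i, F i a • v i) m :=
  integrable_finsetSum _ fun i _ => (hF i).smul_const (v i)

theorem integral_sum_smul {α V ι : Type*} [Fintype ι] [MeasurableSpace α] {m : Measure α}
    [NormedAddCommGroup V] [NormedSpace ℂ V] [CompleteSpace V] {F : ι → α → ℂ}
    (hF : ∀ i, Integrable (F i) m) (v : ι → V) :
    ∫ a, ∑ i, F i a • v i ∂m = ∑ i, (∫ a, F i a ∂m) • v i := by
  rw [integral_finsetSum _ fun i _ => (hF i).smul_const (v i)]
  exact Finset.sum_congr rfl fun i _ => integral_smul_const _ _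

theorem hasFDerivAt_planeWave (c a : ℂ) (k : Mom) (x : Mink) :
    HasFDerivAt (fun x : Mink => a * Complex.exp (c * phase k x))
      (∑ μ, (c * onShellLow k μ * a * Complex.exp (c * phase k x)) • coordC μ) x := by
  have h1 : HasFDerivAt (fun x : Mink => c * (phase k x : ℂ))
      (∑ μ, (c * onShellLow k μ) • coordC μ) x := by
    have h2 : (fun x : Mink => c * (phase k x : ℂ)) =
        fun x => (∑ μ, (c * onShellLow k μ) • coordC μ : Mink →L[ℝ] ℂ) x := by
      funext x
      simp [phase_eq_sum, Finset.mul_sum, coordC_apply, mul_assoc]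
    rw [h2]
    exact ContinuousLinearMap.hasFDerivAt _
  refine (h1.cexp.const_mul a).congr_fderiv ?_
  symm
  rw [Finset.smul_sum, Finset.smul_sum]
  refine Finset.sum_congr rfl fun μ _ => ?_
  rw [smul_smul, smul_smul]
  congr 1
  ring

/-- Differentiation under the integral. The exponential has modulus one for imaginary `c`, and the
momentum factor it produces is absorbed by the rapid decrease of `A`, so the dominating function
does not depend on `x`. -/
theorem hasFDerivAt_coneFourier {c : ℂ} (hc : c.re = 0) {A : Mom → ℂ} (hA : RapidlyDecreasing A)
    (x : Mink) : HasFDerivAt (coneFourier c A)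
      (∑ μ, coneFourier c (fun k => c * onShellLow k μ * A k) x • coordC μ) x := by
  have e : ∑ μ, coneFourier c (fun k => c * onShellLow k μ * A k) x • coordC μ =
      ∫ k, ∑ μ, (c * onShellLow k μ * A k * Complex.exp (c * phase k x)) • coordC μ
        ∂coneMeasure := by
    exact (integral_sum_smul (fun μ => integrable_coneFourier hc (hA.momentum c μ) x) coordC).symm
  rw [e]
  have hint : Integrable (fun k => ∑ μ, (c * onShellLow k μ * A k *
      Complex.exp (c * phase k x)) • coordC μ) coneMeasure := integrable_sum_smul
    (fun μ => integrable_coneFourier hc (hA.momentum c μ) x) coordC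
  have hbound : Integrable (fun k => ∑ μ, ‖c * onShellLow k μ * A k‖ * ‖coordC μ‖)
      coneMeasure := by
    have h3 := fun μ => (hA.momentum c μ).integrable.norm.mul_const ‖coordC μ‖
    simp only [Fin.sum_univ_four]
    exact (((h3 0).add (h3 1)).add (h3 2)).add (h3 3)
  have hle : ∀ k (x : Mink), ‖∑ μ, (c * onShellLow k μ * A k *
      Complex.exp (c * phase k x)) • coordC μ‖ ≤ ∑ μ, ‖c * onShellLow k μ * A k‖ * ‖coordC μ‖ := by
    intro k x
    refine (norm_sum_le (E := Mink →L[ℝ] ℂ) _ _).trans (Finset.sum_le_sum fun μ _ => ?_)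
    rw [norm_smul, norm_mul _ (Complex.exp _), norm_exp_phase hc, mul_one]
  exact hasFDerivAt_integral_of_dominated_of_fderiv_le
    (F := fun x k => A k * Complex.exp (c * phase k x))
    (F' := fun x k => ∑ μ, (c * onShellLow k μ * A k *
      Complex.exp (c * phase k x)) • coordC μ)
    (bound := fun k => ∑ μ, ‖c * onShellLow k μ * A k‖ * ‖coordC μ‖) Filter.univ_mem
    (Filter.Eventually.of_forall fun x => (integrable_coneFourier hc hA x).1)
    (integrable_coneFourier hc hA x) hint.1
    (Filter.Eventually.of_forall fun k x _ => hle k x) hbound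
    (Filter.Eventually.of_forall fun k x _ => hasFDerivAt_planeWave c (A k) k x)

theorem norm_coneFourier_le {c : ℂ} (hc : c.re = 0) {A : Mom → ℂ} (x : Mink) :
    ‖coneFourier c A x‖ ≤ ∫ k, ‖A k‖ ∂coneMeasure := by
  refine (norm_integral_le_integral_norm _).trans (le_of_eq ?_)
  congr 1
  funext k
  rw [norm_mul, norm_exp_phase hc, mul_one]

theorem hasTemperateGrowth_coneFourier {c : ℂ} (hc : c.re = 0) {A : Mom → ℂ}
    (hA : RapidlyDecreasing A) : (coneFourier c A).HasTemperateGrowth := by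
  refine hasTemperateGrowth_of_mem (S := {f | ∃ A, RapidlyDecreasing A ∧ f = coneFourier c A})
    ?_ ?_ ⟨A, hA, rfl⟩
  · rintro _ ⟨A, hA, rfl⟩
    exact ⟨_, norm_coneFourier_le hc⟩
  · rintro _ ⟨A, hA, rfl⟩
    exact ⟨fun μ => coneFourier c fun k => c * onShellLow k μ * A k,
      fun μ => ⟨_, hA.momentum c μ, rfl⟩, hasFDerivAt_coneFourier hc hA⟩

/-- The scalar factor of the distributions `D_{pq}` for the derivatives `∂_M`, `∂_N`. -/
def pjKernel (M N : Multiset (Fin 4)) (g : 𝓢(Mink, ℂ)) (x : Mink) : ℂ :=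
  coneFourier Complex.I
      (fun k => momPoly (-Complex.I) M k * momPoly Complex.I N k * hatNeg g k) x -
    coneFourier (-Complex.I)
      (fun k => momPoly Complex.I M k * momPoly (-Complex.I) N k * hatPos g k) x

theorem rapid_momPoly_mul (c c' : ℂ) (M N : Multiset (Fin 4)) {A : Mom → ℂ}
    (hA : RapidlyDecreasing A) : RapidlyDecreasing fun k => momPoly c M k * momPoly c' N k * A k :=
  ((polyBounded_momPoly c M).mul (polyBounded_momPoly c' N)).mul_rapid hA

theorem pauliJordan_eq (p q : Jet r) (g : 𝓢(Mink, ℂ)) (x : Mink) :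
    pauliJordan p q g x = twoPoint p.1 q.1 * Complex.I * pjKernel p.2 q.2 g x := by
  rw [pauliJordan, pjKernel, coneFourier, coneFourier, ← integral_sub
    (integrable_coneFourier (by simp) (rapid_momPoly_mul _ _ _ _ (rapid_hatNeg g)) x)
    (integrable_coneFourier (by simp) (rapid_momPoly_mul _ _ _ _ (rapid_hatPos g)) x)]

theorem hasTemperateGrowth_pjKernel (M N : Multiset (Fin 4)) (g : 𝓢(Mink, ℂ)) :
    (pjKernel M N g).HasTemperateGrowth :=
  (hasTemperateGrowth_coneFourier (by simp) (rapid_momPoly_mul _ _ _ _ (rapid_hatNeg g))).sub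
    (hasTemperateGrowth_coneFourier (by simp) (rapid_momPoly_mul _ _ _ _ (rapid_hatPos g)))

theorem hasTemperateGrowth_pauliJordan (p q : Jet r) (g : 𝓢(Mink, ℂ)) :
    (pauliJordan p q g).HasTemperateGrowth := by
  rw [funext (pauliJordan_eq p q g)]
  exact (Function.HasTemperateGrowth.const _).mul (hasTemperateGrowth_pjKernel _ _ _)

theorem momPoly_cons (c : ℂ) (μ : Fin 4) (M : Multiset (Fin 4)) (k : Mom) :
    momPoly c (μ ::ₘ M) k = c * onShellLow k μ * momPoly c M k := by
  simp [momPoly]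

/-- In each of the two terms the momenta indexed by `N` carry the same factor `± i` as the exponent
in `x`, so `∂_μ` in `x` just appends `μ` to `N`. -/
theorem hasFDerivAt_pjKernel (M N : Multiset (Fin 4)) (g : 𝓢(Mink, ℂ)) (x : Mink) :
    HasFDerivAt (pjKernel M N g) (∑ μ, pjKernel M (μ ::ₘ N) g x • coordC μ) x := by
  have h := (hasFDerivAt_coneFourier (c := Complex.I) (by simp)
    (rapid_momPoly_mul (-Complex.I) Complex.I M N (rapid_hatNeg g)) x).sub
    (hasFDerivAt_coneFourier (c := -Complex.I) (by simp)
    (rapid_momPoly_mul Complex.I (-Complex.I) M N (rapid_hatPos g)) x)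
  refine h.congr_fderiv ?_
  symm
  rw [← Finset.sum_sub_distrib]
  refine Finset.sum_congr rfl fun μ _ => ?_
  rw [← sub_smul, pjKernel]
  congr 3 <;> funext k <;> rw [momPoly_cons] <;> ring

theorem hasFDerivAt_pauliJordan (p q : Jet r) (g : 𝓢(Mink, ℂ)) (x : Mink) :
    HasFDerivAt (pauliJordan p q g) (∑ μ, pauliJordan p (q.1, μ ::ₘ q.2) g x • coordC μ) x := by
  rw [funext (pauliJordan_eq p q g)]
  refine ((hasFDerivAt_pjKernel p.2 q.2 g x).const_mul
    (twoPoint p.1 q.1 * Complex.I)).congr_fderiv ?_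
  symm
  rw [Finset.smul_sum]
  refine Finset.sum_congr rfl fun μ _ => ?_
  rw [pauliJordan_eq, smul_smul]

/-- Translation invariance: `D` depends on `y - x` only, so a derivative in `y` is minus a
derivative in `x`. -/
theorem pjKernel_cons (μ : Fin 4) (M N : Multiset (Fin 4)) (g : 𝓢(Mink, ℂ)) (x : Mink) :
    pjKernel (μ ::ₘ M) N g x = -pjKernel M (μ ::ₘ N) g x := by
  rw [pjKernel, pjKernel, coneFourier, coneFourier, coneFourier, coneFourier, neg_sub',
    ← integral_neg, ← integral_neg]
  congr 2 <;> funext k <;> simp only [momPoly_cons] <;> ring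

theorem onShellLow_sq (k : Mom) : ∑ μ, eta μ * (onShellLow k μ * onShellLow k μ) = 0 := by
  have h := EuclideanSpace.real_norm_sq_eq k
  rw [Fin.sum_univ_succ]
  have h1 : ∀ i : Fin 3, eta i.succ * (onShellLow k i.succ * onShellLow k i.succ) =
      -((k i ^ 2 : ℝ) : ℂ) := by
    intro i
    simp [onShellLow, onShell, eta]; ring
  rw [Finset.sum_congr rfl fun i _ => h1 i, Finset.sum_neg_distrib, ← Complex.ofReal_sum, ← h]
  simp [onShellLow, onShell, eta]; ring

/-- The wave operator multiplies the integrand by a multiple of `p · p`, which vanishes on the light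
cone. -/
theorem pjKernel_box (M N : Multiset (Fin 4)) (g : 𝓢(Mink, ℂ)) (x : Mink) :
    ∑ μ, eta μ * pjKernel M (μ ::ₘ μ ::ₘ N) g x = 0 := by
  have key : ∀ (c c' : ℂ), c.re = 0 → ∀ (A : Mom → ℂ), RapidlyDecreasing A →
      ∑ μ, eta μ * coneFourier c
        (fun k => momPoly c' M k * momPoly c (μ ::ₘ μ ::ₘ N) k * A k) x = 0 := by
    intro c c' hc A hA
    simp only [coneFourier, ← integral_const_mul]
    rw [← integral_finsetSum _ fun μ _ =>
      (integrable_coneFourier hc (rapid_momPoly_mul _ _ _ _ hA) x).const_mul _]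
    rw [integral_congr_ae (g := fun _ => 0), integral_zero]
    refine Filter.Eventually.of_forall fun k => ?_
    dsimp only
    simp only [momPoly_cons]
    calc _ = (∑ μ, eta μ * (onShellLow k μ * onShellLow k μ)) * (c ^ 2 * momPoly c' M k *
          momPoly c N k * A k * Complex.exp (c * phase k x)) := by
          rw [Finset.sum_mul]
          exact Finset.sum_congr rfl fun μ _ => by ring
      _ = 0 := by rw [onShellLow_sq, zero_mul]
  simp only [pjKernel, mul_sub, Finset.sum_sub_distrib]
  rw [key _ _ (by simp) _ (rapid_hatNeg g), key _ _ (by simp) _ (rapid_hatPos g), sub_zero]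

theorem pauliJordan_box (p q : Jet r) (g : 𝓢(Mink, ℂ)) (x : Mink) :
    ∑ μ, eta μ * pauliJordan p (q.1, μ ::ₘ μ ::ₘ q.2) g x = 0 := by
  have h := pjKernel_box p.2 q.2 g x
  simp only [pauliJordan_eq]
  calc _ = (twoPoint p.1 q.1 * Complex.I) * ∑ μ, eta μ * pjKernel p.2 (μ ::ₘ μ ::ₘ q.2) g x := by
        rw [Finset.mul_sum]
        exact Finset.sum_congr rfl fun μ _ => by ring
    _ = 0 := by rw [h, mul_zero]

theorem pauliJordan_eq_zero {p q : Jet r} (h : p.parity ≠ q.parity) (g : 𝓢(Mink, ℂ)) :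
    pauliJordan p q g = 0 := by
  funext x
  rw [pauliJordan_eq]
  rcases p with ⟨_ | _ | _, M⟩ <;> rcases q with ⟨_ | _ | _, N⟩ <;>
    simp_all [twoPoint, Jet.parity, Species.parity]

/-- The vanishing of `[Q, [ξ_p, ξ_q]]`. -/
theorem sum_dQCoeff_pauliJordan (p q : Jet r) (g : 𝓢(Mink, ℂ)) (x : Mink) :
    ((dQCoeff q).sum fun q' c => c * pauliJordan p q' g x) =
      -(-1 : ℂ) ^ p.parity * (dQCoeff p).sum fun p' c => c * pauliJordan p' q g x := by
  have hs : ∀ (F : Fin 4 → Jet r →₀ ℂ) (G : Jet r → ℂ), ((∑ μ, F μ).sum fun q' c => c * G q') =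
      ∑ μ, (F μ).sum fun q' c => c * G q' := fun F G =>
    Finsupp.sum_finsetSum_index (by simp) (fun _ _ _ => add_mul _ _ _) |>.symm
  rcases p with ⟨⟨a, μ⟩ | a | a, M⟩ <;> rcases q with ⟨⟨b, ν⟩ | b | b, N⟩ <;>
    simp only [dQCoeff, hs, Finsupp.sum_single_index, Finsupp.sum_zero_index, zero_mul, mul_zero,
      pauliJordan_eq, twoPoint, Finset.sum_const_zero, Jet.parity, Species.parity, pow_zero,
      pow_one]
  -- Only the pairs `(v, ũ)` and `(ũ, v)` survive. In both, the identity says that a derivative can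
  -- be moved from one argument of `D_0` to the other with a sign.
  · by_cases h : a = b
    · subst h
      simp only [true_and, if_true, ite_mul, zero_mul, mul_ite, mul_zero, Finset.sum_ite_eq,
        Finset.mem_univ, pjKernel_cons]
      ring
    · simp [h]
  · by_cases h : a = b
    · subst h
      simp only [true_and, if_true, ite_mul, zero_mul, mul_ite, mul_zero, Finset.sum_ite_eq',
        Finset.mem_univ, pjKernel_cons]
      ring
    · simp [h]

/-! ### Linear operations on operator-valued distributions: multiplication, differentiation,
reordering. -/

theorem OpDist.smul_sub {n : ℕ} (c : ℂ) (E F : OpDist r n) : c • (E - F) = c • E - c • F := by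
  module

theorem OpDist.smul_neg {n : ℕ} (c : ℂ) (E : OpDist r n) : c • (-E) = -(c • E) := by
  module

theorem OpDist.map_sub {n k : ℕ} (L : OpDist r n →ₗ[ℂ] OpDist r k) (E F : OpDist r n) :
    L (E - F) = L E - L F := by
  have e : (E - F) + F = E := by module
  have h : L E = L (E - F) + L F := by rw [← map_add, e]
  rw [h]
  module

/-- Precomposition of operator-valued distributions with a map of test functions. -/
def precompL {n : ℕ} (L : 𝓢(Conf n, ℂ) →L[ℂ] 𝓢(Conf n, ℂ)) : OpDist r n →ₗ[ℂ] OpDist r n :=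
  LinearMap.lcomp ℂ (Module.End ℂ (Fock r)) L.toLinearMap

/-- `mulAt` as a linear map. -/
def mulAtL {n : ℕ} (m : Fin n) (G : Mink → ℂ) : OpDist r n →ₗ[ℂ] OpDist r n :=
  precompL (SchwartzMap.smulLeftCLM ℂ fun x : Conf n => G (x m))

/-- `reorder` as a linear map. -/
def reorderL {n : ℕ} (σ : Equiv.Perm (Fin n)) : OpDist r n →ₗ[ℂ] OpDist r n :=
  precompL (SchwartzMap.compCLMOfContinuousLinearEquiv ℂ
    (LinearEquiv.funCongrLeft ℝ Mink σ.symm).toContinuousLinearEquiv)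

/-- `pderivDist` as a linear map. -/
def pderivL {n : ℕ} (l : Fin n) (μ : Fin 4) : OpDist r n →ₗ[ℂ] OpDist r n where
  toFun E := pderivDist l μ E
  map_add' E F := by
    simp only [pderivDist, LinearMap.add_comp]
    abel
  map_smul' c E := by
    simp only [pderivDist, LinearMap.smul_comp, RingHom.id_apply, OpDist.smul_neg]

/-- `dQOp` as a linear map. -/
def dQOpL {n : ℕ} (a : ℕ) : OpDist r n →ₗ[ℂ] OpDist r n where
  toFun E := dQOp a E
  map_add' E F := by
    simp only [dQOp, LinearMap.comp_add, smul_add]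
    abel
  map_smul' c E := by
    simp only [dQOp, LinearMap.comp_smul, RingHom.id_apply, OpDist.smul_sub]
    rw [smul_comm c]

theorem reorderL_apply {n : ℕ} (σ : Equiv.Perm (Fin n)) (E : OpDist r n) :
    reorderL σ E = reorder σ E := rfl

theorem pderivL_apply {n : ℕ} (l : Fin n) (μ : Fin 4) (E : OpDist r n) :
    pderivL l μ E = pderivDist l μ E := rfl

theorem dQOpL_apply {n : ℕ} (a : ℕ) (E : OpDist r n) : dQOpL a E = dQOp a E := rfl

theorem dQOpL_mulAtL {n : ℕ} (a : ℕ) (m : Fin n) (G : Mink → ℂ) (E : OpDist r n) :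
    dQOpL a (mulAtL m G E) = mulAtL m G (dQOpL a E) := rfl

theorem dQOpL_reorderL {n : ℕ} (a : ℕ) (σ : Equiv.Perm (Fin n)) (E : OpDist r n) :
    dQOpL a (reorderL σ E) = reorderL σ (dQOpL a E) := rfl

theorem reorderL_mul {n : ℕ} (σ τ : Equiv.Perm (Fin n)) (E : OpDist r n) :
    reorderL σ (reorderL τ E) = reorderL (σ * τ) E := rfl

theorem reorderL_one {n : ℕ} (E : OpDist r n) : reorderL 1 E = E := by
  ext φ : 1
  change E _ = E φ
  congr 1

theorem hasTemperateGrowth_comp_apply {n : ℕ} {G : Mink → ℂ} (hG : G.HasTemperateGrowth)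
    (m : Fin n) : (fun x : Conf n => G (x m)).HasTemperateGrowth :=
  hG.comp (ContinuousLinearMap.proj (R := ℝ) m : Conf n →L[ℝ] Mink).hasTemperateGrowth

theorem mulAtL_zero {n : ℕ} (m : Fin n) : (mulAtL m 0 : OpDist r n →ₗ[ℂ] OpDist r n) = 0 := by
  have h : (SchwartzMap.smulLeftCLM ℂ fun x : Conf n => (0 : Mink → ℂ) (x m)) =
      (0 : 𝓢(Conf n, ℂ) →L[ℂ] 𝓢(Conf n, ℂ)) := by
    simp
  rw [mulAtL, h]
  ext E φ : 2
  exact map_zero E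

/-- Linearity in the multiplying function is what transports the scalar identities for `D_{pq}` to
operators. Temperate growth is needed for the product with a Schwartz function to be the actual
pointwise product. -/
theorem mulAtL_sum {n : ℕ} {ι : Type*} (S : Finset ι) (m : Fin n) (c : ι → ℂ) (G : ι → Mink → ℂ)
    (hG : ∀ i ∈ S, (G i).HasTemperateGrowth) :
    (mulAtL m fun x => ∑ i ∈ S, c i * G i x) =
      (∑ i ∈ S, c i • mulAtL m (G i) : OpDist r n →ₗ[ℂ] OpDist r n) := by
  have h : (SchwartzMap.smulLeftCLM ℂ fun x : Conf n => ∑ i ∈ S, c i * G i (x m)) =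
      ∑ i ∈ S, c i • (SchwartzMap.smulLeftCLM ℂ fun x : Conf n => G i (x m)) := by
    rw [SchwartzMap.smulLeftCLM_sum (g := fun i (x : Conf n) => c i * G i (x m))]
    · refine Finset.sum_congr rfl fun i hi => ?_
      exact SchwartzMap.smulLeftCLM_smul (hasTemperateGrowth_comp_apply (hG i hi) m) (c i)
    · exact fun i hi => (Function.HasTemperateGrowth.const (c i)).mul
        (hasTemperateGrowth_comp_apply (hG i hi) m)
  rw [mulAtL, h]
  ext E φ : 2
  simp [mulAtL, precompL, LinearMap.sum_apply]

/-- The Leibniz rule on test functions: `G` depends on `x_m` only, so `∂/∂x_l` sees it only for `l =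
m`. -/
theorem lineDeriv_smulLeft {n : ℕ} (l m : Fin n) (μ : Fin 4) {G : Mink → ℂ}
    {F : Fin 4 → Mink → ℂ} (hG : G.HasTemperateGrowth)
    (hF : ∀ x, HasFDerivAt G (∑ μ, F μ x • coordC μ) x) (φ : 𝓢(Conf n, ℂ)) (x : Conf n) :
    (∂_{(Pi.single l (EuclideanSpace.single μ 1) : Conf n)}
      (SchwartzMap.smulLeftCLM ℂ (fun x : Conf n => G (x m)) φ)) x =
      (if l = m then F μ (x m) * φ x else 0) +
        G (x m) * (∂_{(Pi.single l (EuclideanSpace.single μ 1) : Conf n)} φ) x := by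
  rw [SchwartzMap.lineDerivOp_apply_eq_fderiv, SchwartzMap.lineDerivOp_apply_eq_fderiv,
    SchwartzMap.smulLeftCLM_apply (hasTemperateGrowth_comp_apply hG m)]
  have h1 : HasFDerivAt (fun x : Conf n => G (x m))
      ((∑ μ, F μ (x m) • coordC μ) ∘L (ContinuousLinearMap.proj (R := ℝ) m : Conf n →L[ℝ] Mink))
      x :=
    (hF (x m)).comp x (ContinuousLinearMap.hasFDerivAt
      (ContinuousLinearMap.proj (R := ℝ) m : Conf n →L[ℝ] Mink))
  have h2 : HasFDerivAt (fun x : Conf n => G (x m) • φ x) _ x := h1.smul (φ.hasFDerivAt x)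
  rw [h2.fderiv]
  simp only [add_apply, smul_apply, smul_eq_mul,
    ContinuousLinearMap.smulRight_apply, ContinuousLinearMap.comp_apply,
    ContinuousLinearMap.proj_apply]
  rw [add_comm]
  congr 1
  by_cases h : l = m
  · subst h
    simp only [Pi.single_eq_same, sum_apply, smul_apply, coordC_apply, PiLp.single_apply,
      smul_eq_mul, if_true]
    rw [Finset.sum_eq_single μ (fun ν _ h => by simp [h]) (by simp)]
    simp
  · rw [if_neg h, Pi.single_eq_of_ne (Ne.symm h), map_zero, zero_mul]

theorem pderivL_mulAtL_of_ne {n : ℕ} {l m : Fin n} (hlm : l ≠ m) (μ : Fin 4) {G : Mink → ℂ}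
    {F : Fin 4 → Mink → ℂ} (hG : G.HasTemperateGrowth)
    (hF : ∀ x, HasFDerivAt G (∑ μ, F μ x • coordC μ) x) (E : OpDist r n) :
    pderivL l μ (mulAtL m G E) = mulAtL m G (pderivL l μ E) := by
  ext φ : 1
  have h : SchwartzMap.smulLeftCLM ℂ (fun x : Conf n => G (x m))
      (∂_{(Pi.single l (EuclideanSpace.single μ 1) : Conf n)} φ) =
      ∂_{(Pi.single l (EuclideanSpace.single μ 1) : Conf n)}
        (SchwartzMap.smulLeftCLM ℂ (fun x : Conf n => G (x m)) φ) := by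
    ext x
    rw [lineDeriv_smulLeft l m μ hG hF, if_neg hlm, zero_add,
      SchwartzMap.smulLeftCLM_apply_apply (hasTemperateGrowth_comp_apply hG m), smul_eq_mul]
  change -E _ = -E _
  exact congrArg (fun ψ => -E ψ) h

/-- Dual form of the Leibniz rule. With `G = D_{pq}(y - ·)` the first term on the right is the
contribution in which the divergence acts on the contraction function. -/
theorem pderivL_mulAtL_self {n : ℕ} (m : Fin n) (μ : Fin 4) {G : Mink → ℂ}
    {F : Fin 4 → Mink → ℂ} (hG : G.HasTemperateGrowth) (hF' : (F μ).HasTemperateGrowth)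
    (hF : ∀ x, HasFDerivAt G (∑ μ, F μ x • coordC μ) x) (E : OpDist r n) :
    pderivL m μ (mulAtL m G E) = mulAtL m (F μ) E + mulAtL m G (pderivL m μ E) := by
  ext φ : 1
  have h : SchwartzMap.smulLeftCLM ℂ (fun x : Conf n => G (x m))
      (∂_{(Pi.single m (EuclideanSpace.single μ 1) : Conf n)} φ) =
      ∂_{(Pi.single m (EuclideanSpace.single μ 1) : Conf n)}
        (SchwartzMap.smulLeftCLM ℂ (fun x : Conf n => G (x m)) φ) -
      SchwartzMap.smulLeftCLM ℂ (fun x : Conf n => F μ (x m)) φ := by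
    ext x
    rw [sub_apply, lineDeriv_smulLeft m m μ hG hF, if_pos rfl,
      SchwartzMap.smulLeftCLM_apply_apply (hasTemperateGrowth_comp_apply hG m),
      SchwartzMap.smulLeftCLM_apply_apply (hasTemperateGrowth_comp_apply hF' m), smul_eq_mul,
      smul_eq_mul]
    ring
  change -E (SchwartzMap.smulLeftCLM ℂ (fun x : Conf n => G (x m))
      (∂_{(Pi.single m (EuclideanSpace.single μ 1) : Conf n)} φ)) =
    E (SchwartzMap.smulLeftCLM ℂ (fun x : Conf n => F μ (x m)) φ) +
      -E (∂_{(Pi.single m (EuclideanSpace.single μ 1) : Conf n)}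
        (SchwartzMap.smulLeftCLM ℂ (fun x : Conf n => G (x m)) φ))
  rw [h, LinearMap.map_sub]
  abel

theorem reorderL_pderivL {n : ℕ} (σ : Equiv.Perm (Fin n)) (l : Fin n) (μ : Fin 4)
    (E : OpDist r n) : reorderL σ (pderivL l μ E) = pderivL (σ l) μ (reorderL σ E) := by
  ext φ : 1
  have h := SchwartzMap.lineDerivOp_compCLMOfContinuousLinearEquiv (𝕜 := ℂ)
    (Pi.single l (EuclideanSpace.single μ 1) : Conf n)
    (LinearEquiv.funCongrLeft ℝ Mink σ.symm).toContinuousLinearEquiv φ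
  have h2 : (LinearEquiv.funCongrLeft ℝ Mink σ.symm).toContinuousLinearEquiv
      (Pi.single l (EuclideanSpace.single μ 1) : Conf n) =
      Pi.single (σ l) (EuclideanSpace.single μ 1) := by
    funext i
    change (Pi.single l (EuclideanSpace.single μ 1) : Conf n) (σ.symm i) = _
    by_cases hi : i = σ l
    · subst hi; simp
    · rw [Pi.single_eq_of_ne hi, Pi.single_eq_of_ne fun h => hi (by rw [← h]; simp)]
  rw [h2] at h
  exact congrArg (fun ψ => -E ψ) h

/-! ### Skew-symmetry for cyclic permutations. -/

theorem swap_succAbove {n : ℕ} (i : ℕ) (h : i + 1 < n + 1) (j : Fin n) :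
    Equiv.swap (⟨i, by omega⟩ : Fin (n + 1)) ⟨i + 1, h⟩
      ((⟨i, by omega⟩ : Fin (n + 1)).succAbove j) = (⟨i + 1, h⟩ : Fin (n + 1)).succAbove j := by
  rw [Equiv.swap_apply_def]
  simp only [Fin.succAbove, Fin.lt_def, Fin.ext_iff, Fin.val_castSucc]
  split_ifs <;> simp_all <;> omega

/-- One adjacent transposition turns the cycle for the place `i` into the one for `i + 1`. This is
the inductive step from the skew-symmetry axiom, stated for neighbours, to the move of an arbitrary
entry to the front. -/
theorem swap_mul_cycleRange_symm {n : ℕ} (i : ℕ) (h : i + 1 < n + 1) :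
    Equiv.swap (⟨i, by omega⟩ : Fin (n + 1)) ⟨i + 1, h⟩ *
      (⟨i, by omega⟩ : Fin (n + 1)).cycleRange.symm =
        (⟨i + 1, h⟩ : Fin (n + 1)).cycleRange.symm := by
  ext j : 1
  refine Fin.cases ?_ (fun j => ?_) j
  · rw [Equiv.Perm.mul_apply, Fin.cycleRange_symm_zero, Fin.cycleRange_symm_zero,
      Equiv.swap_apply_left]
  · rw [Equiv.Perm.mul_apply, Fin.cycleRange_symm_succ, Fin.cycleRange_symm_succ, swap_succAbove]

theorem prod_swap_sign {n : ℕ} (a : Fin (n + 1) → ℕ) (i : ℕ) (h : i + 1 < n + 1) :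
    (-1 : ℂ) ^ (a ⟨i, by omega⟩ * a ⟨i + 1, h⟩) *
      (∏ l, if l < (⟨i, by omega⟩ : Fin (n + 1)) then (-1 : ℂ) ^
        ((a ∘ Equiv.swap (⟨i, by omega⟩ : Fin (n + 1)) ⟨i + 1, h⟩) l * a ⟨i + 1, h⟩) else 1) =
      ∏ l, if l < (⟨i + 1, h⟩ : Fin (n + 1)) then (-1 : ℂ) ^ (a l * a ⟨i + 1, h⟩) else 1 := by
  have e : ∀ l, (if l < (⟨i + 1, h⟩ : Fin (n + 1)) then (-1 : ℂ) ^ (a l * a ⟨i + 1, h⟩) else 1) =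
      (if l = (⟨i, by omega⟩ : Fin (n + 1)) then (-1 : ℂ) ^ (a l * a ⟨i + 1, h⟩) else 1) *
      (if l < (⟨i, by omega⟩ : Fin (n + 1)) then (-1 : ℂ) ^
        ((a ∘ Equiv.swap (⟨i, by omega⟩ : Fin (n + 1)) ⟨i + 1, h⟩) l * a ⟨i + 1, h⟩) else 1) := by
    intro l
    rcases lt_trichotomy (l : ℕ) i with hl | hl | hl
    · have h1 : l < (⟨i + 1, h⟩ : Fin (n + 1)) := by rw [Fin.lt_def]; simp; omega
      have h2 : l < (⟨i, by omega⟩ : Fin (n + 1)) := hl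
      rw [if_pos h1, if_neg h2.ne, if_pos h2, one_mul, Function.comp_apply,
        Equiv.swap_apply_of_ne_of_ne h2.ne h1.ne]
    · have h1 : l = (⟨i, by omega⟩ : Fin (n + 1)) := Fin.ext hl
      have h2 : l < (⟨i + 1, h⟩ : Fin (n + 1)) := by rw [Fin.lt_def]; simp; omega
      rw [if_pos h2, if_pos h1, if_neg (by rw [h1]; exact lt_irrefl _), mul_one]
    · rw [if_neg, if_neg, if_neg, one_mul]
      · rw [Fin.lt_def]; simp; omega
      · rw [Fin.ext_iff]; simp; omega
      · rw [Fin.lt_def]; simp; omega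
  rw [Finset.prod_congr rfl fun l _ => e l, Finset.prod_mul_distrib, Finset.prod_ite_eq']
  simp

namespace ChronologicalProducts

variable (𝒯 : ChronologicalProducts r)

/-- Skew-symmetry for the cyclic permutation that moves the entry `m` to the first place. -/
theorem skew_cycle {n : ℕ} (A : Fin (n + 1) → Xi r) (a : Fin (n + 1) → ℕ)
    (hA : ∀ l, HasParity (A l) (a l)) (m : Fin (n + 1)) :
    𝒯.T (n + 1) A = (∏ l, if l < m then (-1 : ℂ) ^ (a l * a m) else 1) •
      reorderL m.cycleRange.symm
        (𝒯.T (n + 1) (Fin.cons (A m) fun j => A (m.succAbove j))) := by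
  have hcons : ∀ (m : Fin (n + 1)) (A : Fin (n + 1) → Xi r),
      (Fin.cons (A m) fun j => A (m.succAbove j)) = A ∘ m.cycleRange.symm := by
    intro m A
    funext j
    refine Fin.cases ?_ (fun j => ?_) j <;> simp
  obtain ⟨m, hm⟩ := m
  rw [hcons]
  induction m generalizing A a with
  | zero =>
    have h1 : (⟨0, hm⟩ : Fin (n + 1)).cycleRange.symm = 1 := by
      change (0 : Fin (n + 1)).cycleRange.symm = 1
      rw [Fin.cycleRange_zero]; rfl
    rw [h1, reorderL_one]
    have h2 : ∀ l : Fin (n + 1), ¬ l < ⟨0, hm⟩ := fun l h => by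
      rw [Fin.lt_def] at h; simp at h
    simp only [h2, if_false, Finset.prod_const_one, one_smul]
    rfl
  | succ i ih =>
    set s := Equiv.swap (⟨i, by omega⟩ : Fin (n + 1)) ⟨i + 1, hm⟩ with hs
    -- The entry at `i + 1` is first exchanged with its left neighbour; the induction hypothesis,
    -- applied to the exchanged family, then moves it from `i` to the front.
    have h1 := 𝒯.skew (n + 1) A a hA ⟨i, by omega⟩ ⟨i + 1, hm⟩ rfl
    rw [ih (A ∘ s) (a ∘ s) (fun l => hA _) (by omega), ← reorderL_apply, map_smul, reorderL_mul,
      smul_smul, swap_mul_cycleRange_symm] at h1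
    rw [h1]
    have h2 : (a ∘ s) ⟨i, by omega⟩ = a ⟨i + 1, hm⟩ := by simp [hs]
    rw [h2, prod_swap_sign a i hm, Function.comp_assoc, ← Equiv.Perm.coe_mul, hs,
      swap_mul_cycleRange_symm]

theorem update_eq_zero_of_mem {n : ℕ} (A : Fin n → Xi r) (m : Fin n) {X : Xi r}
    (hX : X ∈ boxSpan r) : (𝒯.T n).toLinearMap A m X = 0 := by
  induction hX using Submodule.span_induction with
  | mem X h =>
    obtain ⟨B, p, rfl⟩ := h
    exact 𝒯.onShell n _ m B p (Function.update_self _ _ _)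
  | zero => exact map_zero _
  | add X Y _ _ hX hY => rw [map_add, hX, hY, add_zero]
  | smul c X _ hX => rw [map_smul, hX, smul_zero]

end ChronologicalProducts

/-! ### The gauge charge on Fock space and its commutators with the free fields. -/

/-- The graded derivation split into its action on the first particle and on the others. It matches
the recursion `createSum_succ` and allows induction on the particle number. -/
theorem gaugeSum_succ {n : ℕ} (F : (Fin (n + 1) → Label r) → ℂ) (z : Fin (n + 1) → Label r) :
    gaugeSum F z = ∑ t, gaugeCoeff (z 0).1 t (z 0).2 * F (Fin.cons (t, (z 0).2) (z ∘ Fin.succ)) +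
      (-1 : ℂ) ^ (z 0).1.parity * gaugeSum (fun y => F (Fin.cons (z 0) y)) (z ∘ Fin.succ) := by
  unfold gaugeSum
  rw [Fin.sum_univ_succ]
  congr 1
  · rw [Finset.prod_eq_one fun i _ => if_neg (Fin.not_lt_zero i), one_mul]
    refine Finset.sum_congr rfl fun t _ => ?_
    congr 2
    funext i
    refine Fin.cases ?_ (fun i => ?_) i
    · simp
    · simp
  · rw [Finset.mul_sum]
    refine Finset.sum_congr rfl fun j _ => ?_
    rw [Fin.prod_univ_succ, if_pos (Fin.succ_pos j), mul_assoc]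
    congr 2
    · exact Finset.prod_congr rfl fun i _ => by simp
    · refine Finset.sum_congr rfl fun t _ => ?_
      simp only [Function.comp_apply]
      congr 2
      funext i
      refine Fin.cases ?_ (fun i => ?_) i
      · rw [Function.update_of_ne (Fin.succ_ne_zero j).symm]; simp
      · simp [Function.update_apply]

theorem createSum_add (s : Species r) (ψ : Mom → ℂ) {n : ℕ} (F G : (Fin n → Label r) → ℂ)
    (z : Fin (n + 1) → Label r) :
    createSum s ψ (fun y => F y + G y) z = createSum s ψ F z + createSum s ψ G z := by
  simp only [createSum, mul_add, Finset.sum_add_distrib]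

theorem createSum_sum (s : Species r) (ψ : Mom → ℂ) {n : ℕ} {ι : Type*} (S : Finset ι)
    (F : ι → (Fin n → Label r) → ℂ) (z : Fin (n + 1) → Label r) :
    createSum s ψ (fun y => ∑ i ∈ S, F i y) z = ∑ i ∈ S, createSum s ψ (F i) z := by
  simp only [createSum, Finset.mul_sum]
  rw [Finset.sum_comm]

theorem gaugeSum_add {n : ℕ} (F G : (Fin n → Label r) → ℂ) (z : Fin n → Label r) :
    gaugeSum (fun y => F y + G y) z = gaugeSum F z + gaugeSum G z := by
  simp only [gaugeSum, mul_add, Finset.sum_add_distrib]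

theorem gaugeSum_const_mul {n : ℕ} (c : ℂ) (F : (Fin n → Label r) → ℂ) (z : Fin n → Label r) :
    gaugeSum (fun y => c * F y) z = c * gaugeSum F z := by
  simp only [gaugeSum, Finset.mul_sum]
  exact Finset.sum_congr rfl fun j _ => Finset.sum_congr rfl fun t _ => by ring

/-- The amplitude is non-zero only between species of opposite parity, and then `|t| ≡ |s| + 1`. -/
theorem gaugeCoeff_mul_sign (s t : Species r) (k : Mom) (a : ℕ) :
    gaugeCoeff s t k * (-1 : ℂ) ^ (a * t.parity) =
      gaugeCoeff s t k * ((-1 : ℂ) ^ a * (-1) ^ (a * s.parity)) := by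
  by_cases h : s.parity + t.parity = 1
  · rcases (by omega : s.parity = 0 ∧ t.parity = 1 ∨ s.parity = 1 ∧ t.parity = 0)
      with ⟨h, h'⟩ | ⟨h, h'⟩ <;> simp [h, h', neg_one_pow_mul_self]
  · rw [gaugeCoeff_parity _ _ _ h]; simp

/-- `Q` acts as a graded derivation on the symmetrized tensor product. -/
theorem gaugeSum_createSum (s : Species r) (ψ : Mom → ℂ) {n : ℕ} (F : (Fin n → Label r) → ℂ)
    (z : Fin (n + 1) → Label r) : gaugeSum (createSum s ψ F) z =
      (-1 : ℂ) ^ s.parity * createSum s ψ (gaugeSum F) z +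
        ∑ s', createSum s' (fun k => gaugeCoeff s' s k * ψ k) F z := by
  induction n with
  | zero =>
    have h1 : ∀ (s : Species r) (ψ : Mom → ℂ) (G : (Fin 0 → Label r) → ℂ) (y : Fin 1 → Label r),
        createSum s ψ G y = (if (y 0).1 = s then ψ (y 0).2 else 0) * G (z ∘ Fin.succ) := by
      intro s ψ G y
      simp [createSum, Subsingleton.elim (y ∘ Fin.succ) (z ∘ Fin.succ)]
    have h0 : ∀ (G : (Fin 0 → Label r) → ℂ) y, gaugeSum G y = 0 := fun G y => by simp [gaugeSum]
    rw [gaugeSum_succ, h0]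
    simp [h1, h0, mul_assoc]
  | succ n ih =>
    rw [gaugeSum_succ]
    simp only [createSum_succ, Fin.cons_zero]
    have cs : ∀ {m : ℕ} (a : Label r) (y : Fin m → Label r),
        (Fin.cons a y : Fin (m + 1) → Label r) ∘ Fin.succ = y := by
      intro m a y; funext k; simp
    simp only [cs]
    rw [gaugeSum_add, gaugeSum_const_mul, gaugeSum_const_mul, ih]
    have h1 : createSum s ψ (fun y => gaugeSum F (Fin.cons (z 0) y)) (z ∘ Fin.succ) =
        (∑ t, gaugeCoeff (z 0).1 t (z 0).2 *
          createSum s ψ (fun y => F (Fin.cons (t, (z 0).2) y)) (z ∘ Fin.succ)) +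
        (-1 : ℂ) ^ (z 0).1.parity *
          createSum s ψ (gaugeSum fun y => F (Fin.cons (z 0) y)) (z ∘ Fin.succ) := by
      simp only [gaugeSum_succ F, Fin.cons_zero, cs]
      rw [createSum_add, createSum_sum, createSum_const_mul]
      simp only [createSum_const_mul]
    rw [h1]
    simp only [mul_add, Finset.sum_add_distrib]
    -- Four contributions are compared, according to whether the new particle is the first one and
    -- whether `Q` acts on the first one. In `h2` the new particle is in front and is hit by `Q`; in
    -- `h3` an old particle in front is hit; `h4` is the new particle further back hit by `Q`; in
    -- `h5` the new particle is in front and `Q` acts behind it.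
    have h2 : ∑ t, gaugeCoeff (z 0).1 t (z 0).2 * ((if t = s then ψ (z 0).2 else 0) *
        F (z ∘ Fin.succ)) = ∑ s', (if (z 0).1 = s' then gaugeCoeff s' s (z 0).2 * ψ (z 0).2 else 0) *
        F (z ∘ Fin.succ) := by
      simp [mul_assoc]
    have h3 : ∑ t, gaugeCoeff (z 0).1 t (z 0).2 * ((-1 : ℂ) ^ (s.parity * t.parity) *
        createSum s ψ (fun y => F (Fin.cons (t, (z 0).2) y)) (z ∘ Fin.succ)) =
        (-1 : ℂ) ^ s.parity * ((-1 : ℂ) ^ (s.parity * (z 0).1.parity) *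
          ∑ t, gaugeCoeff (z 0).1 t (z 0).2 *
          createSum s ψ (fun y => F (Fin.cons (t, (z 0).2) y)) (z ∘ Fin.succ)) := by
      simp only [Finset.mul_sum]
      refine Finset.sum_congr rfl fun t _ => ?_
      rw [← mul_assoc, gaugeCoeff_mul_sign]; ring
    have h4 : ∑ s', (-1 : ℂ) ^ (s'.parity * (z 0).1.parity) *
        createSum s' (fun k => gaugeCoeff s' s k * ψ k) (fun y => F (Fin.cons (z 0) y))
          (z ∘ Fin.succ) = (-1 : ℂ) ^ (z 0).1.parity * ((-1 : ℂ) ^ (s.parity * (z 0).1.parity) *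
        ∑ s', createSum s' (fun k => gaugeCoeff s' s k * ψ k) (fun y => F (Fin.cons (z 0) y))
          (z ∘ Fin.succ)) := by
      simp only [Finset.mul_sum]
      refine Finset.sum_congr rfl fun s' _ => ?_
      simp only [createSum, Finset.mul_sum]
      refine Finset.sum_congr rfl fun j _ => ?_
      have hc : ∀ k, (-1 : ℂ) ^ (s'.parity * (z 0).1.parity) * gaugeCoeff s' s k =
          (-1 : ℂ) ^ (z 0).1.parity * (-1 : ℂ) ^ (s.parity * (z 0).1.parity) *
            gaugeCoeff s' s k := by
        intro k
        by_cases h : s'.parity + s.parity = 1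
        · rcases (by omega : s'.parity = 0 ∧ s.parity = 1 ∨ s'.parity = 1 ∧ s.parity = 0)
            with ⟨h, h'⟩ | ⟨h, h'⟩ <;> simp [h, h', neg_one_pow_mul_self]
        · rw [gaugeCoeff_parity _ _ _ h]; simp
      split_ifs
      · linear_combination (ψ ((z ∘ Fin.succ) j).2 * (∏ i, if i < j then
          (-1 : ℂ) ^ (s'.parity * ((z ∘ Fin.succ) i).1.parity) else 1) *
          F (Fin.cons (z 0) ((z ∘ Fin.succ) ∘ j.succAbove))) * hc ((z ∘ Fin.succ) j).2
      · ring
    rw [h2, h3, h4]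
    have h5 : (-1 : ℂ) ^ (z 0).1.parity * ((if (z 0).1 = s then ψ (z 0).2 else 0) *
        gaugeSum (fun y => F y) (z ∘ Fin.succ)) = (-1 : ℂ) ^ s.parity *
        ((if (z 0).1 = s then ψ (z 0).2 else 0) * gaugeSum F (z ∘ Fin.succ)) := by
      split_ifs with h
      · rw [h]
      · simp
    rw [h5]
    ring

theorem polyBounded_sum {ι : Type*} (S : Finset ι) {F : ι → Mom → ℂ}
    (hF : ∀ i ∈ S, PolyBounded (F i)) : PolyBounded fun k => ∑ i ∈ S, F i k := by
  classical
  induction S using Finset.induction_on with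
  | empty => simpa using polyBounded_const 0
  | insert i S hi ih =>
    obtain ⟨h1, a, C, hC⟩ := hF i (Finset.mem_insert_self i S)
    obtain ⟨h2, b, D, hD⟩ := ih fun j hj => hF j (Finset.mem_insert_of_mem hj)
    have hC0 : 0 ≤ C := by simpa using le_trans (norm_nonneg _) (hC 0)
    have hD0 : 0 ≤ D := by simpa using le_trans (norm_nonneg _) (hD 0)
    simp only [Finset.sum_insert hi]
    refine ⟨h1.add h2, a + b, C + D, fun k => (norm_add_le _ _).trans ?_⟩
    rw [add_mul]
    have hk : 1 ≤ 1 + ‖k‖ := by linarith [norm_nonneg k]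
    refine add_le_add ((hC k).trans ?_) ((hD k).trans ?_)
    · exact mul_le_mul_of_nonneg_left (pow_le_pow_right₀ hk (by omega)) hC0
    · exact mul_le_mul_of_nonneg_left (pow_le_pow_right₀ hk (by omega)) hD0

/-- The value of a state at a point, as a linear form. -/
def Fock.eval (n : ℕ) (z : Fin n → Label r) : Fock r →ₗ[ℂ] ℂ where
  toFun Ψ := Ψ.1 n z
  map_add' _ _ := rfl
  map_smul' _ _ := rfl

theorem Fock.eval_apply (n : ℕ) (z : Fin n → Label r) (Ψ : Fock r) :
    Fock.eval n z Ψ = Ψ.1 n z := rfl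

theorem Fock.ext_eval {Ψ Φ : Fock r} (h : ∀ n z, Fock.eval n z Ψ = Fock.eval n z Φ) : Ψ = Φ :=
  Subtype.ext (funext fun n => funext fun z => h n z)

theorem eval_create_zero (s : Species r) (ψ : Mom → ℂ) (hψ : RapidlyDecreasing ψ) (Φ : Fock r)
    (z : Fin 0 → Label r) : Fock.eval 0 z (create s ψ hψ Φ) = 0 := rfl

theorem eval_create_succ (s : Species r) (ψ : Mom → ℂ) (hψ : RapidlyDecreasing ψ) (Φ : Fock r)
    (n : ℕ) (z : Fin (n + 1) → Label r) :
    Fock.eval (n + 1) z (create s ψ hψ Φ) = createSum s ψ (Φ.1 n) z := rfl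

theorem eval_annihilate (χ : Species r → Mom → ℂ) (hχ : ∀ t, PolyBounded (χ t)) (Φ : Fock r)
    (n : ℕ) (z : Fin n → Label r) : Fock.eval n z (annihilate χ hχ Φ) =
      ∑ t, ∫ k, χ t k * Φ.1 (n + 1) (Fin.cons (t, k) z) ∂coneMeasure := rfl

theorem eval_gaugeCharge (Φ : Fock r) (n : ℕ) (z : Fin n → Label r) :
    Fock.eval n z (gaugeCharge Φ) = gaugeSum (Φ.1 n) z := rfl

theorem gaugeCharge_create (s : Species r) (ψ : Mom → ℂ) (hψ : RapidlyDecreasing ψ)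
    (Φ : Fock r) : gaugeCharge (create s ψ hψ Φ) =
      (-1 : ℂ) ^ s.parity • create s ψ hψ (gaugeCharge Φ) +
        ∑ s', create s' (fun k => gaugeCoeff s' s k * ψ k)
          ((polyBounded_gaugeCoeff s' s).mul_rapid hψ) Φ := by
  refine Fock.ext_eval fun n z => ?_
  rw [map_add, map_smul, map_sum, smul_eq_mul]
  cases n with
  | zero => simp [eval_create_zero, eval_gaugeCharge, gaugeSum]
  | succ n => exact gaugeSum_createSum s ψ (Φ.1 n) z

/-- In `gaugeSum_succ` the action of `Q` on the contracted particle moves onto `χ` as a transposed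
amplitude, while the action on the rest passes the contraction with the sign of the contracted
species. That sign is uniform because `χ` is supported on species of parity `e`. The remaining work
is to exchange finite sums with integrals. -/
theorem gaugeCharge_annihilate (e : ℕ) (χ : Species r → Mom → ℂ) (hχ : ∀ t, PolyBounded (χ t))
    (he : ∀ t, t.parity ≠ e → χ t = 0) (Φ : Fock r) :
    annihilate χ hχ (gaugeCharge Φ) =
      (-1 : ℂ) ^ e • gaugeCharge (annihilate χ hχ Φ) +
        annihilate (fun t' k => ∑ t, χ t k * gaugeCoeff t t' k)
          (fun t' => polyBounded_sum _ fun t _ => (hχ t).mul (polyBounded_gaugeCoeff t t')) Φ := by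
  refine Fock.ext_eval fun n z => ?_
  rw [map_add, map_smul, smul_eq_mul, eval_annihilate, eval_annihilate, eval_gaugeCharge]
  have cs : ∀ (a : Label r) (y : Fin n → Label r),
      (Fin.cons a y : Fin (n + 1) → Label r) ∘ Fin.succ = y := by
    intro a y; funext k; simp
  have hint : ∀ t t', Integrable (fun k => χ t k * gaugeCoeff t t' k *
      Φ.1 (n + 1) (Fin.cons (t', k) z)) coneMeasure := fun t t' =>
    Fock.integrable Φ ((hχ t).mul (polyBounded_gaugeCoeff t t')) t' z
  have h1 : gaugeSum ((annihilate χ hχ Φ).1 n) z =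
      ∑ t, ∫ k, χ t k * gaugeSum (fun y => Φ.1 (n + 1) (Fin.cons (t, k) y)) z ∂coneMeasure := by
    have e1 : ∀ t, ∫ k, χ t k * gaugeSum (fun y => Φ.1 (n + 1) (Fin.cons (t, k) y)) z ∂coneMeasure
        = ∑ j, (∏ i, if i < j then (-1 : ℂ) ^ (z i).1.parity else 1) *
          ∑ t', gaugeCoeff (z j).1 t' (z j).2 * ∫ k, χ t k * Φ.1 (n + 1)
            (Fin.cons (t, k) (Function.update z j (t', (z j).2))) ∂coneMeasure := by
      intro t
      simp only [gaugeSum, ← integral_const_mul, Finset.mul_sum]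
      rw [integral_finsetSum]
      · refine Finset.sum_congr rfl fun j _ => ?_
        rw [integral_finsetSum]
        · refine Finset.sum_congr rfl fun t' _ => ?_
          congr 1
          funext k
          ring
        · intro t' _
          have := (Fock.integrable Φ (hχ t) t (Function.update z j (t', (z j).2))).const_mul
            ((∏ i, if i < j then (-1 : ℂ) ^ (z i).1.parity else 1) *
              gaugeCoeff (z j).1 t' (z j).2)
          refine this.congr (Filter.Eventually.of_forall fun k => ?_)
          dsimp only
          ring
      · intro j _
        refine integrable_finsetSum _ fun t' _ => ?_
        have := (Fock.integrable Φ (hχ t) t (Function.update z j (t', (z j).2))).const_mul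
          ((∏ i, if i < j then (-1 : ℂ) ^ (z i).1.parity else 1) *
            gaugeCoeff (z j).1 t' (z j).2)
        refine this.congr (Filter.Eventually.of_forall fun k => ?_)
        dsimp only
        ring
    rw [Finset.sum_congr rfl fun t _ => e1 t, Finset.sum_comm]
    unfold gaugeSum
    refine Finset.sum_congr rfl fun j _ => ?_
    rw [← Finset.mul_sum, Finset.sum_comm]
    congr 1
    refine Finset.sum_congr rfl fun t' _ => ?_
    rw [← Finset.mul_sum]
    rfl
  have h2 : ∑ t', ∫ k, (∑ t, χ t k * gaugeCoeff t t' k) * Φ.1 (n + 1) (Fin.cons (t', k) z)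
      ∂coneMeasure = ∑ t, ∫ k, χ t k * ∑ t', gaugeCoeff t t' k *
        Φ.1 (n + 1) (Fin.cons (t', k) z) ∂coneMeasure := by
    have e1 : ∀ t', ∫ k, (∑ t, χ t k * gaugeCoeff t t' k) * Φ.1 (n + 1) (Fin.cons (t', k) z)
        ∂coneMeasure = ∑ t, ∫ k, χ t k * gaugeCoeff t t' k *
          Φ.1 (n + 1) (Fin.cons (t', k) z) ∂coneMeasure := by
      intro t'
      rw [← integral_finsetSum _ fun t _ => hint t t']
      simp only [Finset.sum_mul]
    have e2 : ∀ t, ∫ k, χ t k * ∑ t', gaugeCoeff t t' k *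
        Φ.1 (n + 1) (Fin.cons (t', k) z) ∂coneMeasure = ∑ t', ∫ k, χ t k * gaugeCoeff t t' k *
          Φ.1 (n + 1) (Fin.cons (t', k) z) ∂coneMeasure := by
      intro t
      rw [← integral_finsetSum _ fun t' _ => hint t t']
      simp only [Finset.mul_sum, mul_assoc]
    simp only [e1, e2]
    rw [Finset.sum_comm]
  rw [h1, h2, Finset.mul_sum, ← Finset.sum_add_distrib]
  refine Finset.sum_congr rfl fun t _ => ?_
  by_cases ht : t.parity = e
  · rw [← integral_const_mul, ← integral_add]
    · congr 1
      funext k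
      change χ t k * gaugeSum (Φ.1 (n + 1)) (Fin.cons (t, k) z) = _
      rw [gaugeSum_succ]
      simp only [Fin.cons_zero, cs, ht]
      ring
    · have := integrable_finsetSum Finset.univ fun (j : Fin n) _ => integrable_finsetSum Finset.univ
        fun (t' : Species r) _ => (Fock.integrable Φ (hχ t) t
          (Function.update z j (t', (z j).2))).const_mul ((-1 : ℂ) ^ e *
            (∏ i, if i < j then (-1 : ℂ) ^ (z i).1.parity else 1) *
            gaugeCoeff (z j).1 t' (z j).2)
      refine this.congr (Filter.Eventually.of_forall fun k => ?_)
      simp only [gaugeSum, Finset.mul_sum]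
      refine Finset.sum_congr rfl fun j _ => Finset.sum_congr rfl fun t' _ => ?_
      ring
    · have := integrable_finsetSum Finset.univ fun t' _ => hint t t'
      refine this.congr (Filter.Eventually.of_forall fun k => ?_)
      dsimp only
      simp only [Finset.mul_sum, mul_assoc]
  · simp [he t ht]

theorem create_of_zero (s : Species r) (ψ : Mom → ℂ) (hψ : RapidlyDecreasing ψ)
    (h : ∀ k, ψ k = 0) (Φ : Fock r) : create s ψ hψ Φ = 0 := by
  refine Fock.ext_eval fun n z => ?_
  cases n with
  | zero => rfl
  | succ n => simp [eval_create_succ, createSum, h]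

theorem create_eq_smul (s : Species r) (ψ ψ' : Mom → ℂ) (hψ : RapidlyDecreasing ψ)
    (hψ' : RapidlyDecreasing ψ') (c : ℂ) (h : ∀ k, ψ k = c * ψ' k) (Φ : Fock r) :
    create s ψ hψ Φ = c • create s ψ' hψ' Φ := by
  refine Fock.ext_eval fun n z => ?_
  rw [map_smul, smul_eq_mul]
  cases n with
  | zero => simp [eval_create_zero]
  | succ n =>
    simp only [eval_create_succ, createSum, h, Finset.mul_sum]
    refine Finset.sum_congr rfl fun j _ => ?_
    split_ifs <;> ring

theorem annihilate_eq_sum {ι : Type*} (S : Finset ι) (c : ι → ℂ) (χ : Species r → Mom → ℂ)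
    (χ' : ι → Species r → Mom → ℂ) (hχ : ∀ t, PolyBounded (χ t))
    (hχ' : ∀ i t, PolyBounded (χ' i t)) (h : ∀ t k, χ t k = ∑ i ∈ S, c i * χ' i t k)
    (Φ : Fock r) : annihilate χ hχ Φ = ∑ i ∈ S, c i • annihilate (χ' i) (hχ' i) Φ := by
  refine Fock.ext_eval fun n z => ?_
  rw [map_sum]
  simp only [map_smul, smul_eq_mul, eval_annihilate, Finset.mul_sum, h]
  rw [Finset.sum_comm]
  refine Finset.sum_congr rfl fun t _ => ?_
  simp only [← integral_const_mul]
  rw [← integral_finsetSum]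
  · congr 1
    funext k
    rw [Finset.sum_mul]
    exact Finset.sum_congr rfl fun i _ => by ring
  · intro i _
    exact (Fock.integrable Φ (hχ' i t) t z).const_mul _

theorem twoPoint_eq_zero (s t : Species r) (h : s.parity ≠ t.parity) : twoPoint s t = 0 := by
  cases s <;> cases t <;> simp_all [twoPoint, Species.parity]

/-- The momenta in the amplitudes are derivatives of the field: `-p^μ = (i η^{μμ})(i p_μ)` for `v →
u`, and `p_μ = (-i)(i p_μ)` for `ũ → v`. These are the coefficients of `d_Q ξ_p`. -/
theorem sum_create_gaugeCoeff (p : Jet r) (g : 𝓢(Mink, ℂ)) (Φ : Fock r) :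
    ∑ s', create s' (fun k => gaugeCoeff s' p.1 k * (momPoly Complex.I p.2 k * hatPos g k))
      ((polyBounded_gaugeCoeff s' p.1).mul_rapid
        ((polyBounded_momPoly _ _).mul_rapid (rapid_hatPos g))) Φ =
      (dQCoeff p).sum fun p' c => c • fieldPlus p' g Φ := by
  rcases p with ⟨a | a | a, M⟩
  · rename_i μ
    rw [dQCoeff, Finsupp.sum_single_index (h := fun p' c => c • fieldPlus p' g Φ) (zero_smul _ _),
      Finset.sum_eq_single (.u a)]
    · refine create_eq_smul _ _ _ _ _ _ (fun k => ?_) Φ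
      simp only [gaugeCoeff, if_true, momPoly_cons, onShellLow]
      linear_combination ((onShell k μ : ℂ) * momPoly Complex.I M k * hatPos g k) *
        (eta_mul_eta μ) - (eta μ * eta μ * (onShell k μ : ℂ) * momPoly Complex.I M k * hatPos g k) *
        Complex.I_mul_I
    · intro s' _ hs
      refine create_of_zero _ _ _ (fun k => ?_) Φ
      cases s' <;> simp [gaugeCoeff]
      rename_i b
      intro h
      exact absurd (by rw [h]) hs
    · simp
  · rw [dQCoeff, Finsupp.sum_zero_index]
    refine Finset.sum_eq_zero fun s' _ => create_of_zero _ _ _ (fun k => ?_) Φ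
    cases s' <;> simp [gaugeCoeff]
  · rw [dQCoeff, ← Finsupp.sum_finsetSum_index (h := fun p' c => c • fieldPlus p' g Φ)
      (fun _ => zero_smul _ _) (fun _ _ _ => add_smul _ _ _)]
    simp only [Finsupp.sum_single_index, zero_smul]
    symm
    refine Fintype.sum_of_injective (fun μ => Species.v a μ) (fun μ ν h => by simpa using h) _ _ ?_ ?_
    · intro s' hs
      refine create_of_zero _ _ _ (fun k => ?_) Φ
      cases s' <;> simp [gaugeCoeff]
      rename_i b μ
      intro h
      exact absurd ⟨μ, by rw [h]⟩ hs
    · intro μ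
      symm
      refine create_eq_smul _ _ _ _ _ _ (fun k => ?_) Φ
      simp only [gaugeCoeff, if_true, momPoly_cons]
      linear_combination (onShellLow k μ * momPoly Complex.I M k * hatPos g k) * Complex.I_mul_I

/-- Counterpart for the annihilation part: the two-point matrix intertwines the transposed
amplitudes with those of `d_Q ξ_p`, now with derivatives `-i p_μ`. This is compatibility of the
two-point functions with `QΩ = 0`. -/
theorem sum_twoPoint_gaugeCoeff (p : Jet r) (t' : Species r) (k : Mom) (h : ℂ) :
    -(-1 : ℂ) ^ p.parity * ∑ t, twoPoint p.1 t * (momPoly (-Complex.I) p.2 k * h) *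
      gaugeCoeff t t' k = (dQCoeff p).sum fun p' c =>
        c * (twoPoint p'.1 t' * (momPoly (-Complex.I) p'.2 k * h)) := by
  rcases p with ⟨a | a | a, M⟩
  · rename_i μ
    rw [dQCoeff, Finsupp.sum_single_index (zero_mul _), Finset.sum_eq_single (.v a μ)]
    · cases t' <;> simp [gaugeCoeff, twoPoint, Jet.parity, Species.parity]
      split_ifs
      · rw [momPoly_cons, onShellLow]
        linear_combination (momPoly (-Complex.I) M k * h * eta μ * eta μ * (onShell k μ : ℂ)) *
          Complex.I_mul_I
      · simp
    · intro t _ ht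
      cases t <;> simp [twoPoint]
      intro h1 h2
      exact absurd (by rw [h1, h2]) ht
    · simp
  · rw [dQCoeff, Finsupp.sum_zero_index, Finset.sum_eq_zero, mul_zero]
    intro t _
    cases t <;> simp [twoPoint, gaugeCoeff]
  · rw [dQCoeff, ← Finsupp.sum_finsetSum_index (fun _ => zero_mul _) (fun _ _ _ => add_mul _ _ _)]
    simp only [Finsupp.sum_single_index, zero_mul]
    rw [Finset.sum_eq_single (.u a)]
    · cases t' <;> simp [gaugeCoeff, twoPoint, Jet.parity, Species.parity]
      rename_i b ν
      split_ifs with hab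
      · simp only [true_and, hab, momPoly_cons, onShellLow]
        rw [Finset.sum_eq_single ν]
        · simp only [if_true]
          linear_combination (momPoly (-Complex.I) M k * h * eta ν * eta ν * (onShell k ν : ℂ)) *
            Complex.I_mul_I - (momPoly (-Complex.I) M k * h * (onShell k ν : ℂ)) * eta_mul_eta ν
        · intro μ _ hμ
          simp [hμ]
        · simp
      · simp [hab]
    · intro t _ ht
      cases t <;> simp [twoPoint]
      intro h1
      exact absurd (by rw [h1]) ht
    · simp

/-- The commutator of the gauge charge with a free field. -/
theorem gaugeCharge_field (p : Jet r) (g : 𝓢(Mink, ℂ)) (Φ : Fock r) :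
    gaugeCharge (field p g Φ) = (-1 : ℂ) ^ p.parity • field p g (gaugeCharge Φ) +
      (dQCoeff p).sum fun p' c => c • field p' g Φ := by
  have h1 : gaugeCharge (fieldPlus p g Φ) =
      (-1 : ℂ) ^ p.parity • fieldPlus p g (gaugeCharge Φ) + _ :=
    gaugeCharge_create p.1 _ ((polyBounded_momPoly Complex.I p.2).mul_rapid (rapid_hatPos g)) Φ
  rw [sum_create_gaugeCoeff] at h1
  have hχ : ∀ t, PolyBounded fun k => twoPoint p.1 t * (momPoly (-Complex.I) p.2 k * hatNeg g k) :=
    fun _ => (polyBounded_const _).mul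
      ((polyBounded_momPoly _ _).mul_rapid (rapid_hatNeg g)).polyBounded
  have h2 := gaugeCharge_annihilate p.parity _ hχ (fun t ht => by
    funext k
    have : twoPoint p.1 t = 0 := twoPoint_eq_zero _ _ fun h => ht h.symm
    simp [this]) Φ
  have h3 : (dQCoeff p).sum (fun p' c => c • fieldMinus p' g Φ) = (-(-1 : ℂ) ^ p.parity) •
      annihilate (fun t' k => ∑ t, twoPoint p.1 t * (momPoly (-Complex.I) p.2 k * hatNeg g k) *
        gaugeCoeff t t' k) (fun t' => polyBounded_sum _ fun t _ =>
          (hχ t).mul (polyBounded_gaugeCoeff t t')) Φ := by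
    have e1 := annihilate_eq_sum {()} (fun _ => -(-1 : ℂ) ^ p.parity) (fun t' k =>
      -(-1 : ℂ) ^ p.parity * ∑ t, twoPoint p.1 t * (momPoly (-Complex.I) p.2 k * hatNeg g k) *
        gaugeCoeff t t' k) (fun _ t' k => ∑ t, twoPoint p.1 t *
        (momPoly (-Complex.I) p.2 k * hatNeg g k) * gaugeCoeff t t' k)
        (fun t' => (polyBounded_const _).mul (polyBounded_sum _ fun t _ =>
          (hχ t).mul (polyBounded_gaugeCoeff t t'))) (fun _ t' => polyBounded_sum _ fun t _ =>
          (hχ t).mul (polyBounded_gaugeCoeff t t')) (fun t' k => by simp) Φ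
    rw [Finset.sum_singleton] at e1
    rw [← e1]
    symm
    exact annihilate_eq_sum (dQCoeff p).support (dQCoeff p) _ (fun p' t k =>
      twoPoint p'.1 t * (momPoly (-Complex.I) p'.2 k * hatNeg g k)) _ _
      (fun t k => sum_twoPoint_gaugeCoeff p t k (hatNeg g k)) Φ
  have h4 : fieldMinus p g (gaugeCharge Φ) = (-1 : ℂ) ^ p.parity • gaugeCharge (fieldMinus p g Φ) +
    annihilate (fun t' k => ∑ t, twoPoint p.1 t * (momPoly (-Complex.I) p.2 k * hatNeg g k) *
        gaugeCoeff t t' k) (fun t' => polyBounded_sum _ fun t _ =>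
          (hχ t).mul (polyBounded_gaugeCoeff t t')) Φ := h2
  have h5 : (dQCoeff p).sum (fun p' c => c • field p' g Φ) =
      (dQCoeff p).sum (fun p' c => c • fieldPlus p' g Φ) +
        (dQCoeff p).sum (fun p' c => c • fieldMinus p' g Φ) := by
    rw [← Finsupp.sum_add]
    exact Finsupp.sum_congr fun p' _ => smul_add _ _ _
  have sq := neg_one_pow_mul_self p.parity
  rw [h5, h3]
  change gaugeCharge (fieldPlus p g Φ + fieldMinus p g Φ) = (-1 : ℂ) ^ p.parity •
    (fieldPlus p g (gaugeCharge Φ) + fieldMinus p g (gaugeCharge Φ)) + _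
  rw [map_add, h1, h4]
  simp only [smul_add, smul_smul, sq, one_smul, neg_smul]
  abel

/-! ### Contractions `∑_q B_q (ξ_q · X)` and their chain rules. -/

section contraction

variable {V : Type*} [AddCommGroup V] [Module ℂ V]

/-- The sum `∑_q B_q (ξ_q · X)`. -/
def contraction (B : Jet r → Xi r →ₗ[ℂ] V) : Xi r →ₗ[ℂ] V where
  toFun X := ∑ᶠ q, B q (dot q X)
  map_add' X Y := by
    have fin : ∀ Y : Xi r, (Function.support fun q => B q (dot q Y)).Finite := fun Y =>
      (finite_support_dot Y).subset fun q h h' => h (by simp only at h'; simp [h'])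
    simp only [map_add]
    exact finsum_add_distrib (fin X) (fin Y)
  map_smul' a X := by
    have fin : ∀ Y : Xi r, (Function.support fun q => B q (dot q Y)).Finite := fun Y =>
      (finite_support_dot Y).subset fun q h h' => h (by simp only at h'; simp [h'])
    simp only [map_smul, RingHom.id_apply]
    exact (smul_finsum' a (fin X)).symm

theorem contraction_apply (B : Jet r → Xi r →ₗ[ℂ] V) (X : Xi r) :
    contraction B X = ∑ᶠ q, B q (dot q X) := rfl

theorem contraction_eq_sum (B : Jet r → Xi r →ₗ[ℂ] V) {X : Xi r} {S : Finset (Jet r)}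
    (hS : ∀ q, dot q X ≠ 0 → q ∈ S) : contraction B X = ∑ q ∈ S, B q (dot q X) := by
  rw [contraction_apply]
  refine finsum_eq_sum_of_support_subset _ fun q hq => hS q fun h => hq ?_
  simp [h]

theorem dotSum_eq_sum (c : Jet r → ℂ) {X : Xi r} {S : Finset (Jet r)}
    (hS : ∀ q, dot q X ≠ 0 → q ∈ S) : dotSum c X = ∑ q ∈ S, c q • dot q X := by
  rw [dotSum_apply]
  refine finsum_eq_sum_of_support_subset _ fun q hq => hS q fun h => hq ?_
  simp [h]

theorem exists_finset_dot (X : Xi r) : ∃ S : Finset (Jet r), ∀ q, dot q X ≠ 0 → q ∈ S :=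
  ⟨(finite_support_dot X).toFinset, fun q hq => by simpa using hq⟩

theorem finite_support_dotSum (K : Jet r → Jet r →₀ ℂ) (X : Xi r) :
    (Function.support fun q => dotSum (fun q' => K q' q) X).Finite := by
  obtain ⟨S, hS⟩ := exists_finset_dot X
  refine (S.biUnion fun q' => (K q').support).finite_toSet.subset fun q hq => ?_
  by_contra h
  refine hq ?_
  simp only
  rw [dotSum_eq_sum _ hS]
  refine Finset.sum_eq_zero fun q' hq' => ?_
  have : K q' q = 0 := by
    by_contra h0
    exact h (by simpa using ⟨q'.1, q'.2, hq', h0⟩)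
  rw [this, zero_smul]

/-- Exchange of the summations in a contraction with linear combinations of products. -/
theorem finsum_dotSum (K : Jet r → Jet r →₀ ℂ) (B : Jet r → Xi r →ₗ[ℂ] V) (X : Xi r) :
    ∑ᶠ q, B q (dotSum (fun q' => K q' q) X) =
      contraction (fun q' => (K q').sum fun q c => c • B q) X := by
  obtain ⟨S, hS⟩ := exists_finset_dot X
  set R : Finset (Jet r) := S.biUnion fun q' => (K q').support with hR
  have hsub : (Function.support fun q => B q (dotSum (fun q' => K q' q) X)) ⊆ (R : Set (Jet r)) := by
    intro q hq
    by_contra h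
    refine hq ?_
    simp only
    rw [dotSum_eq_sum _ hS, Finset.sum_eq_zero, map_zero]
    intro q' hq'
    have : K q' q = 0 := by
      by_contra h0
      exact h (by simpa [hR] using ⟨q'.1, q'.2, hq', h0⟩)
    rw [this, zero_smul]
  rw [finsum_eq_sum_of_support_subset _ hsub, contraction_eq_sum _ hS]
  have e1 : ∀ q ∈ R, B q (dotSum (fun q' => K q' q) X) =
      ∑ q' ∈ S, K q' q • B q (dot q' X) := fun q _ => by
    rw [dotSum_eq_sum _ hS, map_sum]
    simp only [map_smul]
  rw [Finset.sum_congr rfl e1, Finset.sum_comm]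
  refine Finset.sum_congr rfl fun q' hq' => ?_
  rw [Finsupp.sum, LinearMap.sum_apply]
  symm
  refine Finset.sum_subset (fun q hq => ?_) fun q _ hq => ?_
  · exact Finset.mem_biUnion.2 ⟨q', hq', hq⟩
  · rw [Finsupp.notMem_support_iff.1 hq, zero_smul, LinearMap.zero_apply]

/-- The chain rule for contractions with `d_Q A`. -/
theorem contraction_dQ (e : ℕ) (B : Jet r → Xi r →ₗ[ℂ] V)
    (hB : ∀ q, q.parity % 2 ≠ e % 2 → B q = 0) {X : Xi r} {a : ℕ} (h : HasParity X a) :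
    contraction B (dQ X) = (∑ᶠ q, B q (dQ (dot q X))) + (-1 : ℂ) ^ (e + a) •
      contraction (fun q' => (dQCoeff q').sum fun q c => c • B q) X := by
  have fin1 : (Function.support fun q => B q (dQ (dot q X))).Finite :=
    (finite_support_dot X).subset fun q h h' => h (by simp only at h'; simp [h'])
  have fin2 : (Function.support fun q => B q (dotSum (fun q' => dQCoeff q' q) X)).Finite :=
    (finite_support_dotSum dQCoeff X).subset fun q h h' => h (by simp only at h'; simp [h'])
  rw [← finsum_dotSum, smul_finsum' _ fin2, contraction_apply, ← finsum_add_distrib fin1]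
  · refine finsum_congr fun q => ?_
    rw [dot_dQ q h, map_add, map_smul]
    congr 1
    -- The sign in `dot_dQ` depends on `q`, but only through its parity; where this differs from `e`
    -- the map `B q` vanishes. So the sign can be taken out of the sum.
    by_cases hq : q.parity % 2 = e % 2
    · rw [neg_one_pow_congr (a := q.parity + a) (b := e + a) (by omega)]
    · rw [hB q hq]; simp
  · exact fin2.subset fun q h h' => h (by simp only at h'; simp only [h', smul_zero])

/-- The chain rule for contractions with `∂_μ A`. -/
theorem contraction_formalD (B : Jet r → Xi r →ₗ[ℂ] V) (μ : Fin 4) (X : Xi r) :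
    contraction B (formalD μ X) = (∑ᶠ q, B q (formalD μ (dot q X))) +
      contraction (fun q => B (q.1, μ ::ₘ q.2)) X := by
  have fin1 : (Function.support fun q => B q (formalD μ (dot q X))).Finite :=
    (finite_support_dot X).subset fun q h h' => h (by simp only at h'; simp [h'])
  set K : Jet r → Jet r →₀ ℂ := fun q' => Finsupp.single (q'.1, μ ::ₘ q'.2) 1 with hK
  have fin2 : (Function.support fun q => B q (dotSum (fun q' => K q' q) X)).Finite :=
    (finite_support_dotSum K X).subset fun q h h' => h (by simp only at h'; simp [h'])
  have e : (fun q : Jet r => B (q.1, μ ::ₘ q.2)) =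
      fun q' => (K q').sum fun q c => c • B q := by
    funext q'
    rw [hK, Finsupp.sum_single_index (h := fun q c => c • B q) (zero_smul _ _), one_smul]
  rw [e, ← finsum_dotSum, contraction_apply, ← finsum_add_distrib fin1 fin2]
  refine finsum_congr fun q => ?_
  rw [dot_formalD, map_add]

end contraction

/-! ### Graded commutators with fields and their interplay with `s`. -/

/-- The graded commutator of a fixed operator with operator-valued distributions; `k` is the product
of the Fermi parities. -/
def commL {n : ℕ} (k : ℕ) (A : Module.End ℂ (Fock r)) : OpDist r n →ₗ[ℂ] OpDist r n where
  toFun E := (LinearMap.mulLeft ℂ A - (-1 : ℂ) ^ k • LinearMap.mulRight ℂ A) ∘ₗ E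
  map_add' _ _ := LinearMap.comp_add _ _ _
  map_smul' _ _ := LinearMap.comp_smul _ _ _

theorem commL_apply {n : ℕ} (k : ℕ) (A : Module.End ℂ (Fock r)) (E : OpDist r n) (φ : 𝓢(Conf n, ℂ)) :
    commL k A E φ = A * E φ - (-1 : ℂ) ^ k • (E φ * A) := rfl

theorem commL_pderivL {n : ℕ} (k : ℕ) (A : Module.End ℂ (Fock r)) (l : Fin n) (μ : Fin 4)
    (E : OpDist r n) : commL k A (pderivL l μ E) = pderivL l μ (commL k A E) := by
  ext φ : 1
  have h : ∀ (F : OpDist r n) φ, pderivL l μ F φ =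
    -F (∂_{(Pi.single l (EuclideanSpace.single μ 1) : Conf n)} φ) := fun _ _ => rfl
  have key : ∀ X : Module.End ℂ (Fock r), A * (-X) - (-1 : ℂ) ^ k • (-X * A) =
      -(A * X - (-1 : ℂ) ^ k • (X * A)) := by
    intro X
    ext1 Φ
    change A (-(X Φ)) - (-1 : ℂ) ^ k • -(X (A Φ)) = -(A (X Φ) - (-1 : ℂ) ^ k • X (A Φ))
    rw [map_neg]
    module
  exact key _

theorem dQOpL_apply_apply {n : ℕ} (a : ℕ) (E : OpDist r n) (φ : 𝓢(Conf n, ℂ)) :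
    dQOpL a E φ = (gaugeCharge : Module.End ℂ (Fock r)) * E φ -
      (-1 : ℂ) ^ a • (E φ * (gaugeCharge : Module.End ℂ (Fock r))) := rfl

/-- The graded Jacobi identity for the gauge charge, a field and a distribution of parity `a`. -/
theorem commL_dQOpL {n : ℕ} (p : Jet r) (g : 𝓢(Mink, ℂ)) (a : ℕ) (E : OpDist r n) :
    commL (p.parity * (1 + a)) (field p g) (dQOpL a E) =
      (-1 : ℂ) ^ p.parity • dQOpL (p.parity + a) (commL (p.parity * a) (field p g) E) -
      (-1 : ℂ) ^ p.parity • (dQCoeff p).sum fun p' c =>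
        c • commL (p'.parity * a) (field p' g) E := by
  have hQ : (gaugeCharge : Module.End ℂ (Fock r)) * field p g =
      (-1 : ℂ) ^ p.parity • (field p g * (gaugeCharge : Module.End ℂ (Fock r))) +
        (dQCoeff p).sum fun p' c => c • field p' g := by
    ext1 Φ
    have := gaugeCharge_field p g Φ
    rw [LinearMap.add_apply, Finsupp.sum, LinearMap.sum_apply]
    exact this
  set Q := (gaugeCharge : Module.End ℂ (Fock r)) with hQdef
  set R := (dQCoeff p).sum fun p' c => c • field p' g with hR
  -- All jet variables in `d_Q ξ_p` have parity `|ξ_p| + 1`, so their graded commutators share one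
  -- sign and combine into the commutator with a single operator.
  have hR' : ((dQCoeff p).sum fun p' c => c • commL (p'.parity * a) (field p' g) E) =
      commL ((p.parity + 1) * a) R E := by
    ext φ : 1
    rw [hR, commL_apply, Finsupp.sum, Finsupp.sum, LinearMap.sum_apply, Finset.sum_mul,
      Finset.mul_sum, Finset.smul_sum, ← Finset.sum_sub_distrib]
    refine Finset.sum_congr rfl fun p' hp' => ?_
    have hp := dQCoeff_parity p p' (Finsupp.mem_support_iff.1 hp')
    have : (p'.parity * a) % 2 = ((p.parity + 1) * a) % 2 := by
      rw [Nat.mul_mod, hp, ← Nat.mul_mod]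
    rw [LinearMap.smul_apply, commL_apply, neg_one_pow_congr this]
    simp only [mul_smul_comm, smul_mul_assoc]
    module
  rw [hR']
  ext φ : 1
  rw [LinearMap.sub_apply, LinearMap.smul_apply, LinearMap.smul_apply, commL_apply, commL_apply,
    dQOpL_apply_apply, dQOpL_apply_apply, commL_apply]
  have hR2 : R = Q * field p g - (-1 : ℂ) ^ p.parity • (field p g * Q) := by
    rw [hQ]; abel
  rw [hR2]
  simp only [mul_sub, sub_mul, smul_sub, mul_smul_comm, smul_mul_assoc, smul_smul, mul_assoc]
  have s1 := neg_one_pow_mul_self p.parity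
  have s2 := neg_one_pow_mul_self a
  have e1 : (-1 : ℂ) ^ (p.parity * (1 + a)) = (-1) ^ p.parity * (-1) ^ (p.parity * a) := by
    rw [← pow_add]; congr 1; ring
  have e2 : (-1 : ℂ) ^ (p.parity + a) = (-1) ^ p.parity * (-1) ^ a := pow_add _ _ _
  have e3 : (-1 : ℂ) ^ ((p.parity + 1) * a) = (-1) ^ (p.parity * a) * (-1) ^ a := by
    rw [← pow_add]; congr 1; ring
  rw [e1, e2, e3]
  -- With the signs as indeterminates satisfying `x² = y² = 1`, the Jacobi identity is a linear
  -- identity between the ordered products of `Q`, the field and `E φ`.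
  generalize ((-1 : ℂ) ^ p.parity) = x at *
  generalize ((-1 : ℂ) ^ a) = y at *
  generalize ((-1 : ℂ) ^ (p.parity * a)) = w at *
  have c1 : x * (x * y) = y := by rw [← mul_assoc, s1, one_mul]
  simp only [c1, s1, one_smul, mul_assoc]
  module

namespace ChronologicalProducts

variable (𝒯 : ChronologicalProducts r)

/-- The linear maps `X ↦ D_{pq}(y - x_m) T(A_1, …, X, …, A_n)`, with `X` in place of `A_m`. -/
def wickMap (p : Jet r) (g : 𝓢(Mink, ℂ)) {n : ℕ} (A : Fin n → Xi r) (m : Fin n) (q : Jet r) :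
    Xi r →ₗ[ℂ] OpDist r n :=
  mulAtL m (pauliJordan p q g) ∘ₗ (𝒯.T n).toLinearMap A m

theorem wickMap_apply (p : Jet r) (g : 𝓢(Mink, ℂ)) {n : ℕ} (A : Fin n → Xi r) (m : Fin n)
    (q : Jet r) (X : Xi r) : 𝒯.wickMap p g A m q X =
      mulAtL m (pauliJordan p q g) (𝒯.T n (Function.update A m X)) := rfl

theorem wickMap_eq_zero {p q : Jet r} (h : q.parity % 2 ≠ p.parity % 2) (g : 𝓢(Mink, ℂ)) {n : ℕ}
    (A : Fin n → Xi r) (m : Fin n) : 𝒯.wickMap p g A m q = 0 := by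
  rw [wickMap, pauliJordan_eq_zero (fun h' => h (by rw [h'])), mulAtL_zero, LinearMap.zero_comp]

theorem wick_commL {n : ℕ} (A : Fin n → Xi r) (a : Fin n → ℕ) (hA : ∀ l, HasParity (A l) (a l))
    (p : Jet r) (g : 𝓢(Mink, ℂ)) : commL (p.parity * ∑ l, a l) (field p g) (𝒯.T n A) =
      -Complex.I • ∑ m, (∏ l, if l ≤ m then (-1 : ℂ) ^ (p.parity * a l) else 1) •
        contraction (V := OpDist r n) (𝒯.wickMap p g A m) (A m) := by
  ext φ : 1
  have h := 𝒯.wick n A a hA p g φ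
  rw [gradedComm] at h
  rw [commL_apply, h, LinearMap.smul_apply, LinearMap.sum_apply]
  congr 1
  refine Finset.sum_congr rfl fun m _ => ?_
  rw [LinearMap.smul_apply]
  congr 1
  obtain ⟨S, hS⟩ := exists_finset_dot (A m)
  rw [contraction_eq_sum _ hS, LinearMap.sum_apply]
  refine finsum_eq_sum_of_support_subset _ fun q hq => hS q fun h => hq ?_
  have h0 : 𝒯.T n (Function.update A m 0) = 0 := (𝒯.T n).map_update_zero A m
  simp only [h, h0]
  rfl

/-- Contractions vanish on the multiples of the field equations. -/
theorem contraction_wickMap_of_mem (p : Jet r) (g : 𝓢(Mink, ℂ)) {n : ℕ} (A : Fin n → Xi r)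
    (m : Fin n) {X : Xi r} (hX : X ∈ boxSpan r) :
    contraction (V := OpDist r n) (𝒯.wickMap p g A m) X = 0 := by
  induction hX using Submodule.span_induction with
  | zero => exact map_zero _
  | add X Y _ _ hX hY => rw [map_add, hX, hY, add_zero]
  | smul c X _ hX => rw [map_smul, hX, smul_zero]
  | mem X h =>
    obtain ⟨B, b, rfl⟩ := h
    set v : Fin 4 → Jet r := fun μ => (b.1, μ ::ₘ μ ::ₘ b.2) with hv
    -- The part in which `B` is contracted still contains the field equation and is annihilated by
    -- `T`. Only contractions with the two-derivative variables `v μ` of `boxXi b` remain.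
    have e1 : ∀ q, 𝒯.wickMap p g A m q (dot q (B * boxXi b)) =
        ∑ μ, if v μ = q then ((-1 : ℂ) ^ b.parity * eta μ) • 𝒯.wickMap p g A m (v μ) B else 0 := by
      intro q
      have h1 : 𝒯.wickMap p g A m q (dot q B * boxXi b) = 0 := by
        rw [wickMap, LinearMap.comp_apply, 𝒯.update_eq_zero_of_mem A m (mul_boxXi_mem _ _),
          map_zero]
      rw [dot_mul_boxXi, map_add, map_smul, map_smul, h1, smul_zero, zero_add, Finset.mul_sum,
        Finset.sum_smul]
      refine Finset.sum_congr rfl fun μ _ => ?_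
      by_cases h : v μ = q
      · rw [if_pos h, if_pos h, ← h]; rfl
      · rw [if_neg h, if_neg h, mul_zero, zero_smul]
    -- These add up to multiplication by `□ D`, which is zero.
    have e2 : ∑ μ, ((-1 : ℂ) ^ b.parity * eta μ) • 𝒯.wickMap p g A m (v μ) B = 0 := by
      have h1 := mulAtL_sum (r := r) Finset.univ m eta (fun μ => pauliJordan p (v μ) g)
        (fun μ _ => hasTemperateGrowth_pauliJordan p (v μ) g)
      have h2 : (fun x => ∑ μ, eta μ * pauliJordan p (v μ) g x) = 0 :=
        funext fun x => pauliJordan_box p b g x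
      rw [h2, mulAtL_zero] at h1
      have h3 := congrArg (fun L => L (𝒯.T n (Function.update A m B))) h1
      simp only [LinearMap.sum_apply, LinearMap.smul_apply, LinearMap.zero_apply] at h3
      simp only [wickMap_apply, mul_smul]
      rw [← Finset.smul_sum, ← h3, smul_zero]
    rw [contraction_apply, finsum_congr e1, finsum_eq_sum_of_support_subset (s := Finset.univ.image v)]
    · rw [Finset.sum_comm]
      refine (Finset.sum_congr rfl fun μ _ => ?_).trans e2
      rw [Finset.sum_ite_eq, if_pos (Finset.mem_image_of_mem v (Finset.mem_univ μ))]
    · intro q hq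
      by_contra h
      refine hq (Finset.sum_eq_zero fun μ _ => if_neg fun h' => h ?_)
      rw [← h']
      exact Finset.mem_coe.2 (Finset.mem_image_of_mem v (Finset.mem_univ μ))

/-- Since `D_{pq}` is invariant under the gauge charge, applying `d_Q` to the contracted variable
`ξ_q` can be traded for applying it to the external field `ξ_p`. -/
theorem sum_dQCoeff_wickMap (p q : Jet r) (g : 𝓢(Mink, ℂ)) {n : ℕ} (A : Fin n → Xi r)
    (m : Fin n) : ((dQCoeff q).sum fun q' c => c • 𝒯.wickMap p g A m q') =
      -(-1 : ℂ) ^ p.parity • (dQCoeff p).sum fun p' c => c • 𝒯.wickMap p' g A m q := by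
  have h1 := mulAtL_sum (r := r) (dQCoeff q).support m (dQCoeff q) (fun q' => pauliJordan p q' g)
    (fun q' _ => hasTemperateGrowth_pauliJordan p q' g)
  have h2 := mulAtL_sum (r := r) (dQCoeff p).support m
    (fun p' => -(-1 : ℂ) ^ p.parity * dQCoeff p p') (fun p' => pauliJordan p' q g)
    (fun p' _ => hasTemperateGrowth_pauliJordan p' q g)
  have h3 : (fun x => ∑ q' ∈ (dQCoeff q).support, dQCoeff q q' * pauliJordan p q' g x) =
      fun x => ∑ p' ∈ (dQCoeff p).support,
        (-(-1 : ℂ) ^ p.parity * dQCoeff p p') * pauliJordan p' q g x := by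
    funext x
    have := sum_dQCoeff_pauliJordan p q g x
    simp only [Finsupp.sum] at this
    rw [this, Finset.mul_sum]
    exact Finset.sum_congr rfl fun _ _ => (mul_assoc _ _ _).symm
  rw [h3, h2] at h1
  ext1 X
  have h4 := congrArg (fun L => L ((𝒯.T n).toLinearMap A m X)) h1
  simp only [LinearMap.sum_apply, LinearMap.smul_apply] at h4
  simp only [Finsupp.sum, LinearMap.smul_apply, LinearMap.sum_apply]
  refine h4.symm.trans ?_
  rw [Finset.smul_sum]
  exact Finset.sum_congr rfl fun _ _ => mul_smul _ _ _

end ChronologicalProducts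

section contraction

variable {V : Type*} [AddCommGroup V] [Module ℂ V]

theorem contraction_smul_sum {ι : Type*} (S : Finset ι) (b : ℂ) (c : ι → ℂ)
    (B : ι → Jet r → Xi r →ₗ[ℂ] V) (X : Xi r) :
    contraction (fun q => b • ∑ i ∈ S, c i • B i q) X = b • ∑ i ∈ S, c i • contraction (B i) X := by
  obtain ⟨R, hR⟩ := exists_finset_dot X
  have h := fun B : Jet r → Xi r →ₗ[ℂ] V => contraction_eq_sum B hR
  simp only [h, LinearMap.smul_apply, LinearMap.sum_apply, Finset.smul_sum]
  rw [Finset.sum_comm]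

theorem sPoly_lag (f : Fin r → Fin r → Fin r → ℝ) (I : List (Fin 4)) : sPoly f .lag I =
    dQ (lagr f I) - Complex.I • ∑ μ, formalD μ (lagr f (I ++ [μ])) := rfl

theorem sPoly_sub (f : Fin r → Fin r → Fin r → ℝ) (q : Jet r) (I : List (Fin 4)) :
    sPoly f (.sub q) I =
      dQ (dot q (lagr f I)) - Complex.I • ∑ μ, formalD μ (dot q (lagr f (I ++ [μ]))) := rfl

/-- The contraction with `s (ξ_q · T^I)`, if the contraction with `s T^I` vanishes. -/
theorem finsum_sPoly_sub (f : Fin r → Fin r → Fin r → ℝ) (I : List (Fin 4)) (e : ℕ)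
    (B : Jet r → Xi r →ₗ[ℂ] V) (hB : ∀ q, q.parity % 2 ≠ e % 2 → B q = 0)
    (h0 : contraction B (sPoly f .lag I) = 0) :
    ∑ᶠ q, B q (sPoly f (.sub q) I) =
      -(-1 : ℂ) ^ (e + I.length) •
        contraction (fun q' => (dQCoeff q').sum fun q c => c • B q) (lagr f I) +
      Complex.I • ∑ μ, contraction (fun q => B (q.1, μ ::ₘ q.2)) (lagr f (I ++ [μ])) := by
  have fin : ∀ (D : Xi r →ₗ[ℂ] Xi r) (X : Xi r),
      (Function.support fun q => B q (D (dot q X))).Finite := fun D X =>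
    (finite_support_dot X).subset fun q h h' => h (by simp only at h'; simp [h'])
  have fin2 : (Function.support fun q =>
      ∑ μ, B q (formalD μ (dot q (lagr f (I ++ [μ]))))).Finite :=
    (Set.finite_iUnion fun μ => fin (formalD μ) (lagr f (I ++ [μ]))).subset fun q hq => by
      by_contra h
      refine hq (Finset.sum_eq_zero fun μ _ => ?_)
      by_contra h'
      exact h (Set.mem_iUnion.2 ⟨μ, h'⟩)
  have e1 : ∑ᶠ q, B q (sPoly f (.sub q) I) = (∑ᶠ q, B q (dQ (dot q (lagr f I)))) -
      Complex.I • ∑ μ, ∑ᶠ q, B q (formalD μ (dot q (lagr f (I ++ [μ])))) := by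
    rw [← finsum_sum_comm _ _ fun μ _ => fin _ _, smul_finsum' _ fin2, ← finsum_sub_distrib (fin _ _)]
    · refine finsum_congr fun q => ?_
      rw [sPoly_sub, map_sub, map_smul, map_sum]
    · exact fin2.subset fun q h h' => h (by simp only at h'; simp only [h', smul_zero])
  -- The chain rules write the vanishing contraction with `s T^I` as the wanted sum plus the two
  -- index-changing terms, and the relation is solved for the former.
  rw [sPoly_lag, map_sub, map_smul, map_sum, contraction_dQ e B hB (hasParity_lagr f I)] at h0
  simp only [contraction_formalD, Finset.sum_add_distrib] at h0
  rw [e1, eq_sub_of_add_eq (sub_eq_zero.1 h0)]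
  module

end contraction

namespace ChronologicalProducts

variable (𝒯 : ChronologicalProducts r)

/-- The contribution of `T(s(ξ_q · T^I))` is thereby identified with the two excess terms of the
commutator: contractions with `d_Q ξ_p`, and contractions in which `∂_μ` has differentiated
`D_{pq}`. -/
theorem finsum_wickMap_sPoly {f : Fin r → Fin r → Fin r → ℝ}
    (hf : ∀ a b c, f b a c = -f a b c ∧ f a c b = -f a b c) (p : Jet r) (g : 𝓢(Mink, ℂ)) {n : ℕ}
    (A : Fin n → Xi r) (m : Fin n) (I : List (Fin 4)) :
    ∑ᶠ q, 𝒯.wickMap p g A m q (sPoly f (.sub q) I) =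
      ((-1 : ℂ) ^ I.length • (dQCoeff p).sum fun p' c =>
        c • contraction (V := OpDist r n) (𝒯.wickMap p' g A m) (lagr f I)) +
      Complex.I • ∑ μ, contraction (V := OpDist r n)
        (fun q => 𝒯.wickMap p g A m (q.1, μ ::ₘ q.2)) (lagr f (I ++ [μ])) := by
  refine (finsum_sPoly_sub (V := OpDist r n) f I p.parity (𝒯.wickMap p g A m) (fun q h => 𝒯.wickMap_eq_zero h g A m)
    (𝒯.contraction_wickMap_of_mem p g A m (sPoly_lag_mem hf I))).trans ?_
  simp only [sum_dQCoeff_wickMap]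
  simp only [Finsupp.sum]
  rw [contraction_smul_sum, smul_smul]
  congr 2
  rw [pow_add]
  linear_combination ((-1 : ℂ) ^ I.length) * neg_one_pow_mul_self p.parity

/-- `skew_cycle` read backwards: the sign of the cycle is its own inverse, and it involves the
parity of the new entry `X` rather than that of `A m`. -/
theorem reorderL_cons {n : ℕ} (A : Fin (n + 1) → Xi r) (a : Fin (n + 1) → ℕ)
    (hA : ∀ l, HasParity (A l) (a l)) (m : Fin (n + 1)) {X : Xi r} {b : ℕ} (hX : HasParity X b) :
    reorderL m.cycleRange.symm (𝒯.T (n + 1) (Fin.cons X fun j => A (m.succAbove j))) =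
      (∏ l, if l < m then (-1 : ℂ) ^ (a l * b) else 1) • 𝒯.T (n + 1) (Function.update A m X) := by
  have h := 𝒯.skew_cycle (Function.update A m X) (Function.update a m b) (fun l => by
    rcases eq_or_ne l m with rfl | h
    · simpa using hX
    · simpa [h] using hA l) m
  have h1 : (∏ l, if l < m then
        (-1 : ℂ) ^ (Function.update a m b l * Function.update a m b m) else 1) =
      ∏ l, if l < m then (-1 : ℂ) ^ (a l * b) else 1 := by
    refine Finset.prod_congr rfl fun l _ => ?_
    split_ifs with hl
    · rw [Function.update_of_ne hl.ne, Function.update_self]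
    · rfl
  have h2 : (∏ l, if l < m then (-1 : ℂ) ^ (a l * b) else 1) *
      (∏ l, if l < m then (-1 : ℂ) ^ (a l * b) else 1) = 1 := by
    rw [← Finset.prod_mul_distrib]
    refine Finset.prod_eq_one fun l _ => ?_
    split_ifs
    · exact neg_one_pow_mul_self _
    · exact one_mul 1
  simp only [Function.update_self, Function.update_of_ne (Fin.succAbove_ne m _)] at h
  have h1' : (∏ l, if l < m then (-1 : ℂ) ^ (Function.update a m b l * b) else 1) =
      ∏ l, if l < m then (-1 : ℂ) ^ (a l * b) else 1 := by
    rw [← h1]; simp only [Function.update_self]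
  rw [h1'] at h
  rw [h, smul_smul, h2, one_smul]

/-- The cyclically reordered `s T(ξ_q · T^{I_m}, T^{I_1}, …)`. -/
theorem reorderL_sT (f : Fin r → Fin r → Fin r → ℝ) {n : ℕ} (I : Fin (n + 1) → List (Fin 4))
    (m : Fin (n + 1)) (q : Jet r) :
    reorderL m.cycleRange.symm (sT f 𝒯 (Fin.cons (.sub q) fun _ => .lag)
      (Fin.cons (I m) fun j => I (m.succAbove j))) =
    (∏ l, if l < m then (-1 : ℂ) ^ ((I l).length * (q.parity + (I m).length)) else 1) •
      dQOpL (q.parity + ∑ l, (I l).length) (𝒯.T (n + 1)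
        (Function.update (fun l => lagr f (I l)) m (dot q (lagr f (I m))))) -
    Complex.I • (
      (∏ l, if l < m then (-1 : ℂ) ^ ((I l).length * (q.parity + (I m).length + 1)) else 1) •
        ∑ μ, pderivL m μ (𝒯.T (n + 1)
          (Function.update (fun l => lagr f (I l)) m (dot q (lagr f (I m ++ [μ]))))) +
      ∑ j, ((-1 : ℂ) ^ (q.parity + (I m).length) *
        (∏ i, if i < j then (-1 : ℂ) ^ (I (m.succAbove i)).length else 1) *
        (∏ l, if l < m then (-1 : ℂ) ^ (((I l).length + if l = m.succAbove j then 1 else 0) *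
          (q.parity + (I m).length)) else 1)) •
        ∑ μ, pderivL (m.succAbove j) μ (𝒯.T (n + 1)
          (Function.update (Function.update (fun l => lagr f (I l)) (m.succAbove j)
            (lagr f (I (m.succAbove j) ++ [μ]))) m (dot q (lagr f (I m)))))) := by
  set X : Fin (n + 1) → Xi r := fun l => lagr f (I l) with hXdef
  have hX : ∀ l, HasParity (X l) (I l).length := fun l => hasParity_lagr f (I l)
  have hent : entries f (Fin.cons (.sub q) fun _ => .lag)
      (Fin.cons (I m) fun j => I (m.succAbove j)) =
      (Fin.cons (dot q (lagr f (I m))) fun j => X (m.succAbove j) : Fin (n + 1) → Xi r) := by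
    funext l
    refine Fin.cases ?_ (fun l => ?_) l <;> rfl
  have hsum : ∑ l, entryParity (Fin.cons (.sub q) fun _ => .lag : Fin (n + 1) → Entry r)
      (Fin.cons (I m) fun j => I (m.succAbove j)) l = q.parity + ∑ l, (I l).length := by
    rw [Fin.sum_univ_succ, Fin.sum_univ_succAbove (fun l => (I l).length) m, ← add_assoc]
    simp [entryParity, Entry.parity]
  rw [sT, ← dQOpL_apply, OpDist.map_sub, hent, hsum, ← dQOpL_reorderL, map_smul,
    𝒯.reorderL_cons X _ hX m ((hX m).dot q), map_smul]
  congr 2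
  rw [deltaT, Fin.sum_univ_succ, map_add]
  congr 1
  · rw [Finset.prod_eq_one fun i _ => if_neg (Fin.not_lt_zero i), one_smul, map_sum,
      Finset.smul_sum]
    refine Finset.sum_congr rfl fun μ _ => ?_
    -- The reordering also relabels the derivatives: the first place becomes `m`, and below the
    -- place `j + 1` becomes `m.succAbove j`.
    rw [← pderivL_apply, reorderL_pderivL, Fin.cycleRange_symm_zero, hent, Fin.update_cons_zero]
    have h1 : HasParity (dot q (lagr f (I m ++ [μ]))) (q.parity + (I m).length + 1) := by
      have := (hasParity_lagr f (I m ++ [μ])).dot q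
      rwa [List.length_append, List.length_singleton, ← add_assoc] at this
    exact (congrArg _ (𝒯.reorderL_cons X _ hX m h1)).trans (map_smul _ _ _)
  · rw [map_sum]
    refine Finset.sum_congr rfl fun j _ => ?_
    rw [map_smul, map_sum, mul_smul]
    have hs : (∏ i, if i < j.succ then (-1 : ℂ) ^ entryParity
        (Fin.cons (.sub q) fun _ => .lag : Fin (n + 1) → Entry r)
        (Fin.cons (I m) fun j => I (m.succAbove j)) i else 1) =
        (-1 : ℂ) ^ (q.parity + (I m).length) *
        (∏ i, if i < j then (-1 : ℂ) ^ (I (m.succAbove i)).length else 1) := by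
      rw [Fin.prod_univ_succ, if_pos (Fin.succ_pos j)]
      simp [entryParity, Entry.parity]
    rw [hs]
    congr 1
    rw [Finset.smul_sum]
    refine Finset.sum_congr rfl fun μ _ => ?_
    rw [← pderivL_apply, reorderL_pderivL, Fin.cycleRange_symm_succ, hent, ← Fin.cons_update]
    set l := m.succAbove j with hl
    have hu : (Function.update (fun j => X (m.succAbove j)) j
        (((Fin.cons (.sub q) fun _ => .lag : Fin (n + 1) → Entry r) j.succ).poly f
          ((Fin.cons (I m) fun j => I (m.succAbove j) : Fin (n + 1) → List (Fin 4)) j.succ ++ [μ])))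
        = fun j' => (Function.update X l (lagr f (I l ++ [μ]))) (m.succAbove j') := by
      funext j'
      rcases eq_or_ne j' j with rfl | h
      · rw [Function.update_self, hl, Function.update_self]; rfl
      · rw [Function.update_of_ne h, hl,
          Function.update_of_ne fun h' => h (Fin.succAbove_right_injective h')]
    rw [hu]
    -- The extra index `μ` makes the entry at `l` change parity, which enters the sign of the cycle
    -- whenever `l` stands before `m`.
    have hX' : ∀ k, HasParity (Function.update X l (lagr f (I l ++ [μ])) k)
        ((I k).length + if k = l then 1 else 0) := by
      intro k
      rcases eq_or_ne k l with h | h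
      · rw [h, Function.update_self, if_pos rfl]
        have := hasParity_lagr f (I l ++ [μ])
        rwa [List.length_append] at this
      · rw [Function.update_of_ne h, if_neg h]
        exact hX k
    exact (congrArg _ (𝒯.reorderL_cons _ _ hX' m ((hX m).dot q))).trans (map_smul _ _ _)

end ChronologicalProducts

/-! ### Sign identities for the commutator formula. -/

section signs

theorem prod_single {n : ℕ} (m : Fin n) (c : ℂ) : (∏ k, if k = m then c else 1) = c := by
  simp

/-- All identities of this kind are compared place by place: isolated signs are inserted into the
product at one place by `prod_single`, and for each `l` the exponents then differ by an even number.
This one is for the terms without additional index or `d_Q ξ_p`. -/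
theorem sign_wick {n : ℕ} (e : ℕ) (a : Fin n → ℕ) (m : Fin n) :
    (∏ l, if l < m then (-1 : ℂ) ^ (a l * a m) else 1) * (-1) ^ (e * a m) *
      (∏ l, if l < m then (-1 : ℂ) ^ (a l * (e + a m)) else 1) =
      ∏ l, if l ≤ m then (-1 : ℂ) ^ (e * a l) else 1 := by
  rw [← prod_single m ((-1 : ℂ) ^ (e * a m)), ← Finset.prod_mul_distrib, ← Finset.prod_mul_distrib]
  refine Finset.prod_congr rfl fun l _ => ?_
  rcases lt_trichotomy l m with h | rfl | h
  · simp only [h, h.ne, h.le, if_true, if_false, mul_one, ← pow_add]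
    refine neg_one_pow_congr ?_
    rw [show a l * a m + a l * (e + a m) = e * a l + 2 * (a l * a m) by ring]
    omega
  · simp
  · simp [h.not_gt, h.ne', h.not_ge]

theorem sign_wick_succ {n : ℕ} (e : ℕ) (a : Fin n → ℕ) (m : Fin n) :
    (∏ l, if l < m then (-1 : ℂ) ^ (a l * a m) else 1) * (-1) ^ (e * a m) *
      (∏ l, if l < m then (-1 : ℂ) ^ (a l * (e + a m + 1)) else 1) * (-1) ^ a m =
      ∏ l, if l ≤ m then (-1 : ℂ) ^ ((e + 1) * a l) else 1 := by
  rw [← prod_single m ((-1 : ℂ) ^ (e * a m)), ← Finset.prod_mul_distrib, ← Finset.prod_mul_distrib,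
    ← prod_single m ((-1 : ℂ) ^ (a m)), ← Finset.prod_mul_distrib]
  refine Finset.prod_congr rfl fun l _ => ?_
  rcases lt_trichotomy l m with h | rfl | h
  · simp only [h, h.ne, h.le, if_true, if_false, mul_one, ← pow_add]
    refine neg_one_pow_congr ?_
    rw [show a l * a m + a l * (e + a m + 1) = (e + 1) * a l + 2 * (a l * a m) by ring]
    omega
  · simp [← pow_add, add_mul]
  · simp [h.not_gt, h.ne', h.not_ge]

theorem sign_deriv_self {n : ℕ} (e : ℕ) (a : Fin n → ℕ) (m : Fin n) :
    (-1 : ℂ) ^ e * ((∏ k, if k < m then (-1 : ℂ) ^ a k else 1) *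
      (∏ k, if k ≤ m then (-1 : ℂ) ^ (e * (a k + if k = m then 1 else 0)) else 1)) =
      (∏ l, if l < m then (-1 : ℂ) ^ (a l * a m) else 1) * (-1) ^ (e * a m) *
        (∏ l, if l < m then (-1 : ℂ) ^ (a l * (e + a m + 1)) else 1) := by
  rw [← prod_single m ((-1 : ℂ) ^ (e * a m)), ← prod_single m ((-1 : ℂ) ^ e)]
  simp only [← Finset.prod_mul_distrib]
  refine Finset.prod_congr rfl fun l _ => ?_
  rcases lt_trichotomy l m with h | rfl | h
  · simp only [h, h.ne, h.le, if_true, if_false, mul_one, one_mul, ← pow_add]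
    refine neg_one_pow_congr ?_
    rw [show a l * a m + a l * (e + a m + 1) = e * (a l + 0) + a l + 2 * (a l * a m) by ring]
    omega
  · simp only [lt_irrefl, le_refl, if_true, if_false, mul_one, one_mul, ← pow_add]
    refine neg_one_pow_congr ?_
    rw [show e + e * (a l + 1) = e * a l + 2 * e by ring]
    omega
  · simp [h.not_gt, h.ne', h.not_ge]

/-- The sign for a divergence acting at a place `l` other than the contracted one. Passing through
`ξ_q · T^{I_m}`, moved to the front, always costs `e + a m`; whether the cycle also sees the raised
parity of the entry `l` depends on its position relative to `m`. -/
theorem sign_deriv_of_ne {n : ℕ} (e : ℕ) (a : Fin (n + 1) → ℕ) (m : Fin (n + 1)) (j : Fin n) :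
    (-1 : ℂ) ^ e * ((∏ k, if k < m.succAbove j then (-1 : ℂ) ^ a k else 1) *
      (∏ k, if k ≤ m then (-1 : ℂ) ^ (e * (a k + if k = m.succAbove j then 1 else 0)) else 1)) =
      (∏ l, if l < m then (-1 : ℂ) ^ (a l * a m) else 1) * (-1) ^ (e * a m) *
        ((-1 : ℂ) ^ (e + a m) * (∏ i, if i < j then (-1 : ℂ) ^ a (m.succAbove i) else 1) *
        (∏ l, if l < m then (-1 : ℂ) ^ ((a l + if l = m.succAbove j then 1 else 0) *
          (e + a m)) else 1)) := by
  have hΘ : (∏ i, if i < j then (-1 : ℂ) ^ a (m.succAbove i) else 1) =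
      ∏ k, if k = m then 1 else if k < m.succAbove j then (-1 : ℂ) ^ a k else 1 := by
    rw [Fin.prod_univ_succAbove _ m]
    simp [Fin.succAbove_ne, Fin.succAbove_lt_succAbove_iff]
  have hne := Fin.succAbove_ne m j
  rw [hΘ]
  generalize m.succAbove j = l at *
  rw [pow_add (-1 : ℂ) e (a m), ← prod_single m ((-1 : ℂ) ^ (e * a m)), ← prod_single l ((-1 : ℂ) ^ e)]
  rcases lt_or_gt_of_ne hne with hlm | hlm
  -- For `l < m` the sign `(-1)^{a m}` is charged to the factor at `l`, where it meets the raised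
  -- parity; for `l > m` it belongs to the factor at `m`, the entry standing before `l` in the
  -- original order.
  · rw [← prod_single l ((-1 : ℂ) ^ (a m))]
    simp only [← Finset.prod_mul_distrib]
    refine Finset.prod_congr rfl fun k _ => ?_
    rcases lt_trichotomy k m with h | rfl | h
    · rcases eq_or_ne k l with rfl | hkl
      · simp only [h, h.ne, h.le, if_true, if_false, mul_one, one_mul, ← pow_add, lt_irrefl]
        refine neg_one_pow_congr ?_
        rw [show a k * a m + (e + a m + (a k + 1) * (e + a m)) =
          e + e * (a k + 1) + 2 * (a k * a m + a m) by ring]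
        omega
      · rcases lt_or_gt_of_ne hkl with h' | h'
        · simp only [h, h.ne, h.le, hkl, h', if_true, if_false, mul_one, one_mul, ← pow_add, add_zero]
          refine neg_one_pow_congr ?_
          rw [show a k * a m + (a k + a k * (e + a m)) = a k + e * a k + 2 * (a k * a m) by ring]
          omega
        · simp only [h, h.ne, h.le, hkl, h'.not_gt, if_true, if_false, mul_one, one_mul, ← pow_add,
            add_zero]
          refine neg_one_pow_congr ?_
          rw [show a k * a m + (a k * (e + a m)) = e * a k + 2 * (a k * a m) by ring]
          omega
    · simp [hlm.ne', hlm.not_gt]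
    · simp [h.not_gt, h.ne', h.not_ge, (hlm.trans h).ne', (hlm.trans h).not_gt]
  · rw [← prod_single m ((-1 : ℂ) ^ (a m))]
    simp only [← Finset.prod_mul_distrib]
    refine Finset.prod_congr rfl fun k _ => ?_
    rcases lt_trichotomy k m with h | rfl | h
    · simp only [h, h.ne, h.le, (h.trans hlm).ne, h.trans hlm, if_true, if_false, mul_one, one_mul,
        ← pow_add, add_zero]
      refine neg_one_pow_congr ?_
      rw [show a k * a m + (a k + a k * (e + a m)) = a k + e * a k + 2 * (a k * a m) by ring]
      omega
    · simp [hlm.ne, hlm, mul_comm]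
    · simp [h.not_gt, h.ne', h.not_ge]

end signs

/-! ### The commutator of a free field with `s T`. -/

namespace ChronologicalProducts

variable (𝒯 : ChronologicalProducts r)

/-- The contribution of the Wick contractions with the entry `m` to the commutator of a field with
`s T(T^{I_1}, …, T^{I_n})`. -/
def gaugeTerm (f : Fin r → Fin r → Fin r → ℝ) (p : Jet r) (g : 𝓢(Mink, ℂ)) {n : ℕ}
    (I : Fin n → List (Fin 4)) (m : Fin n) : OpDist r n :=
  ((-1 : ℂ) ^ p.parity * ∏ l, if l ≤ m then (-1 : ℂ) ^ (p.parity * (I l).length) else 1) •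
    dQOpL (p.parity + ∑ l, (I l).length)
      (contraction (V := OpDist r n) (𝒯.wickMap p g (fun l => lagr f (I l)) m) (lagr f (I m))) +
  (-(-1 : ℂ) ^ p.parity * ∏ l, if l ≤ m then (-1 : ℂ) ^ ((p.parity + 1) * (I l).length) else 1) •
    ((dQCoeff p).sum fun p' c => c •
      contraction (V := OpDist r n) (𝒯.wickMap p' g (fun l => lagr f (I l)) m) (lagr f (I m))) +
  (-Complex.I) • ∑ l, ((∏ k, if k < l then (-1 : ℂ) ^ (I k).length else 1) *
      ∏ k, if k ≤ m then (-1 : ℂ) ^ (p.parity * ((I k).length + if k = l then 1 else 0)) else 1) •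
    ∑ μ, pderivL l μ (contraction (V := OpDist r n)
      (𝒯.wickMap p g (Function.update (fun l => lagr f (I l)) l (lagr f (I l ++ [μ]))) m)
      (Function.update (fun l => lagr f (I l)) l (lagr f (I l ++ [μ])) m))

theorem hasParity_update_lagr (f : Fin r → Fin r → Fin r → ℝ) {n : ℕ} (I : Fin n → List (Fin 4))
    (l : Fin n) (μ : Fin 4) (k : Fin n) :
    HasParity (Function.update (fun l => lagr f (I l)) l (lagr f (I l ++ [μ])) k)
      ((I k).length + if k = l then 1 else 0) := by
  rcases eq_or_ne k l with h | h
  · rw [h, Function.update_self, if_pos rfl]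
    have := hasParity_lagr f (I l ++ [μ])
    rwa [List.length_append] at this
  · rw [Function.update_of_ne h, if_neg h]
    exact hasParity_lagr f (I k)

theorem sT_lag (f : Fin r → Fin r → Fin r → ℝ) {n : ℕ} (I : Fin n → List (Fin 4)) :
    sT f 𝒯 (fun _ => .lag) I = dQOpL (∑ l, (I l).length) (𝒯.T n fun l => lagr f (I l)) +
      (-Complex.I) • ∑ l, (∏ k, if k < l then (-1 : ℂ) ^ (I k).length else 1) • ∑ μ,
        pderivL l μ (𝒯.T n (Function.update (fun l => lagr f (I l)) l (lagr f (I l ++ [μ])))) := by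
  have h : ∀ l, entryParity (fun _ => .lag : Fin n → Entry r) I l = (I l).length := fun l => by
    simp [entryParity, Entry.parity]
  simp only [sT, deltaT, h]
  have : ∀ X Y : OpDist r n, X - Complex.I • Y = X + (-Complex.I) • Y := fun X Y => by module
  exact this _ _

/-- The Jacobi identity for the `d_Q` part, commutation with derivatives for the divergence, and the
Wick expansion of every product that appears. The sum over the contracted entry is then taken
outermost. -/
theorem commL_sT (f : Fin r → Fin r → Fin r → ℝ) (p : Jet r) (g : 𝓢(Mink, ℂ)) {n : ℕ}
    (I : Fin n → List (Fin 4)) :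
    commL (p.parity * (1 + ∑ l, (I l).length)) (field p g) (sT f 𝒯 (fun _ => .lag) I) =
      (-Complex.I) • ∑ m, 𝒯.gaugeTerm f p g I m := by
  set X : Fin n → Xi r := fun l => lagr f (I l) with hX
  have hXp : ∀ l, HasParity (X l) (I l).length := fun l => hasParity_lagr f (I l)
  have h1 : ((dQCoeff p).sum fun p' c => c • commL (p'.parity * ∑ l, (I l).length) (field p' g)
      (𝒯.T n X)) = (-Complex.I) • ∑ m,
        (∏ l, if l ≤ m then (-1 : ℂ) ^ ((p.parity + 1) * (I l).length) else 1) •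
        ((dQCoeff p).sum fun p' c => c •
          contraction (V := OpDist r n) (𝒯.wickMap p' g X m) (X m)) := by
    simp only [Finsupp.sum, Finset.smul_sum]
    rw [Finset.sum_comm]
    refine Finset.sum_congr rfl fun p' hp' => ?_
    rw [𝒯.wick_commL X _ hXp, Finset.smul_sum, Finset.smul_sum]
    refine Finset.sum_congr rfl fun m _ => ?_
    have hp := dQCoeff_parity p p' (Finsupp.mem_support_iff.1 hp')
    have hs : (∏ l, if l ≤ m then (-1 : ℂ) ^ (p'.parity * (I l).length) else 1) =
        ∏ l, if l ≤ m then (-1 : ℂ) ^ ((p.parity + 1) * (I l).length) else 1 :=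
      Finset.prod_congr rfl fun l _ => by
        rw [neg_one_pow_congr (a := p'.parity * (I l).length)
          (b := (p.parity + 1) * (I l).length) (by rw [Nat.mul_mod, hp, ← Nat.mul_mod])]
    rw [hs]
    module
  have h2 : ∀ l μ, commL (p.parity * (1 + ∑ l, (I l).length)) (field p g)
      (𝒯.T n (Function.update X l (lagr f (I l ++ [μ])))) = (-Complex.I) • ∑ m,
        (∏ k, if k ≤ m then (-1 : ℂ) ^ (p.parity * ((I k).length + if k = l then 1 else 0)) else 1) •
        contraction (V := OpDist r n) (𝒯.wickMap p g (Function.update X l (lagr f (I l ++ [μ]))) m)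
          (Function.update X l (lagr f (I l ++ [μ])) m) := by
    intro l μ
    rw [← 𝒯.wick_commL _ _ (hasParity_update_lagr f I l μ)]
    rw [Finset.sum_add_distrib, Finset.sum_ite_eq', if_pos (Finset.mem_univ l), add_comm 1]
  have h3 : commL (p.parity * (1 + ∑ l, (I l).length)) (field p g) (∑ l,
      (∏ k, if k < l then (-1 : ℂ) ^ (I k).length else 1) • ∑ μ,
        pderivL l μ (𝒯.T n (Function.update X l (lagr f (I l ++ [μ]))))) =
      (-Complex.I) • ∑ m, ∑ l, ((∏ k, if k < l then (-1 : ℂ) ^ (I k).length else 1) *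
      ∏ k, if k ≤ m then (-1 : ℂ) ^ (p.parity * ((I k).length + if k = l then 1 else 0)) else 1) •
    ∑ μ, pderivL l μ (contraction (V := OpDist r n)
      (𝒯.wickMap p g (Function.update X l (lagr f (I l ++ [μ]))) m)
      (Function.update X l (lagr f (I l ++ [μ])) m)) := by
    simp only [map_sum, map_smul, commL_pderivL, h2, Finset.smul_sum]
    rw [Finset.sum_comm]
    refine (Finset.sum_congr rfl fun l _ => Finset.sum_comm).trans ?_
    rw [Finset.sum_comm]
    refine Finset.sum_congr rfl fun m _ => ?_
    rw [Finset.sum_comm]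
    refine Finset.sum_congr rfl fun l _ => Finset.sum_congr rfl fun μ _ => ?_
    module
  rw [sT_lag, map_add, map_smul, h3, commL_dQOpL, h1, 𝒯.wick_commL X _ hXp, map_smul, map_sum]
  simp only [map_smul, gaugeTerm, Finset.sum_add_distrib, ← Finset.smul_sum, mul_smul]
  module

end ChronologicalProducts

theorem Jet.parity_lt (p : Jet r) : p.parity < 2 := by
  rcases p with ⟨_ | _ | _, M⟩ <;> simp [Jet.parity, Species.parity]

namespace ChronologicalProducts

variable (𝒯 : ChronologicalProducts r)

/-- In `s T(ξ_q · T^{I_m}, …)` the derivative stands inside the product with `D_{pq}`, in the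
commutator outside. The difference is the term with `∂_μ D_{pq}`, which is `D` for the jet variable
with one more index. -/
theorem pderivL_wickMap (p q : Jet r) (g : 𝓢(Mink, ℂ)) {n : ℕ} (A : Fin n → Xi r)
    (m : Fin n) (μ : Fin 4) (X : Xi r) :
    mulAtL m (pauliJordan p q g) (pderivL m μ (𝒯.T n (Function.update A m X))) =
      pderivL m μ (𝒯.wickMap p g A m q X) + (-1 : ℂ) • 𝒯.wickMap p g A m (q.1, μ ::ₘ q.2) X := by
  have h := pderivL_mulAtL_self (r := r) m μ (hasTemperateGrowth_pauliJordan p q g)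
    (F := fun μ => pauliJordan p (q.1, μ ::ₘ q.2) g) (hasTemperateGrowth_pauliJordan p _ g)
    (hasFDerivAt_pauliJordan p q g) (𝒯.T n (Function.update A m X))
  rw [wickMap_apply, h, wickMap_apply]
  module

theorem pderivL_wickMap_of_ne (p q : Jet r) (g : 𝓢(Mink, ℂ)) {n : ℕ} (A : Fin n → Xi r)
    {l m : Fin n} (hlm : l ≠ m) (μ : Fin 4) (X : Xi r) :
    mulAtL m (pauliJordan p q g) (pderivL l μ (𝒯.T n (Function.update A m X))) =
      pderivL l μ (𝒯.wickMap p g A m q X) :=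
  (pderivL_mulAtL_of_ne (r := r) hlm μ (hasTemperateGrowth_pauliJordan p q g)
    (F := fun μ => pauliJordan p (q.1, μ ::ₘ q.2) g) (hasFDerivAt_pauliJordan p q g) _).symm

/-- A single summand of the right-hand side of the commutator formula. -/
theorem mulAtL_reorderL_sT (f : Fin r → Fin r → Fin r → ℝ) (p q : Jet r) (g : 𝓢(Mink, ℂ)) {n : ℕ}
    (I : Fin (n + 1) → List (Fin 4)) (m : Fin (n + 1)) :
    mulAtL m (pauliJordan p q g) (reorderL m.cycleRange.symm
      (sT f 𝒯 (Fin.cons (.sub q) fun _ => .lag) (Fin.cons (I m) fun j => I (m.succAbove j)) -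
        𝒯.T (n + 1) (Fin.cons (sPoly f (.sub q) (I m)) fun j => lagr f (I (m.succAbove j))))) =
    (∏ l, if l < m then (-1 : ℂ) ^ ((I l).length * (p.parity + (I m).length)) else 1) •
      dQOpL (p.parity + ∑ l, (I l).length)
        (𝒯.wickMap p g (fun l => lagr f (I l)) m q (dot q (lagr f (I m)))) +
    ((-Complex.I) *
      (∏ l, if l < m then (-1 : ℂ) ^ ((I l).length * (p.parity + (I m).length + 1)) else 1)) •
        (∑ μ, (pderivL m μ (𝒯.wickMap p g (fun l => lagr f (I l)) m q
          (dot q (lagr f (I m ++ [μ])))) + (-1 : ℂ) •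
          𝒯.wickMap p g (fun l => lagr f (I l)) m (q.1, μ ::ₘ q.2)
            (dot q (lagr f (I m ++ [μ]))))) +
    (-Complex.I) • (∑ j, ((-1 : ℂ) ^ (p.parity + (I m).length) *
        (∏ i, if i < j then (-1 : ℂ) ^ (I (m.succAbove i)).length else 1) *
        (∏ l, if l < m then (-1 : ℂ) ^ (((I l).length + if l = m.succAbove j then 1 else 0) *
          (p.parity + (I m).length)) else 1)) •
        ∑ μ, pderivL (m.succAbove j) μ (𝒯.wickMap p g
          (Function.update (fun l => lagr f (I l)) (m.succAbove j)
            (lagr f (I (m.succAbove j) ++ [μ]))) m q (dot q (lagr f (I m))))) +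
    (-(∏ l, if l < m then (-1 : ℂ) ^ ((I l).length * (p.parity + (I m).length + 1)) else 1)) •
      𝒯.wickMap p g (fun l => lagr f (I l)) m q (sPoly f (.sub q) (I m)) := by
  -- Equal parities allow all signs to be written with `|ξ_p|`, independently of `q`; for unequal
  -- parities `D_{pq} = 0` and both sides vanish.
  by_cases hq : q.parity = p.parity
  · have hs : HasParity (sPoly f (.sub q) (I m)) (q.parity + (I m).length + 1) := by
      rw [sPoly_sub]
      refine ((hasParity_lagr f (I m)).dot q).dQ.sub (HasParity.smul _ (HasParity.sum fun μ _ => ?_))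
      have := ((hasParity_lagr f (I m ++ [μ])).dot q).formalD μ
      rwa [List.length_append, List.length_singleton, ← add_assoc] at this
    have h1 := 𝒯.reorderL_cons (fun l => lagr f (I l)) _ (fun l => hasParity_lagr f (I l)) m hs
    rw [OpDist.map_sub, OpDist.map_sub, reorderL_sT, h1, OpDist.map_sub]
    simp only [map_smul, map_add, map_sum, ← dQOpL_mulAtL, pderivL_wickMap,
      fun j A => 𝒯.pderivL_wickMap_of_ne p q g A (Fin.succAbove_ne m j)]
    rw [hq]
    simp only [wickMap_apply]
    module
  · have h0 : ∀ p' : Jet r, p'.parity % 2 ≠ p.parity % 2 → ∀ A, 𝒯.wickMap p g A m p' = 0 :=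
      fun p' h A => 𝒯.wickMap_eq_zero h g A m
    have hq' : q.parity % 2 ≠ p.parity % 2 := by
      have := p.parity_lt; have := q.parity_lt; omega
    rw [pauliJordan_eq_zero (fun h => hq h.symm), mulAtL_zero]
    simp only [h0 q hq', fun μ => h0 (q.1, μ ::ₘ q.2) hq', LinearMap.zero_apply, map_zero, smul_zero,
      add_zero, Finset.sum_const_zero]

/-- The right-hand side of the commutator formula for a fixed entry. -/
theorem finsum_mulAtL_reorderL_sT {f : Fin r → Fin r → Fin r → ℝ}
    (hf : ∀ a b c, f b a c = -f a b c ∧ f a c b = -f a b c) (p : Jet r) (g : 𝓢(Mink, ℂ)) {n : ℕ}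
    (I : Fin (n + 1) → List (Fin 4)) (m : Fin (n + 1)) (φ : 𝓢(Conf (n + 1), ℂ)) :
    ∑ᶠ q : Jet r, (((∏ l, if l < m then (-1 : ℂ) ^ ((I l).length * (I m).length) else 1) *
              (-1) ^ (p.parity * (I m).length)) •
            mulAt m (pauliJordan p q g) (reorder m.cycleRange.symm
              (sT f 𝒯 (Fin.cons (.sub q) fun _ => .lag) (Fin.cons (I m) fun j => I (m.succAbove j))
                - 𝒯.T (n + 1) (Fin.cons (sPoly f (.sub q) (I m))
                    fun j => lagr f (I (m.succAbove j))))) φ) =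
      (-1 : ℂ) ^ p.parity • 𝒯.gaugeTerm f p g I m φ := by
  obtain ⟨S₀, hS₀⟩ := exists_finset_dot (lagr f (I m))
  choose S₁ hS₁ using fun μ => exists_finset_dot (lagr f (I m ++ [μ]))
  -- A common finite set of jet variables for `T^{I_m}` and all `T^{I_m μ}`; outside it `s(ξ_q ·
  -- T^{I_m})` vanishes too. All sums over `q` can be taken over it.
  set S : Finset (Jet r) := S₀ ∪ Finset.univ.biUnion S₁ with hS
  have hX : ∀ q, dot q (lagr f (I m)) ≠ 0 → q ∈ S := fun q hq =>
    Finset.mem_union_left _ (hS₀ q hq)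
  have hXμ : ∀ μ q, dot q (lagr f (I m ++ [μ])) ≠ 0 → q ∈ S := fun μ q hq =>
    Finset.mem_union_right _ (Finset.mem_biUnion.2 ⟨μ, Finset.mem_univ μ, hS₁ μ q hq⟩)
  have hX' : ∀ q, q ∉ S → dot q (lagr f (I m)) = 0 := fun q hq => by
    by_contra h; exact hq (hX q h)
  have hXμ' : ∀ μ q, q ∉ S → dot q (lagr f (I m ++ [μ])) = 0 := fun μ q hq => by
    by_contra h; exact hq (hXμ μ q h)
  have hsP : ∀ q, q ∉ S → sPoly f (.sub q) (I m) = 0 := fun q hq => by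
    rw [sPoly_sub, hX' q hq]
    simp [hXμ' _ q hq]
  have e1 := fun q => congrArg (fun E : OpDist r (n + 1) => E φ) (𝒯.mulAtL_reorderL_sT f p q g I m)
  rw [finsum_eq_sum_of_support_subset (s := S), ← Finset.smul_sum]
  swap
  · intro q hq
    by_contra h
    refine hq ?_
    refine (congrArg (fun Z : Module.End ℂ (Fock r) =>
      ((∏ l, if l < m then (-1 : ℂ) ^ ((I l).length * (I m).length) else 1) *
        (-1) ^ (p.parity * (I m).length)) • Z) ((e1 q).trans ?_)).trans
      (smul_zero (A := Module.End ℂ (Fock r)) _)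
    simp only [hX' q h, hsP q h, hXμ' _ q h, map_zero, smul_zero, add_zero,
      Finset.sum_const_zero, LinearMap.zero_apply]
  refine (congrArg _ (Finset.sum_congr rfl fun q _ => e1 q)).trans ?_
  rw [← LinearMap.sum_apply, ← LinearMap.smul_apply, ← LinearMap.smul_apply]
  refine congrArg (fun E : OpDist r (n + 1) => E φ) ?_
  have hsum : ∀ {ι : Type} (R : Finset ι) (L : ι → OpDist r (n + 1) →ₗ[ℂ] OpDist r (n + 1))
      (E : ι → Jet r → OpDist r (n + 1)), ∑ q ∈ S, ∑ i ∈ R, L i (E i q) =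
        ∑ i ∈ R, L i (∑ q ∈ S, E i q) := by
    intro ι R L E
    rw [Finset.sum_comm]
    exact Finset.sum_congr rfl fun i _ => (map_sum _ _ _).symm
  have hP := 𝒯.finsum_wickMap_sPoly hf p g (fun l => lagr f (I l)) m (I m)
  rw [finsum_eq_sum_of_support_subset (s := S)] at hP
  swap
  · intro q hq
    by_contra h
    refine hq ?_
    simp only [hsP q h, map_zero]
  have hC : ∀ B : Jet r → Xi r →ₗ[ℂ] OpDist r (n + 1), ∑ q ∈ S, B q (dot q (lagr f (I m))) =
      contraction (V := OpDist r (n + 1)) B (lagr f (I m)) := fun B =>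
    (contraction_eq_sum (V := OpDist r (n + 1)) B hX).symm
  have hCμ : ∀ μ (B : Jet r → Xi r →ₗ[ℂ] OpDist r (n + 1)),
      ∑ q ∈ S, B q (dot q (lagr f (I m ++ [μ]))) =
      contraction (V := OpDist r (n + 1)) B (lagr f (I m ++ [μ])) := fun μ B =>
    (contraction_eq_sum (V := OpDist r (n + 1)) B (hXμ μ)).symm
  simp only [Finset.sum_add_distrib, ← Finset.smul_sum, hsum, ← map_sum, hP, hC]
  have hm1 : ∑ μ, pderivL m μ (∑ q ∈ S, 𝒯.wickMap p g (fun l => lagr f (I l)) m q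
      (dot q (lagr f (I m ++ [μ])))) = ∑ μ, pderivL m μ (contraction (V := OpDist r (n + 1))
        (𝒯.wickMap p g (fun l => lagr f (I l)) m) (lagr f (I m ++ [μ]))) :=
    Finset.sum_congr rfl fun μ _ => congrArg _ (hCμ μ _)
  have hm2 : ∑ q ∈ S, ∑ μ, 𝒯.wickMap p g (fun l => lagr f (I l)) m (q.1, μ ::ₘ q.2)
      (dot q (lagr f (I m ++ [μ]))) = ∑ μ, contraction (V := OpDist r (n + 1))
        (fun q => 𝒯.wickMap p g (fun l => lagr f (I l)) m (q.1, μ ::ₘ q.2))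
          (lagr f (I m ++ [μ])) := by
    rw [Finset.sum_comm]
    exact Finset.sum_congr rfl fun μ _ => hCμ μ fun q =>
      𝒯.wickMap p g (fun l => lagr f (I l)) m (q.1, μ ::ₘ q.2)
  have hm3 : ∀ c : Fin n → ℂ, ∑ q ∈ S, ∑ j, c j • ∑ μ, pderivL (m.succAbove j) μ (𝒯.wickMap p g
      (Function.update (fun l => lagr f (I l)) (m.succAbove j)
        (lagr f (I (m.succAbove j) ++ [μ]))) m q (dot q (lagr f (I m)))) =
      ∑ j, c j • ∑ μ, pderivL (m.succAbove j) μ (contraction (V := OpDist r (n + 1)) (𝒯.wickMap p g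
      (Function.update (fun l => lagr f (I l)) (m.succAbove j)
        (lagr f (I (m.succAbove j) ++ [μ]))) m) (lagr f (I m))) := by
    intro c
    rw [Finset.sum_comm]
    refine Finset.sum_congr rfl fun j _ => ?_
    rw [← Finset.smul_sum, hsum]
    exact congrArg _ (Finset.sum_congr rfl fun μ _ => congrArg _ (hC _))
  rw [hm1, hm2, hm3, gaugeTerm, Fin.sum_univ_succAbove (M := OpDist r (n + 1)) _ m]
  have hw : ∀ μ, 𝒯.wickMap p g (Function.update (fun l => lagr f (I l)) m (lagr f (I m ++ [μ]))) m =
      𝒯.wickMap p g (fun l => lagr f (I l)) m := by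
    intro μ
    ext q X : 2
    rw [wickMap_apply, wickMap_apply, Function.update_idem]
  simp only [hw, Function.update_self, fun j (X : Xi r) => Function.update_of_ne
    (Fin.succAbove_ne m j).symm X (fun l => lagr f (I l))]
  have s0 := sign_wick p.parity (fun l => (I l).length) m
  have s1 := sign_wick_succ p.parity (fun l => (I l).length) m
  have s2 := sign_deriv_self p.parity (fun l => (I l).length) m
  have s3 := sign_deriv_of_ne p.parity (fun l => (I l).length) m
  beta_reduce at s3
  have sq := neg_one_pow_mul_self p.parity
  have hj : ∀ L : Fin n → OpDist r (n + 1), ((∏ l, if l < m then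
      (-1 : ℂ) ^ ((I l).length * (I m).length) else 1) * (-1) ^ (p.parity * (I m).length)) •
      ∑ j, ((-1 : ℂ) ^ (p.parity + (I m).length) *
        (∏ i, if i < j then (-1 : ℂ) ^ (I (m.succAbove i)).length else 1) *
        (∏ l, if l < m then (-1 : ℂ) ^ (((I l).length + if l = m.succAbove j then 1 else 0) *
          (p.parity + (I m).length)) else 1)) • L j = (-1 : ℂ) ^ p.parity • ∑ j,
        ((∏ k, if k < m.succAbove j then (-1 : ℂ) ^ (I k).length else 1) *
      ∏ k, if k ≤ m then (-1 : ℂ) ^ (p.parity * ((I k).length +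
        if k = m.succAbove j then 1 else 0)) else 1) • L j := by
    intro L
    rw [Finset.smul_sum, Finset.smul_sum]
    refine Finset.sum_congr rfl fun j _ => ?_
    rw [smul_smul, smul_smul, s3 j]
  have key : ∀ (V : Type) [AddCommGroup V] [Module ℂ V] (D K P N J J' : V)
      (ρ κ₀ κ₁ x y σ σ' θ : ℂ), x * x = 1 → ρ * κ₀ = σ → ρ * κ₁ * y = σ' → x * θ = ρ * κ₁ →
      ρ • J = x • J' →
      ρ • (κ₀ • D + (-Complex.I * κ₁) • (P + (-1 : ℂ) • N) + -Complex.I • J +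
        (-κ₁) • (y • K + Complex.I • N)) =
      x • ((x * σ) • D + (-x * σ') • K + -Complex.I • (θ • P + J')) := by
    intro V _ _ D K P N J J' ρ κ₀ κ₁ x y σ σ' θ hx h0 h1 h2 hJ
    have e1 : ρ • (κ₀ • D + (-Complex.I * κ₁) • (P + (-1 : ℂ) • N) + -Complex.I • J +
        (-κ₁) • (y • K + Complex.I • N)) = (ρ * κ₀) • D + (-(Complex.I * (ρ * κ₁))) • P +
        -Complex.I • (ρ • J) + (-(ρ * κ₁ * y)) • K := by module
    have e2 : x • ((x * σ) • D + (-x * σ') • K + -Complex.I • (θ • P + J')) =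
        (x * x * σ) • D + (-(x * x * σ')) • K + (-(Complex.I * (x * θ))) • P +
          -Complex.I • (x • J') := by module
    rw [e1, e2, hJ, hx, h0, h1, h2]
    module
  exact key (OpDist r (n + 1)) _ _ _ _ _ _ _ _ _ _ _ _ _ _ sq s0 s1 s2 (hj _)

/-- The commutator of a free field with `s T(T^{I_1}, …, T^{I_n})`. -/
theorem gradedComm_sT {f : Fin r → Fin r → Fin r → ℝ}
    (hf : ∀ a b c, f b a c = -f a b c ∧ f a c b = -f a b c) {n : ℕ}
    (I : Fin (n + 1) → List (Fin 4)) (p : Jet r) (g : 𝓢(Mink, ℂ)) (φ : 𝓢(Conf (n + 1), ℂ)) :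
    gradedComm p.parity (1 + ∑ l, (I l).length) (field p g)
          (sT f 𝒯 (fun _ => .lag) I φ) =
        (-Complex.I * (-1) ^ p.parity) • ∑ m, ∑ᶠ q : Jet r,
          ((∏ l, if l < m then (-1 : ℂ) ^ ((I l).length * (I m).length) else 1) *
              (-1) ^ (p.parity * (I m).length)) •
            mulAt m (pauliJordan p q g) (reorder m.cycleRange.symm
              (sT f 𝒯 (Fin.cons (.sub q) fun _ => .lag) (Fin.cons (I m) fun j => I (m.succAbove j))
                - 𝒯.T (n + 1) (Fin.cons (sPoly f (.sub q) (I m))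
                    fun j => lagr f (I (m.succAbove j))))) φ := by
  have h := congrArg (fun E : OpDist r (n + 1) => E φ) (𝒯.commL_sT f p g I)
  refine Eq.trans h ?_
  rw [LinearMap.smul_apply, LinearMap.sum_apply, mul_smul, Finset.smul_sum (r := (-1) ^ p.parity)]
  congr 1
  refine Finset.sum_congr rfl fun m _ => ?_
  rw [𝒯.finsum_mulAtL_reorderL_sT hf p g I m φ, smul_smul, neg_one_pow_mul_self, one_smul]

end ChronologicalProducts

/-! ### The pairing of states, adjoints and non-degeneracy. -/

instance : SigmaFinite coneMeasure := SigmaFinite.withDensity_ofReal _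

instance : coneMeasure.IsOpenPosMeasure := by
  refine (withDensity_absolutelyContinuous' (by fun_prop) ?_ :
    (volume : Measure Mom) ≪ coneMeasure).isOpenPosMeasure
  -- At the origin the density has the default value `0⁻¹ = 0`, so positivity holds only off this
  -- null set.
  have h : ∀ᵐ p : Mom, p ≠ 0 := by
    simp [ae_iff]
  filter_upwards [h] with p hp
  have : 0 < ‖p‖ := norm_pos_iff.2 hp
  rw [ne_eq, ENNReal.ofReal_eq_zero, not_le]
  positivity

/-- The `n`-particle function of a state for fixed species, as a function of the momenta. -/
theorem Fock.continuous_apply (Ψ : Fock r) {n : ℕ} (t : Fin n → Species r) :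
    Continuous fun p : Fin n → Mom => Ψ.1 n fun i => (t i, p i) := (Ψ.2.2.2 n t).1

theorem RapidlyDecreasing.integrable_pi {n : ℕ} {F : (Fin n → Mom) → ℂ} (hF : RapidlyDecreasing F) :
    Integrable F (Measure.pi fun _ => coneMeasure) := by
  -- A fourth power for each of the `n` particles makes the bound a product of functions integrable
  -- over the cone.
  obtain ⟨D, hD0, hD⟩ := hF.bound (4 * n)
  have h := (Integrable.fintype_prod (𝕜 := ℝ) (ι := Fin n) (μ := fun _ => coneMeasure)
    fun _ => integrable_coneMeasure).const_mul D
  refine h.mono' hF.1.aestronglyMeasurable (Filter.Eventually.of_forall fun p => ?_)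
  rw [Finset.prod_inv_distrib, ← div_eq_mul_inv, le_div_iff₀ (by positivity)]
  refine le_trans ?_ (hD p)
  rw [mul_comm]
  refine mul_le_mul_of_nonneg_right ?_ (norm_nonneg _)
  rw [pow_mul]
  calc ∏ i : Fin n, (1 + ‖p i‖) ^ 4 ≤ ∏ _i : Fin n, (1 + ‖p‖) ^ 4 :=
        Finset.prod_le_prod (fun i _ => by positivity) fun i _ => by
          gcongr
          exact norm_le_pi_norm p i
    _ = _ := by simp

theorem Fock.integrable_mul (K Ψ : Fock r) {n : ℕ} (s t : Fin n → Species r) :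
    Integrable (fun p : Fin n → Mom => (K.1 n fun i => (s i, p i)) * Ψ.1 n fun i => (t i, p i))
      (Measure.pi fun _ => coneMeasure) := by
  obtain ⟨C, hC⟩ := (K.2.2.2 n s).2 0
  exact (Ψ.2.2.2 n t).integrable_pi.bdd_mul (Fock.continuous_apply K s).aestronglyMeasurable
    (Filter.Eventually.of_forall fun p => by simpa using hC p)

theorem Fock.exists_bound (Ψ : Fock r) : ∃ N, ∀ n, N ≤ n → Ψ.1 n = 0 := Ψ.2.1

/-- The bilinear pairing of two states. -/
def pairing : Fock r →ₗ[ℂ] Fock r →ₗ[ℂ] ℂ :=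
  have fin : ∀ K Ψ : Fock r, (Function.support fun n : ℕ => ((n.factorial : ℂ))⁻¹ *
      ∑ t : Fin n → Species r, ∫ p : Fin n → Mom, (K.1 n fun i => (t i, p i)) *
        Ψ.1 n (fun i => (t i, p i)) ∂(Measure.pi fun _ => coneMeasure)).Finite := fun K Ψ => by
    obtain ⟨N, hN⟩ := Fock.exists_bound Ψ
    refine (Finset.range N).finite_toSet.subset fun n hn => ?_
    by_contra h
    exact hn (by simp [hN n (by simpa using h)])
  LinearMap.mk₂ ℂ (fun K Ψ => ∑ᶠ n : ℕ, ((n.factorial : ℂ))⁻¹ *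
      ∑ t : Fin n → Species r, ∫ p : Fin n → Mom, (K.1 n fun i => (t i, p i)) *
        Ψ.1 n (fun i => (t i, p i)) ∂(Measure.pi fun _ => coneMeasure))
    (fun K K' Ψ => by
      rw [← finsum_add_distrib (fin K Ψ) (fin K' Ψ)]
      refine finsum_congr fun n => ?_
      rw [← mul_add, ← Finset.sum_add_distrib]
      congr 1
      refine Finset.sum_congr rfl fun t _ => ?_
      rw [← integral_add (Fock.integrable_mul K Ψ t t) (Fock.integrable_mul K' Ψ t t)]
      congr 1
      funext p
      exact add_mul _ _ _)
    (fun c K Ψ => by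
      rw [smul_finsum' c (fin K Ψ)]
      refine finsum_congr fun n => ?_
      rw [smul_eq_mul, mul_left_comm]
      congr 1
      rw [Finset.mul_sum]
      refine Finset.sum_congr rfl fun t _ => ?_
      rw [← integral_const_mul]
      congr 1
      funext p
      exact mul_assoc _ _ _)
    (fun K Ψ Ψ' => by
      rw [← finsum_add_distrib (fin K Ψ) (fin K Ψ')]
      refine finsum_congr fun n => ?_
      rw [← mul_add, ← Finset.sum_add_distrib]
      congr 1
      refine Finset.sum_congr rfl fun t _ => ?_
      rw [← integral_add (Fock.integrable_mul K Ψ t t) (Fock.integrable_mul K Ψ' t t)]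
      congr 1
      funext p
      exact mul_add _ _ _)
    (fun c K Ψ => by
      rw [smul_finsum' c (fin K Ψ)]
      refine finsum_congr fun n => ?_
      rw [smul_eq_mul, mul_left_comm]
      congr 1
      rw [Finset.mul_sum]
      refine Finset.sum_congr rfl fun t _ => ?_
      rw [← integral_const_mul]
      congr 1
      funext p
      exact mul_left_comm _ _ _)

theorem pairing_apply (K Ψ : Fock r) : pairing K Ψ = ∑ᶠ n : ℕ, ((n.factorial : ℂ))⁻¹ *
      ∑ t : Fin n → Species r, ∫ p : Fin n → Mom, (K.1 n fun i => (t i, p i)) *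
        Ψ.1 n (fun i => (t i, p i)) ∂(Measure.pi fun _ => coneMeasure) := rfl

/-- The species with non-zero scalar product with the given one. -/
def Species.star : Species r → Species r
  | .v a μ => .v a μ
  | .u a => .ut a
  | .ut a => .u a

/-- The non-zero entry of the Gram matrix in the column of the given species. -/
def gramSign : Species r → ℂ
  | .v _ μ => -eta μ
  | _ => 1

theorem Species.star_star (s : Species r) : s.star.star = s := by cases s <;> rfl

theorem Species.parity_star (s : Species r) : s.star.parity = s.parity := by cases s <;> rfl

theorem gram_eq (s t : Species r) : gram s t = if s = t.star then gramSign t else 0 := by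
  cases s <;> cases t <;> simp [gram, Species.star, gramSign]
  rename_i a μ b ν
  by_cases h : a = b ∧ μ = ν
  · simp [h]
  · rw [if_neg h, if_neg h]

theorem norm_gramSign (s : Species r) : ‖gramSign s‖ = 1 := by
  cases s <;> simp [gramSign, eta]
  split_ifs <;> simp

theorem RapidlyDecreasing.of_norm_eq {E : Type*} [NormedAddCommGroup E] {F G : E → ℂ}
    (hF : RapidlyDecreasing F) (hG : Continuous G) (h : ∀ x, ‖G x‖ = ‖F x‖) :
    RapidlyDecreasing G :=
  ⟨hG, fun k => by simpa only [h] using hF.2 k⟩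

/-- The complex conjugate state. -/
def Fock.conj (Θ : Fock r) : Fock r :=
  ⟨fun n z => starRingEnd ℂ (Θ.1 n z), by
    obtain ⟨N, hN⟩ := Θ.2.1
    refine ⟨⟨N, fun n hn => ?_⟩, fun n i j hij z => ?_, fun n s => ?_⟩
    · funext z
      simp [hN n hn]
    · dsimp only
      rw [Θ.2.2.1 n i j hij z]
      simp
    · exact (Θ.2.2.2 n s).of_norm_eq (Complex.continuous_conj.comp (Θ.2.2.2 n s).1)
        fun x => Complex.norm_conj _⟩

/-- The state that represents the linear form `⟨Θ, ·⟩` in the pairing. -/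
def Fock.dual (Θ : Fock r) : Fock r :=
  ⟨fun n z => (∏ i, gramSign (z i).1) * starRingEnd ℂ (Θ.1 n fun i => ((z i).1.star, (z i).2)), by
    obtain ⟨N, hN⟩ := Θ.2.1
    refine ⟨⟨N, fun n hn => ?_⟩, fun n i j hij z => ?_, fun n s => ?_⟩
    · funext z
      simp [hN n hn]
    · have h := Θ.2.2.1 n i j hij fun i => ((z i).1.star, (z i).2)
      have h1 : (∏ k, gramSign ((z ∘ Equiv.swap i j) k).1) = ∏ k, gramSign (z k).1 :=
        Equiv.prod_comp (Equiv.swap i j) fun k => gramSign (z k).1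
      dsimp only
      rw [h1]
      refine (congrArg (fun x => (∏ k, gramSign (z k).1) * starRingEnd ℂ x) h).trans ?_
      simp only [Species.parity_star, map_mul, map_pow, map_neg, map_one]
      ring
    · refine (Θ.2.2.2 n fun i => (s i).star).of_norm_eq
        ((continuous_const (y := ∏ i, gramSign (s i))).mul
          (Complex.continuous_conj.comp (Θ.2.2.2 n fun i => (s i).star).1))
        fun x => ?_
      simp [norm_gramSign]⟩

theorem Fock.dual_apply (Θ : Fock r) (n : ℕ) (z : Fin n → Label r) : (Fock.dual Θ).1 n z =
    (∏ i, gramSign (z i).1) * starRingEnd ℂ (Θ.1 n fun i => ((z i).1.star, (z i).2)) := rfl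

theorem form_eq_pairing (Θ Ψ : Fock r) : form Θ Ψ = pairing (Fock.dual Θ) Ψ := by
  rw [form, pairing_apply]
  refine finsum_congr fun n => ?_
  congr 1
  rw [Finset.sum_comm]
  refine Finset.sum_congr rfl fun t _ => ?_
  rw [Finset.sum_eq_single fun i => (t i).star]
  · congr 1
    funext p
    rw [Fock.dual_apply]
    simp only [gram_eq, if_true]
    ring
  · intro s _ hs
    have : ∏ i, gram (s i) (t i) = 0 := by
      by_contra h
      refine hs (funext fun i => ?_)
      have := Finset.prod_ne_zero_iff.1 h i (Finset.mem_univ i)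
      by_contra h'
      exact this (by rw [gram_eq, if_neg h'])
    simp [this]
  · simp

theorem gramSign_mul_self (s : Species r) : gramSign s * gramSign s = 1 := by
  cases s <;> simp [gramSign, eta_mul_eta]

/-- The symmetry of `Q` for the indefinite form, on one-particle states: conjugation and passage to
dual species transpose the amplitude, with the Gram signs as metric. -/
theorem conj_gaugeCoeff_star (s t : Species r) (k : Mom) :
    gramSign s * starRingEnd ℂ (gaugeCoeff s.star t.star k) = gramSign t * gaugeCoeff t s k := by
  cases s <;> cases t <;> simp [gaugeCoeff, Species.star, gramSign]
  · rename_i a μ b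
    by_cases h : a = b
    · simp only [h, if_true, onShellLow, map_mul, Complex.conj_ofReal]
      have : starRingEnd ℂ (eta μ) = eta μ := by
        unfold eta; split_ifs <;> simp
      rw [this]
      linear_combination (-(onShell k μ : ℂ)) * eta_mul_eta μ
    · simp [h, Ne.symm h]
  · rename_i a b μ
    by_cases h : a = b
    · simp only [h, if_true, onShellLow]
      simp only [map_neg, Complex.conj_ofReal]
      linear_combination (onShell k μ : ℂ) * eta_mul_eta μ
    · simp [h, Ne.symm h]

theorem prod_gramSign_update {n : ℕ} (z : Fin n → Label r) (j : Fin n) (w : Label r) :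
    ∏ i, gramSign (Function.update z j w i).1 =
      gramSign (z j).1 * gramSign w.1 * ∏ i, gramSign (z i).1 := by
  rw [← Finset.mul_prod_erase Finset.univ _ (Finset.mem_univ j),
    ← Finset.mul_prod_erase Finset.univ (fun i => gramSign (z i).1) (Finset.mem_univ j),
    Function.update_self]
  have h : ∏ i ∈ Finset.univ.erase j, gramSign (Function.update z j w i).1 =
      ∏ i ∈ Finset.univ.erase j, gramSign (z i).1 :=
    Finset.prod_congr rfl fun i hi => by rw [Function.update_of_ne (Finset.ne_of_mem_erase hi)]
  rw [h]
  linear_combination (-(gramSign w.1 * ∏ i ∈ Finset.univ.erase j, gramSign (z i).1)) *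
    gramSign_mul_self (z j).1

theorem dual_gaugeCharge (Θ : Fock r) (n : ℕ) (z : Fin n → Label r) :
    (Fock.dual (gaugeCharge Θ)).1 n z = ∑ j, (∏ i, if i < j then (-1 : ℂ) ^ (z i).1.parity else 1) *
      ∑ t, gaugeCoeff t (z j).1 (z j).2 * (Fock.dual Θ).1 n (Function.update z j (t, (z j).2)) := by
  rw [Fock.dual_apply]
  have h : (gaugeCharge Θ).1 n (fun i => ((z i).1.star, (z i).2)) =
      gaugeSum (Θ.1 n) (fun i => ((z i).1.star, (z i).2)) := rfl
  rw [h, gaugeSum, map_sum, Finset.mul_sum]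
  refine Finset.sum_congr rfl fun j _ => ?_
  have hs : starRingEnd ℂ (∏ i, if i < j then (-1 : ℂ) ^ (z i).1.star.parity else 1) =
      ∏ i, if i < j then (-1 : ℂ) ^ (z i).1.parity else 1 := by
    rw [map_prod]
    refine Finset.prod_congr rfl fun i _ => ?_
    rw [Species.parity_star]
    split_ifs <;> simp
  rw [map_mul, hs, mul_left_comm]
  congr 1
  have hst : Function.Involutive (Species.star : Species r → Species r) := Species.star_star
  rw [← Equiv.sum_comp hst.toPerm, map_sum, Finset.mul_sum]
  refine Finset.sum_congr rfl fun t _ => ?_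
  rw [Fock.dual_apply, prod_gramSign_update, map_mul, Function.Involutive.coe_toPerm]
  have hu : (fun i => ((Function.update z j (t, (z j).2) i).1.star,
      (Function.update z j (t, (z j).2) i).2)) =
      Function.update (fun i => ((z i).1.star, (z i).2)) j (t.star, (z j).2) := by
    funext i
    rcases eq_or_ne i j with rfl | h
    · simp
    · simp [h]
  rw [hu]
  have h1 := conj_gaugeCoeff_star (z j).1 t (z j).2
  have h2 := gramSign_mul_self (z j).1
  linear_combination (gramSign (z j).1 * (∏ i, gramSign (z i).1) * starRingEnd ℂ (Θ.1 n
    (Function.update (fun i => ((z i).1.star, (z i).2)) j (t.star, (z j).2)))) * h1 -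
    ((∏ i, gramSign (z i).1) * starRingEnd ℂ (gaugeCoeff (z j).1.star t.star (z j).2) *
      starRingEnd ℂ (Θ.1 n
    (Function.update (fun i => ((z i).1.star, (z i).2)) j (t.star, (z j).2)))) * h2

theorem update_label {n : ℕ} (t : Fin n → Species r) (p : Fin n → Mom) (j : Fin n)
    (s : Species r) : Function.update (fun i => (t i, p i)) j (s, p j) =
      fun i => (Function.update t j s i, p i) := by
  funext i
  rcases eq_or_ne i j with rfl | h
  · simp
  · simp [h]

/-- Transposition of the action of the gauge charge. -/
theorem sum_gaugeSum_transpose {n : ℕ} (F G : (Fin n → Label r) → ℂ) (p : Fin n → Mom) :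
    ∑ t : Fin n → Species r, (∑ j, (∏ i, if i < j then (-1 : ℂ) ^ (t i).parity else 1) *
      ∑ s, gaugeCoeff s (t j) (p j) * F (Function.update (fun i => (t i, p i)) j (s, p j))) *
        G (fun i => (t i, p i)) =
    ∑ t : Fin n → Species r, F (fun i => (t i, p i)) * gaugeSum G fun i => (t i, p i) := by
  simp only [gaugeSum, update_label, Finset.sum_mul, Finset.mul_sum]
  rw [Finset.sum_comm, Finset.sum_comm (s := Finset.univ (α := Fin n → Species r))]
  refine Finset.sum_congr rfl fun j _ => ?_
  rw [← Fintype.sum_prod_type', ← Fintype.sum_prod_type']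
  -- Transposition is the exchange of the species at place `j` with the intermediate species summed
  -- over. The sign involves only places before `j` and is unaffected.
  have hinv : Function.Involutive fun x : (Fin n → Species r) × Species r =>
      (Function.update x.1 j x.2, x.1 j) := by
    intro x
    simp
  rw [← Equiv.sum_comp hinv.toPerm]
  refine Finset.sum_congr rfl fun x _ => ?_
  rw [Function.Involutive.coe_toPerm]
  simp only [Function.update_self, Function.update_idem, Function.update_eq_self]
  have hs : (∏ i, if i < j then (-1 : ℂ) ^ (Function.update x.1 j x.2 i).parity else 1) =
      ∏ i, if i < j then (-1 : ℂ) ^ (x.1 i).parity else 1 := by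
    refine Finset.prod_congr rfl fun i _ => ?_
    split_ifs with h
    · rw [Function.update_of_ne h.ne]
    · rfl
  rw [hs]
  ring

/-- `Q` is symmetric. This lets `⟨Ω, T Q Ψ⟩` be written as the pairing of `Ψ` with a fixed state. -/
theorem form_gaugeCharge (Θ Ψ : Fock r) : form Θ (gaugeCharge Ψ) = form (gaugeCharge Θ) Ψ := by
  rw [form_eq_pairing, form_eq_pairing, pairing_apply, pairing_apply]
  refine finsum_congr fun n => ?_
  congr 1
  rw [← integral_finsetSum _ fun t _ => Fock.integrable_mul _ _ t t,
    ← integral_finsetSum _ fun t _ => Fock.integrable_mul _ _ t t]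
  congr 1
  funext p
  have h := sum_gaugeSum_transpose ((Fock.dual Θ).1 n) (Ψ.1 n) p
  refine Eq.trans ?_ (h.symm.trans ?_)
  · rfl
  · exact Finset.sum_congr rfl fun t _ => by rw [dual_gaugeCharge]

/-- The vacuum. -/
def vacuum : Fock r :=
  ⟨fun n => match n with
    | 0 => 1
    | _ + 1 => 0, by
    refine ⟨⟨1, fun n hn => ?_⟩, fun n => ?_, fun n s => ?_⟩
    · cases n with
      | zero => omega
      | succ n => rfl
    · cases n with
      | zero => intro i; exact i.elim0
      | succ n => intro i j _ z; simp
    · cases n with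
      | zero =>
        refine ⟨continuous_const, fun k => ⟨1, fun x => ?_⟩⟩
        have : ‖x‖ = 0 := by rw [Subsingleton.elim x 0, norm_zero]
        simp [this]
      | succ n => exact ⟨continuous_const, fun k => ⟨0, fun x => by simp⟩⟩⟩

theorem pairing_of_zero {K : Fock r} (h : ∀ n, K.1 (n + 1) = 0) (Ψ : Fock r)
    (z : Fin 0 → Label r) : pairing K Ψ = K.1 0 z * Ψ.1 0 z := by
  rw [pairing_apply, finsum_eq_single _ 0]
  · rw [Fintype.sum_unique, Measure.pi_of_empty, integral_dirac]
    simp only [Nat.factorial_zero, Nat.cast_one, inv_one, one_mul]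
    exact congrArg₂ (· * ·) (congrArg (K.1 0) (Subsingleton.elim _ _))
      (congrArg (Ψ.1 0) (Subsingleton.elim _ _))
  · intro n hn
    obtain ⟨n, rfl⟩ := Nat.exists_eq_succ_of_ne_zero hn
    simp [h n]

theorem form_vacuum (Ψ : Fock r) (z : Fin 0 → Label r) : form vacuum Ψ = Fock.eval 0 z Ψ := by
  rw [form_eq_pairing, pairing_of_zero (z := z)]
  · rw [Fock.eval_apply, Fock.dual_apply]
    simp [vacuum]
  · intro n
    funext z
    rw [Fock.dual_apply]
    simp [vacuum]

theorem gaugeCharge_vacuum : gaugeCharge (vacuum : Fock r) = 0 := by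
  refine Fock.ext_eval fun n z => ?_
  rw [eval_gaugeCharge, map_zero]
  cases n with
  | zero => simp [gaugeSum]
  | succ n => simp [gaugeSum, vacuum]

theorem eval_zero_gaugeCharge (Ψ : Fock r) (z : Fin 0 → Label r) :
    Fock.eval 0 z (gaugeCharge Ψ) = 0 := by
  simp [eval_gaugeCharge, gaugeSum]

theorem cons_cons_swap {X : Type*} {m : ℕ} (a b : X) (y : Fin m → X) :
    (Fin.cons a (Fin.cons b y) : Fin (m + 2) → X) ∘ Equiv.swap 0 (Fin.succ 0) =
      Fin.cons b (Fin.cons a y) := by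
  funext k
  refine Fin.cases ?_ (fun k => Fin.cases ?_ (fun k => ?_) k) k
  · simp
  · simp
  · simp only [Function.comp]
    rw [Equiv.swap_apply_of_ne_of_ne (Fin.succ_ne_zero _)
      fun h => Fin.succ_ne_zero k (Fin.succ_injective _ h)]
    simp

/-- Moving an argument of a graded symmetric function to the first place. -/
theorem gradedSymm_cons {n : ℕ} {F : (Fin (n + 1) → Label r) → ℂ} (hF : GradedSymm F)
    (z : Fin (n + 1) → Label r) (j : Fin (n + 1)) :
    F z = (∏ i, if i < j then (-1 : ℂ) ^ ((z j).1.parity * (z i).1.parity) else 1) *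
      F (Fin.cons (z j) (z ∘ j.succAbove)) := by
  induction n with
  | zero =>
    rw [Fin.fin_one_eq_zero j, Finset.prod_eq_one fun i _ => if_neg (Fin.not_lt_zero i), one_mul]
    congr 1
    funext i
    rw [Fin.fin_one_eq_zero i]
    simp
  | succ n ih =>
    rcases Fin.eq_zero_or_eq_succ j with rfl | ⟨j, rfl⟩
    · rw [Finset.prod_eq_one fun i _ => if_neg (Fin.not_lt_zero i), one_mul]
      congr 1
      funext i
      refine Fin.cases ?_ (fun i => ?_) i <;> simp
    · have hG : GradedSymm fun y => F (Fin.cons (z 0) y) := by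
        intro a b hab y
        have := hF a.succ b.succ (by simp [hab]) (Fin.cons (z 0) y)
        simpa [cons_comp_swap] using this
      have h := ih hG (z ∘ Fin.succ) j
      have e1 : (Fin.cons (z 0) (z ∘ Fin.succ) : Fin (n + 2) → Label r) = z := Fin.cons_self_tail z
      simp only [e1, Function.comp_apply] at h
      have h2 := hF 0 (Fin.succ 0) (by simp)
        (Fin.cons (z j.succ) (Fin.cons (z 0) ((z ∘ Fin.succ) ∘ j.succAbove)))
      rw [cons_cons_swap] at h2
      have e2 : (Fin.cons (z 0) ((z ∘ Fin.succ) ∘ j.succAbove) : Fin (n + 1) → Label r) =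
          z ∘ j.succ.succAbove := by
        funext i
        refine Fin.cases ?_ (fun i => ?_) i <;> simp
      have hp : (∏ i, if i < j.succ then (-1 : ℂ) ^ ((z j.succ).1.parity * (z i).1.parity) else 1) =
          (-1 : ℂ) ^ ((z j.succ).1.parity * (z 0).1.parity) *
          ∏ x, if x < j then (-1 : ℂ) ^ ((z j.succ).1.parity * (z x.succ).1.parity) else 1 := by
        rw [Fin.prod_univ_succ, if_pos (Fin.succ_pos j)]
        simp only [Fin.succ_lt_succ_iff]
      rw [Fin.cons_succ, Fin.cons_zero, Fin.cons_zero] at h2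
      rw [h, h2, e2, hp]
      ring

/-- The operator that contracts one particle of species `s` with the function `ψ`. -/
def removeParticle (s : Species r) (ψ : Mom → ℂ) (hψ : PolyBounded ψ) : Fock r →ₗ[ℂ] Fock r :=
  annihilate (fun t k => (if t = s then 1 else 0) * ψ k) fun _ => (polyBounded_const _).mul hψ

theorem eval_removeParticle (s : Species r) (ψ : Mom → ℂ) (hψ : PolyBounded ψ) (Φ : Fock r) (n : ℕ)
    (z : Fin n → Label r) : Fock.eval n z (removeParticle s ψ hψ Φ) =
      ∫ k, ψ k * Φ.1 (n + 1) (Fin.cons (s, k) z) ∂coneMeasure := by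
  rw [removeParticle, eval_annihilate, Finset.sum_eq_single s]
  · simp
  · intro t _ ht
    simp [ht]
  · simp

/-- Graded symmetry brings the `j`-th argument of `F` to the front with the same sign that
`createSum` attaches to inserting a particle at `j`; the two signs square to one. -/
theorem mul_createSum {n : ℕ} {F : (Fin (n + 1) → Label r) → ℂ} (hF : GradedSymm F)
    (s : Species r) (ψ : Mom → ℂ) (G : (Fin n → Label r) → ℂ) (z : Fin (n + 1) → Label r) :
    F z * createSum s ψ G z = ∑ j, if (z j).1 = s then ψ (z j).2 *
      F (Fin.cons (s, (z j).2) (z ∘ j.succAbove)) * G (z ∘ j.succAbove) else 0 := by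
  rw [createSum, Finset.mul_sum]
  refine Finset.sum_congr rfl fun j _ => ?_
  by_cases h : (z j).1 = s
  · subst h
    rw [gradedSymm_cons hF z j, if_pos rfl, if_pos rfl]
    have hs : (∏ i, if i < j then (-1 : ℂ) ^ ((z j).1.parity * (z i).1.parity) else 1) *
        (∏ i, if i < j then (-1 : ℂ) ^ ((z j).1.parity * (z i).1.parity) else 1) = 1 := by
      rw [← Finset.prod_mul_distrib]
      refine Finset.prod_eq_one fun i _ => ?_
      split_ifs
      · exact neg_one_pow_mul_self _
      · exact one_mul 1
    linear_combination (ψ (z j).2 * F (Fin.cons ((z j).1, (z j).2) (z ∘ j.succAbove)) *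
      G (z ∘ j.succAbove)) * hs
  · simp [h]

theorem integrable_contract (K Φ : Fock r) {ψ : Mom → ℂ} (hψ : RapidlyDecreasing ψ) {n : ℕ}
    (s : Species r) (t : Fin n → Species r) :
    Integrable (fun x : Mom × (Fin n → Mom) => ψ x.1 *
      K.1 (n + 1) (Fin.cons (s, x.1) fun i => (t i, x.2 i)) * Φ.1 n fun i => (t i, x.2 i))
      (coneMeasure.prod (Measure.pi fun _ => coneMeasure)) := by
  have mp := measurePreserving_piFinSuccAbove (n := n) (fun _ => coneMeasure) 0
  rw [← mp.integrable_comp_emb (MeasurableEquiv.measurableEmbedding _)]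
  obtain ⟨C, hC⟩ := hψ.2 0
  obtain ⟨D, hD0, hD⟩ := (Φ.2.2.2 n t).bound 0
  have hc1 : Continuous fun p : Fin (n + 1) → Mom => ψ (p 0) := hψ.1.comp (continuous_apply 0)
  have hc2 : Continuous fun p : Fin (n + 1) → Mom => Φ.1 n fun i => (t i, p i.succ) :=
    (Fock.continuous_apply Φ t).comp
      (continuous_pi fun i => (continuous_apply i.succ : Continuous fun p : Fin (n + 1) → Mom => _))
  have h := (Fock.cons_regular K n s t).integrable_pi.bdd_mul (c := C * D)
    (hc1.mul hc2).aestronglyMeasurable (Filter.Eventually.of_forall fun p => by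
      change ‖ψ (p 0) * _‖ ≤ _
      rw [norm_mul]
      have h1 := hC (p 0)
      have h2 := hD fun i => p i.succ
      rw [pow_zero, one_mul] at h1 h2
      exact mul_le_mul h1 h2 (norm_nonneg _) ((norm_nonneg _).trans h1))
  refine h.congr (Filter.Eventually.of_forall fun p => ?_)
  have e1 : (Fin.cons (s, p 0) fun i => (t i, p i.succ) : Fin (n + 1) → Label r) =
      fun i => ((Fin.cons s t : Fin (n + 1) → Species r) i, p i) := by
    funext i
    refine Fin.cases ?_ (fun i => ?_) i <;> simp
  change ψ (p 0) * (Φ.1 n fun i => (t i, p i.succ)) * _ = ψ (p 0) *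
    K.1 (n + 1) (Fin.cons (s, p 0) fun i => (t i, p i.succ)) * (Φ.1 n fun i => (t i, p i.succ))
  rw [e1]
  ring

/-- All `n + 1` positions of the created particle contribute equally after renaming the integration
variables. The resulting factor is what converts `1/(n+1)!` into `1/n!` in the pairing. -/
theorem sum_integral_createSum (K Φ : Fock r) {ψ : Mom → ℂ} (hψ : RapidlyDecreasing ψ)
    (s : Species r) (n : ℕ) :
    ∑ t : Fin (n + 1) → Species r, ∫ p : Fin (n + 1) → Mom, (K.1 (n + 1) fun i => (t i, p i)) *
        createSum s ψ (Φ.1 n) (fun i => (t i, p i)) ∂(Measure.pi fun _ => coneMeasure) =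
      (n + 1) * ∑ t : Fin n → Species r, ∫ p : Fin n → Mom,
        (∫ k, ψ k * K.1 (n + 1) (Fin.cons (s, k) fun i => (t i, p i)) ∂coneMeasure) *
          Φ.1 n (fun i => (t i, p i)) ∂(Measure.pi fun _ => coneMeasure) := by
  set h : (Fin n → Species r) → Mom × (Fin n → Mom) → ℂ := fun t x => ψ x.1 *
      K.1 (n + 1) (Fin.cons (s, x.1) fun i => (t i, x.2 i)) * Φ.1 n fun i => (t i, x.2 i) with hh
  have hint := fun t : Fin n → Species r => integrable_contract K Φ hψ s t
  have hcomp : ∀ (j : Fin (n + 1)) t, Integrable (fun p : Fin (n + 1) → Mom =>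
      h t (p j, fun i => p (j.succAbove i))) (Measure.pi fun _ => coneMeasure) := fun j t =>
    ((measurePreserving_piFinSuccAbove (n := n) (fun _ => coneMeasure) j).integrable_comp_emb
      (MeasurableEquiv.measurableEmbedding _)).2 (hint t)
  have e1 : ∀ (t : Fin (n + 1) → Species r) (p : Fin (n + 1) → Mom),
      (K.1 (n + 1) fun i => (t i, p i)) * createSum s ψ (Φ.1 n) (fun i => (t i, p i)) =
      ∑ j, (if t j = s then 1 else 0) *
        h (fun i => t (j.succAbove i)) (p j, fun i => p (j.succAbove i)) := by
    intro t p
    rw [mul_createSum (K.2.2.1 (n + 1))]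
    refine Finset.sum_congr rfl fun j _ => ?_
    by_cases hj : t j = s
    · simp only [hj, if_true, one_mul]
      rfl
    · simp [hj]
  have e2 : ∀ (j : Fin (n + 1)) t, ∫ p : Fin (n + 1) → Mom,
      h t (p j, fun i => p (j.succAbove i)) ∂(Measure.pi fun _ => coneMeasure) =
      ∫ p : Fin n → Mom, (∫ k, ψ k * K.1 (n + 1) (Fin.cons (s, k) fun i => (t i, p i)) ∂coneMeasure) *
          Φ.1 n (fun i => (t i, p i)) ∂(Measure.pi fun _ => coneMeasure) := by
    intro j t
    have h1 := (measurePreserving_piFinSuccAbove (n := n) (fun _ => coneMeasure) j).integral_comp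
      (MeasurableEquiv.measurableEmbedding _) (h t)
    refine h1.trans ?_
    rw [integral_prod_symm _ (hint t)]
    congr 1
    funext p
    rw [← integral_mul_const]
  simp only [e1]
  have e3 : ∀ t : Fin (n + 1) → Species r, ∫ p : Fin (n + 1) → Mom, ∑ j, (if t j = s then 1 else 0) *
        h (fun i => t (j.succAbove i)) (p j, fun i => p (j.succAbove i))
          ∂(Measure.pi fun _ => coneMeasure) = ∑ j, (if t j = s then 1 else 0) *
      ∫ p : Fin n → Mom, (∫ k, ψ k * K.1 (n + 1)
        (Fin.cons (s, k) fun i => (t (j.succAbove i), p i)) ∂coneMeasure) *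
          Φ.1 n (fun i => (t (j.succAbove i), p i)) ∂(Measure.pi fun _ => coneMeasure) := by
    intro t
    rw [integral_finsetSum _ fun j _ => (hcomp j _).const_mul _]
    refine Finset.sum_congr rfl fun j _ => ?_
    rw [integral_const_mul, e2 j]
  rw [Finset.sum_congr rfl fun t _ => e3 t, Finset.sum_comm]
  have e4 : ∀ (j : Fin (n + 1)) (f : (Fin n → Species r) → ℂ),
      ∑ t : Fin (n + 1) → Species r, (if t j = s then 1 else 0) * f (fun i => t (j.succAbove i)) =
      ∑ t, f t := by
    intro j f
    rw [← (Fin.insertNthEquiv (fun _ => Species r) j).sum_comp, Fintype.sum_prod_type]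
    simp
  rw [Finset.sum_congr rfl fun j _ => e4 j fun t => ∫ p : Fin n → Mom, (∫ k, ψ k * K.1 (n + 1)
        (Fin.cons (s, k) fun i => (t i, p i)) ∂coneMeasure) *
          Φ.1 n (fun i => (t i, p i)) ∂(Measure.pi fun _ => coneMeasure)]
  simp

/-- Creation and annihilation operators are adjoint for the pairing. -/
theorem pairing_create (K Φ : Fock r) (s : Species r) (ψ : Mom → ℂ) (hψ : RapidlyDecreasing ψ) :
    pairing K (create s ψ hψ Φ) = pairing (removeParticle s ψ hψ.polyBounded K) Φ := by
  obtain ⟨N, hN⟩ := Fock.exists_bound Φ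
  rw [pairing_apply, pairing_apply, finsum_eq_sum_of_support_subset (s := Finset.range (N + 1)),
    finsum_eq_sum_of_support_subset (s := Finset.range N), Finset.sum_range_succ']
  · have h0 : (create s ψ hψ Φ).1 0 = 0 := rfl
    simp only [h0]
    rw [show ∀ x y : ℂ, y = 0 → x + y = x from fun x y h => by rw [h, add_zero]]
    swap
    · simp
    refine Finset.sum_congr rfl fun n _ => ?_
    have h1 : (create s ψ hψ Φ).1 (n + 1) = createSum s ψ (Φ.1 n) := rfl
    simp only [h1]
    rw [sum_integral_createSum K Φ hψ s n, ← mul_assoc]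
    congr 1
    · rw [Nat.factorial_succ]
      have : (n : ℂ) + 1 ≠ 0 := by exact_mod_cast Nat.succ_ne_zero n
      have h2 : (n.factorial : ℂ) ≠ 0 := by exact_mod_cast n.factorial_ne_zero
      push_cast
      field_simp
    · refine Finset.sum_congr rfl fun t _ => ?_
      congr 1
      funext p
      rw [← eval_removeParticle s ψ hψ.polyBounded]
      rfl
  · intro n hn
    by_contra h
    exact hn (by simp [hN n (by simpa using h)])
  · intro n hn
    by_contra h
    refine hn ?_
    obtain ⟨m, rfl⟩ : ∃ m, n = m + 1 := ⟨n - 1, by simp at h; omega⟩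
    have h1 : (create s ψ hψ Φ).1 (m + 1) = createSum s ψ (Φ.1 m) := rfl
    simp [h1, hN m (by simp at h; omega), createSum]

/-- The pairing is non-degenerate. -/
theorem eq_zero_of_pairing {K : Fock r} (h : ∀ Φ, pairing K Φ = 0) : K = 0 := by
  -- Testing against the complex conjugate gives a sum of `L²` norms with positive weights. Each
  -- must vanish, and continuity together with full support of the measure gives pointwise
  -- vanishing.
  have h1 := h (Fock.conj K)
  obtain ⟨N, hN⟩ := Fock.exists_bound K
  have e1 : ∀ (n : ℕ) (z : Fin n → Label r), K.1 n z * (Fock.conj K).1 n z =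
      ((‖K.1 n z‖ ^ 2 : ℝ) : ℂ) := fun n z => by
    change K.1 n z * starRingEnd ℂ (K.1 n z) = _
    rw [Complex.mul_conj, Complex.normSq_eq_norm_sq]
  rw [pairing_apply, finsum_eq_sum_of_support_subset (s := Finset.range N)] at h1
  swap
  · intro n hn
    by_contra h
    exact hn (by simp [hN n (by simpa using h)])
  simp only [e1, integral_complex_ofReal] at h1
  have h2 : ∑ n ∈ Finset.range N, ((n.factorial : ℝ))⁻¹ * ∑ t : Fin n → Species r,
      ∫ p : Fin n → Mom, ‖K.1 n fun i => (t i, p i)‖ ^ 2 ∂(Measure.pi fun _ => coneMeasure) = 0 := by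
    refine Complex.ofReal_injective ?_
    simp only [Complex.ofReal_sum, Complex.ofReal_mul, Complex.ofReal_inv, Complex.ofReal_natCast,
      Complex.ofReal_zero]
    exact h1
  have hpos : ∀ (n : ℕ) (t : Fin n → Species r), 0 ≤ ∫ p : Fin n → Mom,
      ‖K.1 n fun i => (t i, p i)‖ ^ 2 ∂(Measure.pi fun _ => coneMeasure) := fun n t =>
    integral_nonneg fun p => by positivity
  have hint : ∀ (n : ℕ) (t : Fin n → Species r), Integrable (fun p : Fin n → Mom =>
      ‖K.1 n fun i => (t i, p i)‖ ^ 2) (Measure.pi fun _ => coneMeasure) := fun n t => by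
    have := (Fock.integrable_mul K K t t).norm
    exact this.congr (Filter.Eventually.of_forall fun p => by simp only [norm_mul]; ring)
  refine Subtype.ext (funext fun n => ?_)
  by_cases hn : N ≤ n
  · exact hN n hn
  rw [Finset.sum_eq_zero_iff_of_nonneg fun n _ => mul_nonneg (by positivity)
    (Finset.sum_nonneg fun t _ => hpos n t)] at h2
  have h3 := h2 n (by simpa using hn)
  rw [mul_eq_zero, or_iff_right (by positivity),
    Finset.sum_eq_zero_iff_of_nonneg fun t _ => hpos n t] at h3
  funext z
  have h4 := h3 (fun i => (z i).1) (Finset.mem_univ _)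
  rw [integral_eq_zero_iff_of_nonneg (fun p => by positivity) (hint n _)] at h4
  have hc : Continuous fun p : Fin n → Mom => ‖K.1 n fun i => ((z i).1, p i)‖ ^ 2 :=
    (Fock.continuous_apply K _).norm.pow 2
  have h5 := (hc.ae_eq_iff_eq _ continuous_zero).1 h4
  have h6 := congrFun h5 fun i => (z i).2
  simpa using h6

/-! ### Wave packets that separate creation from annihilation. -/

theorem dist_waveVector (k l : Mom) : dist k l ≤ 2 * Real.pi * dist (waveVector k) (waveVector l) := by
  have hpi : 0 < 2 * Real.pi := by positivity
  rw [← div_le_iff₀' hpi, EuclideanSpace.dist_eq (waveVector k)]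
  refine Real.le_sqrt_of_sq_le ?_
  rw [Fin.sum_univ_succ, div_pow, EuclideanSpace.dist_eq k, Real.sq_sqrt (by positivity),
    Finset.sum_div]
  have h : ∀ i : Fin 3, dist (k i) (l i) ^ 2 / (2 * Real.pi) ^ 2 =
      dist (waveVector k i.succ) (waveVector l i.succ) ^ 2 := fun i => by
    simp only [waveVector, Fin.cons_succ, Real.dist_eq, sq_abs]
    field_simp
  rw [Finset.sum_congr rfl fun i _ => h i]
  exact le_add_of_nonneg_left (by positivity)

/-- The energies on opposite half-cones have opposite signs, so the distance of their points is at
least the sum of the moduli of the energies. This keeps a small ball around a non-zero point of one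
half-cone off the other. -/
theorem norm_le_dist_neg_waveVector (k l : Mom) :
    ‖l‖ / (2 * Real.pi) ≤ dist (-waveVector k) (waveVector l) := by
  have hpi : 0 < 2 * Real.pi := by positivity
  have h := PiLp.norm_apply_le (-waveVector k - waveVector l) 0
  rw [← dist_eq_norm] at h
  refine le_trans ?_ h
  refine le_trans ?_ (le_abs_self _)
  have : (-waveVector k - waveVector l) 0 = ‖k‖ / (2 * Real.pi) + ‖l‖ / (2 * Real.pi) := by
    simp only [waveVector, PiLp.sub_apply, PiLp.neg_apply, Fin.cons_zero]
    ring
  rw [this]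
  exact le_add_of_nonneg_left (by positivity)

theorem twoPoint_star (s t : Species r) :
    twoPoint s.star t = if t = s then twoPoint s.star s else 0 := by
  split_ifs with h
  · rw [h]
  · cases s <;> cases t <;> simp_all [Species.star, twoPoint] <;> grind

theorem twoPoint_star_self_ne_zero (s : Species r) : twoPoint s.star s ≠ 0 := by
  cases s <;> simp [Species.star, twoPoint, eta]
  split_ifs <;> simp

theorem field_eq_create (s : Species r) (ψ : Mom → ℂ) (hψ : RapidlyDecreasing ψ) {g : 𝓢(Mink, ℂ)}
    (h1 : ∀ k, hatPos g k = ψ k) (h2 : ∀ k, hatNeg g k = 0) : field (s, 0) g = create s ψ hψ := by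
  refine LinearMap.ext fun Φ => ?_
  have e1 : fieldPlus (s, 0) g Φ = (1 : ℂ) • create s ψ hψ Φ :=
    create_eq_smul _ _ _ _ _ _ (fun k => by simp [momPoly, h1]) Φ
  have e2 : fieldMinus (s, 0) g Φ = ∑ i ∈ (∅ : Finset ℕ), (0 : ℂ) • (0 : Fock r) :=
    annihilate_eq_sum (∅ : Finset ℕ) (fun _ => 0) _ (fun _ _ _ => 0) _
      (fun _ _ => polyBounded_const 0) (fun t k => by simp [h2]) Φ
  change fieldPlus (s, 0) g Φ + fieldMinus (s, 0) g Φ = _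
  rw [e1, e2, one_smul, Finset.sum_empty, add_zero]

theorem field_eq_removeParticle (s : Species r) (ψ : Mom → ℂ) (hψ : PolyBounded ψ)
    {g : 𝓢(Mink, ℂ)} (h1 : ∀ k, hatPos g k = 0) (h2 : ∀ k, hatNeg g k = ψ k) :
    field (s.star, 0) g = twoPoint s.star s • removeParticle s ψ hψ := by
  refine LinearMap.ext fun Φ => ?_
  have e1 : fieldPlus (s.star, 0) g Φ = 0 := create_of_zero _ _ _ (fun k => by simp [h1]) Φ
  have e2 := annihilate_eq_sum ({()} : Finset Unit) (fun _ => twoPoint s.star s)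
    (fun t k => twoPoint s.star t * (momPoly (-Complex.I) 0 k * hatNeg g k))
    (fun _ t k => (if t = s then 1 else 0) * ψ k)
    (fun _ => (polyBounded_const _).mul
      ((polyBounded_momPoly _ _).mul_rapid (rapid_hatNeg g)).polyBounded)
    (fun _ _ => (polyBounded_const _).mul hψ)
    (fun t k => by
      rw [twoPoint_star]
      simp [h2, momPoly]) Φ
  rw [Finset.sum_singleton] at e2
  change fieldPlus (s.star, 0) g Φ + fieldMinus (s.star, 0) g Φ = _
  rw [e1, zero_add]
  exact e2

/-- Wave functions of one-particle states that are created by a smeared field without annihilation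
part, and annihilated by a smeared field without creation part. -/
structure IsWavePacket (ψ : Mom → ℂ) : Prop where
  rapid : RapidlyDecreasing ψ
  exists_pos : ∃ g : 𝓢(Mink, ℂ), (∀ k, hatPos g k = ψ k) ∧ ∀ k, hatNeg g k = 0
  exists_neg : ∃ g : 𝓢(Mink, ℂ), (∀ k, hatPos g k = 0) ∧ ∀ k, hatNeg g k = ψ k

/-- There are wave packets concentrated near any given non-zero momentum. -/
theorem exists_isWavePacket {k₀ : Mom} (h₀ : k₀ ≠ 0) {ε : ℝ} (hε : 0 < ε) :
    ∃ ψ : Mom → ℝ, IsWavePacket (fun k => (ψ k : ℂ)) ∧ (∀ k, 0 ≤ ψ k) ∧ ψ k₀ ≠ 0 ∧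
      ∀ k, ψ k ≠ 0 → dist k k₀ < ε := by
  have hpi : 0 < 2 * Real.pi := by positivity
  -- The bound `ε` localizes the packet; the bound `‖k₀‖` keeps the bump away from the opposite
  -- half-cone. The factor `2π` is the scaling in `waveVector`.
  have hδ : 0 < min ε ‖k₀‖ / (2 * Real.pi) := div_pos (lt_min hε (norm_pos_iff.2 h₀)) hpi
  let b : ContDiffBump (waveVector k₀) := ⟨_, _, half_pos hδ, half_lt_self hδ⟩
  have hb : ∀ w, b w ≠ 0 → dist w (waveVector k₀) < min ε ‖k₀‖ / (2 * Real.pi) := fun w hw => by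
    have : w ∈ Function.support b := hw
    rwa [b.support_eq] at this
  have hcs : HasCompactSupport fun w => (b w : ℂ) :=
    b.hasCompactSupport.comp_left (g := ((↑) : ℝ → ℂ)) Complex.ofReal_zero
  have hcd : ContDiff ℝ (⊤ : ℕ∞) fun w => (b w : ℂ) := Complex.ofRealCLM.contDiff.comp b.contDiff
  let H : 𝓢(Mink, ℂ) := hcs.toSchwartzMap hcd
  -- The reflected bump has the same values on the opposite half-cone, and yields a field consisting
  -- only of its annihilation part.
  have hcs' : HasCompactSupport fun w => (b (-w) : ℂ) :=
    hcs.comp_homeomorph (Homeomorph.neg Mink)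
  have hcd' : ContDiff ℝ (⊤ : ℕ∞) fun w => (b (-w) : ℂ) := hcd.comp contDiff_neg
  let H' : 𝓢(Mink, ℂ) := hcs'.toSchwartzMap hcd'
  have hneg : ∀ k, b (-waveVector k) = 0 := fun k => by
    by_contra h
    have h1 := hb _ h
    have h2 := norm_le_dist_neg_waveVector k k₀
    have h3 : min ε ‖k₀‖ / (2 * Real.pi) ≤ ‖k₀‖ / (2 * Real.pi) := by
      gcongr
      exact min_le_right _ _
    linarith
  refine ⟨fun k => b (waveVector k),
    ⟨rapid_comp H waveVector continuous_waveVector norm_le_waveVector,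
      ⟨𝓕⁻ H, fun k => ?_, fun k => ?_⟩, ⟨𝓕⁻ H', fun k => ?_, fun k => ?_⟩⟩,
    fun k => b.nonneg, (b.pos_of_mem_ball (Metric.mem_ball_self hδ)).ne', fun k hk => ?_⟩
  · rw [hatPos, FourierTransform.fourier_fourierInv_eq]
    rfl
  · rw [hatNeg, FourierTransform.fourier_fourierInv_eq]
    change ((b (-waveVector k) : ℝ) : ℂ) = 0
    rw [hneg, Complex.ofReal_zero]
  · rw [hatPos, FourierTransform.fourier_fourierInv_eq]
    change ((b (-waveVector k) : ℝ) : ℂ) = 0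
    rw [hneg, Complex.ofReal_zero]
  · rw [hatNeg, FourierTransform.fourier_fourierInv_eq]
    change ((b (- -waveVector k) : ℝ) : ℂ) = _
    rw [neg_neg]
  · have h1 := hb _ hk
    rw [lt_div_iff₀' hpi] at h1
    exact ((dist_waveVector k k₀).trans_lt h1).trans_le (min_le_left _ _)

/-- A continuous function vanishes if its integrals against all wave packets vanish. -/
theorem eq_zero_of_isWavePacket {F : Mom → ℂ} (hF : Continuous F)
    (hi : ∀ ψ : Mom → ℂ, IsWavePacket ψ → Integrable (fun k => ψ k * F k) coneMeasure)
    (h : ∀ ψ : Mom → ℂ, IsWavePacket ψ → ∫ k, ψ k * F k ∂coneMeasure = 0) (k : Mom) : F k = 0 := by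
  -- No packet separates the two half-cones at their common apex; the value at 0 follows by
  -- continuity at the end.
  have key : ∀ k₀, k₀ ≠ 0 → F k₀ = 0 := by
    intro k₀ h₀
    by_contra hne
    -- Multiplication by the conjugate of `F k₀` makes the real part positive near `k₀`, so the
    -- integral against a non-negative packet concentrated there could not vanish.
    have hc : Continuous fun k => (starRingEnd ℂ (F k₀) * F k).re := by fun_prop
    have hpos : 0 < (starRingEnd ℂ (F k₀) * F k₀).re := by
      rw [mul_comm, Complex.mul_conj, Complex.ofReal_re]
      exact Complex.normSq_pos.2 hne
    obtain ⟨ε, hε, hball⟩ := Metric.isOpen_iff.1 (isOpen_lt continuous_const hc) k₀ hpos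
    obtain ⟨ψ, hψ, hψ0, hψ1, hψ2⟩ := exists_isWavePacket h₀ hε
    have hz := h _ hψ
    have hint := (hi _ hψ).const_mul (starRingEnd ℂ (F k₀))
    have hre : ∫ k, ψ k * (starRingEnd ℂ (F k₀) * F k).re ∂coneMeasure = 0 := by
      have e := integral_re hint
      rw [integral_const_mul, hz, mul_zero] at e
      rw [← Complex.zero_re]
      refine Eq.trans ?_ e
      congr 1
      funext k
      change _ = (starRingEnd ℂ (F k₀) * (ψ k * F k)).re
      rw [mul_left_comm, Complex.re_ofReal_mul]
    have hcψ : Continuous ψ := by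
      have := Complex.continuous_re.comp hψ.rapid.1
      simpa [Function.comp_def] using this
    have hnn : ∀ k, 0 ≤ ψ k * (starRingEnd ℂ (F k₀) * F k).re := fun k => by
      by_cases hk : ψ k = 0
      · rw [hk, zero_mul]
      · exact mul_nonneg (hψ0 k) (le_of_lt (hball (hψ2 k hk)))
    rw [integral_eq_zero_iff_of_nonneg hnn] at hre
    · have h5 := ((hcψ.mul hc).ae_eq_iff_eq _ continuous_zero).1 hre
      have h6 := congrFun h5 k₀
      exact (mul_ne_zero hψ1 hpos.ne') h6
    · refine hint.re.congr (Filter.Eventually.of_forall fun k => ?_)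
      change (starRingEnd ℂ (F k₀) * (ψ k * F k)).re = _
      rw [mul_left_comm, Complex.re_ofReal_mul]
  have hd : Dense ({0}ᶜ : Set Mom) := dense_compl_singleton 0
  exact congrFun (hF.ext_on hd continuous_const fun x hx => key x hx) k

/-! ### Irreducibility of the free fields. -/

/-- Removing a particle integrates the first argument against a packet, so this is
`eq_zero_of_isWavePacket` with the other arguments held fixed. -/
theorem Fock.eq_zero_of_removeParticle {M : Fock r} {n : ℕ}
    (h : ∀ (s : Species r) (ψ : Mom → ℂ) (hψ : IsWavePacket ψ) (z : Fin n → Label r),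
      Fock.eval n z (removeParticle s ψ hψ.rapid.polyBounded M) = 0) : M.1 (n + 1) = 0 := by
  funext z
  have hc := continuous_integrand (fun i => (z i.succ).1)
    (Fock.cons_regular M n (z 0).1 fun i => (z i.succ).1)
  have := eq_zero_of_isWavePacket
    (hc.comp (Continuous.prodMk_left fun i : Fin n => (z i.succ).2))
    (fun ψ hψ => Fock.integrable M hψ.rapid.polyBounded (z 0).1 (z ∘ Fin.succ))
    (fun ψ hψ => (eval_removeParticle (z 0).1 ψ hψ.rapid.polyBounded M n (z ∘ Fin.succ)).symm.trans
      (h _ ψ hψ _)) (z 0).2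
  rw [← Fin.cons_self_tail z]
  exact this

theorem sign_mul_of_odd {c : ℂ} {e : ℕ} (hc : e % 2 = 1 → c = 0) (a : ℕ) :
    (-1 : ℂ) ^ (a * e) * c = c := by
  rcases Nat.mod_two_eq_zero_or_one e with h | h
  · rw [(Nat.even_iff.2 h).mul_left a |>.neg_one_pow, one_mul]
  · rw [hc h, mul_zero]

/-- An operator that graded commutes with all fields and whose vacuum component is given by a state
is a multiple of the identity. -/
theorem eq_smul_one_of_gradedComm {E : Module.End ℂ (Fock r)} {e : ℕ}
    (h : ∀ (p : Jet r) (g : 𝓢(Mink, ℂ)), gradedComm p.parity e (field p g) E = 0) {K : Fock r}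
    (hK : ∀ Ψ z, Fock.eval 0 z (E Ψ) = pairing K Ψ) {c : ℂ}
    (hc : ∀ z, Fock.eval 0 z (E vacuum) = c) (he : e % 2 = 1 → c = 0) : E = c • 1 := by
  have hcomm : ∀ p g Φ, field p g (E Φ) = (-1 : ℂ) ^ (p.parity * e) • E (field p g Φ) :=
    fun p g Φ => by
      have := LinearMap.congr_fun (h p g) Φ
      exact sub_eq_zero.1 this
  -- A created state has no vacuum component, and `E` commutes with creation up to sign. Hence `K`
  -- pairs to zero with all created states; by adjointness every removal annihilates `K`, which
  -- leaves only its vacuum component.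
  have hK0 : ∀ n, K.1 (n + 1) = 0 := fun n => by
    refine Fock.eq_zero_of_removeParticle fun s ψ hψ z => ?_
    have h0 : removeParticle s ψ hψ.rapid.polyBounded K = 0 := by
      refine eq_zero_of_pairing fun Φ => ?_
      obtain ⟨g, h1, h2⟩ := hψ.exists_pos
      have h3 := congrArg (Fock.eval 0 Fin.elim0) (hcomm (s, 0) g Φ)
      rw [field_eq_create s ψ hψ.rapid h1 h2, eval_create_zero, map_smul, hK, pairing_create] at h3
      exact (smul_eq_zero.1 h3.symm).resolve_left (pow_ne_zero _ (by norm_num))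
    rw [h0, map_zero]
  have hcK : ∀ z, K.1 0 z = c := fun z => by
    rw [← hc z, hK, pairing_of_zero hK0 _ z, ← Fock.eval_apply 0 z vacuum, ← form_vacuum vacuum z,
      form_vacuum vacuum z]
    exact (mul_one _).symm
  have key : ∀ n Ψ z, Fock.eval n z (E Ψ) = c * Fock.eval n z Ψ := by
    intro n
    induction n with
    | zero =>
      intro Ψ z
      rw [hK, pairing_of_zero hK0 _ z, hcK]
      rfl
    | succ n ih =>
      intro Ψ z
      -- Removing one particle commutes with `E` up to sign and lowers the particle number, where
      -- the induction hypothesis applies. The sign is harmless, since `c = 0` when `E` is odd.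
      have h0 : (E Ψ - c • Ψ).1 (n + 1) = 0 := by
        refine Fock.eq_zero_of_removeParticle fun s ψ hψ z => ?_
        obtain ⟨g, h1, h2⟩ := hψ.exists_neg
        have h3 := congrArg (Fock.eval n z) (hcomm (s.star, 0) g Ψ)
        rw [field_eq_removeParticle s ψ hψ.rapid.polyBounded h1 h2] at h3
        simp only [LinearMap.smul_apply, map_smul, smul_eq_mul, ih] at h3
        rw [map_sub, map_sub, map_smul, map_smul, smul_eq_mul, sub_eq_zero]
        refine mul_left_cancel₀ (twoPoint_star_self_ne_zero s) ?_
        rw [h3]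
        linear_combination (twoPoint s.star s *
          Fock.eval n z (removeParticle s ψ hψ.rapid.polyBounded Ψ)) *
            sign_mul_of_odd he (Jet.parity ((s.star, 0) : Jet r))
      have h1 : Fock.eval (n + 1) z (E Ψ - c • Ψ) = 0 := congrFun h0 z
      rw [map_sub, map_smul, sub_eq_zero] at h1
      exact h1
  refine LinearMap.ext fun Ψ => Fock.ext_eval fun n z => ?_
  rw [key]
  rfl

/-! ### The anomaly as a vacuum expectation value. -/

namespace ChronologicalProducts
variable (𝒯 : ChronologicalProducts r)

/-- The vacuum component of `s T(T^{I_1}(x_1), …, T^{I_n}(x_n))` applied to a state. -/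
theorem eval_zero_sT (f : Fin r → Fin r → Fin r → ℝ) {n : ℕ} (I : Fin n → List (Fin 4))
    (φ : 𝓢(Conf n, ℂ)) (Ψ : Fock r) (z : Fin 0 → Label r) :
    Fock.eval 0 z (sT f 𝒯 (fun _ => .lag) I φ Ψ) =
      -(-1) ^ (∑ l, (I l).length) *
        Fock.eval 0 z (𝒯.T n (fun l => lagr f (I l)) φ (gaugeCharge Ψ)) +
      Complex.I * ∑ l, (∏ k, if k < l then (-1 : ℂ) ^ (I k).length else 1) * ∑ μ : Fin 4,
        Fock.eval 0 z (𝒯.T n (Function.update (fun l => lagr f (I l)) l (lagr f (I l ++ [μ])))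
          (LineDeriv.lineDerivOpCLM ℂ 𝓢(Conf n, ℂ)
            (Pi.single l (EuclideanSpace.single μ 1) : Conf n) φ) Ψ) := by
  have hQ := eval_zero_gaugeCharge (𝒯.T n (fun l => lagr f (I l)) φ Ψ) z
  rw [sT_lag]
  simp only [LinearMap.add_apply, LinearMap.smul_apply, LinearMap.sum_apply, dQOpL_apply_apply,
    LinearMap.sub_apply, Module.End.mul_apply, map_add, map_sub, map_smul, map_sum, hQ, smul_eq_mul]
  have hp : ∀ l μ (E : OpDist r n), Fock.eval 0 z (pderivL l μ E φ Ψ) =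
      -Fock.eval 0 z (E (LineDeriv.lineDerivOpCLM ℂ 𝓢(Conf n, ℂ)
            (Pi.single l (EuclideanSpace.single μ 1) : Conf n) φ) Ψ) := fun l μ E =>
    (Fock.eval 0 z).map_neg _
  simp only [hp, Finset.sum_neg_distrib]
  simp only [mul_neg, Finset.sum_neg_distrib]
  ring

theorem exists_pairing {n : ℕ} (A : Fin n → Xi r) (φ : 𝓢(Conf n, ℂ)) (z : Fin 0 → Label r) :
    ∃ K, ∀ Ψ, Fock.eval 0 z (𝒯.T n A φ Ψ) = pairing K Ψ := by
  obtain ⟨C, hC⟩ := 𝒯.adjoint n A φ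
  exact ⟨Fock.dual (C vacuum), fun Ψ => by rw [← form_vacuum, ← hC, form_eq_pairing]⟩

theorem exists_pairing_gaugeCharge {n : ℕ} (A : Fin n → Xi r) (φ : 𝓢(Conf n, ℂ))
    (z : Fin 0 → Label r) :
    ∃ K, ∀ Ψ, Fock.eval 0 z (𝒯.T n A φ (gaugeCharge Ψ)) = pairing K Ψ := by
  obtain ⟨C, hC⟩ := 𝒯.adjoint n A φ
  exact ⟨Fock.dual (gaugeCharge (C vacuum)), fun Ψ => by
    rw [← form_vacuum, ← hC, form_gaugeCharge, form_eq_pairing]⟩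

theorem exists_pairing_sT (f : Fin r → Fin r → Fin r → ℝ) {n : ℕ} (I : Fin n → List (Fin 4))
    (φ : 𝓢(Conf n, ℂ)) :
    ∃ K, ∀ Ψ z, Fock.eval 0 z (sT f 𝒯 (fun _ => .lag) I φ Ψ) = pairing K Ψ := by
  obtain ⟨K, hK⟩ := 𝒯.exists_pairing_gaugeCharge (fun l => lagr f (I l)) φ Fin.elim0
  choose L hL using fun (l : Fin n) (μ : Fin 4) => 𝒯.exists_pairing
    (Function.update (fun l => lagr f (I l)) l (lagr f (I l ++ [μ])))
    (LineDeriv.lineDerivOpCLM ℂ 𝓢(Conf n, ℂ) (Pi.single l (EuclideanSpace.single μ 1) : Conf n) φ)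
    Fin.elim0
  refine ⟨(-(-1 : ℂ) ^ (∑ l, (I l).length)) • K + Complex.I •
    ∑ l, (∏ k, if k < l then (-1 : ℂ) ^ (I k).length else 1) • ∑ μ, L l μ, fun Ψ z => ?_⟩
  rw [Subsingleton.elim z Fin.elim0, eval_zero_sT, hK]
  simp only [hL, map_add, map_smul, map_sum, LinearMap.add_apply, LinearMap.smul_apply,
    LinearMap.sum_apply, smul_eq_mul]

/-- The distribution `⟨Ω, T(A_1(x_1), …, A_n(x_n)) Ω⟩`. -/
def vacuumExpectation {n : ℕ} (A : Fin n → Xi r) : 𝓢(Conf n, ℂ) →L[ℂ] ℂ where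
  toLinearMap := Fock.eval 0 Fin.elim0 ∘ₗ LinearMap.applyₗ vacuum ∘ₗ 𝒯.T n A
  cont := by
    refine (𝒯.tempered n A vacuum vacuum).congr fun φ => ?_
    rw [form_vacuum _ Fin.elim0]
    rfl

/-- The vacuum expectation value of `s T(T^{I_1}(x_1), …, T^{I_n}(x_n))`. -/
def anomaly (f : Fin r → Fin r → Fin r → ℝ) {n : ℕ} (I : Fin n → List (Fin 4)) :
    𝓢(Conf n, ℂ) →L[ℂ] ℂ :=
  Complex.I • ∑ l, (∏ k, if k < l then (-1 : ℂ) ^ (I k).length else 1) • ∑ μ : Fin 4,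
    (𝒯.vacuumExpectation
      (Function.update (fun l => lagr f (I l)) l (lagr f (I l ++ [μ])))).comp
        (LineDeriv.lineDerivOpCLM ℂ 𝓢(Conf n, ℂ)
          (Pi.single l (EuclideanSpace.single μ 1) : Conf n))

/-- The `d_Q` part does not contribute: `Q` annihilates the vacuum and never produces a vacuum
component. Only the divergences remain, and these are tempered. -/
theorem eval_zero_sT_vacuum (f : Fin r → Fin r → Fin r → ℝ) {n : ℕ} (I : Fin n → List (Fin 4))
    (φ : 𝓢(Conf n, ℂ)) (z : Fin 0 → Label r) :
    Fock.eval 0 z (sT f 𝒯 (fun _ => .lag) I φ vacuum) = 𝒯.anomaly f I φ := by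
  rw [eval_zero_sT, gaugeCharge_vacuum, map_zero, map_zero, mul_zero, zero_add,
    Subsingleton.elim z Fin.elim0]
  simp only [anomaly, smul_apply, sum_apply, smul_eq_mul,
    ContinuousLinearMap.comp_apply]
  rfl

theorem stateParity_vacuum : StateParity (vacuum : Fock r) 0 := by
  intro n z h
  cases n with
  | zero => simp
  | succ n => exact absurd rfl h

/-- The products in the divergence then have odd total Fermi parity and map the vacuum to odd
states, which have no vacuum component. -/
theorem anomaly_eq_zero_of_odd (f : Fin r → Fin r → Fin r → ℝ) {n : ℕ} (I : Fin n → List (Fin 4))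
    (h : (1 + ∑ l, (I l).length) % 2 = 1) (φ : 𝓢(Conf n, ℂ)) : 𝒯.anomaly f I φ = 0 := by
  have key : ∀ l μ φ, 𝒯.vacuumExpectation
      (Function.update (fun l => lagr f (I l)) l (lagr f (I l ++ [μ]))) φ = 0 := by
    intro l μ φ
    by_contra hne
    have := 𝒯.parity n _ _ (hasParity_update_lagr f I l μ) φ vacuum 0 stateParity_vacuum 0
      Fin.elim0 hne
    rw [Finset.sum_add_distrib, Finset.sum_ite_eq' Finset.univ l] at this
    simp at this
    omega
  simp only [anomaly, smul_apply, sum_apply, smul_eq_mul,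
    ContinuousLinearMap.comp_apply, key]
  simp

end ChronologicalProducts

/-- The rank-one gauge identity with the entry `ξ_q · T^{I_1}` at the first place. -/
theorem GaugeRankOne.sT_cons {f : Fin r → Fin r → Fin r → ℝ}
    (hf : ∀ a b c, f b a c = -f a b c ∧ f a c b = -f a b c) {𝒯 : ChronologicalProducts r} {n : ℕ}
    (hG : GaugeRankOne f 𝒯 (n + 1)) (q : Jet r) (J : List (Fin 4)) (I : Fin n → List (Fin 4)) :
    sT f 𝒯 (Fin.cons (.sub q) fun _ => .lag) (Fin.cons J I) =
      𝒯.T (n + 1) (Fin.cons (sPoly f (.sub q) J) fun j => lagr f (I j)) := by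
  have e : (Function.update (fun _ => .lag) 0 (.sub q) : Fin (n + 1) → Entry r) =
      Fin.cons (.sub q) fun _ => .lag := by
    funext l
    refine Fin.cases ?_ (fun l => ?_) l <;> simp
  have h := hG 0 q (Fin.cons J I)
  simp only [e] at h
  rw [h, Fin.sum_univ_succ, Finset.prod_eq_one fun l _ => if_neg (Fin.not_lt_zero l), one_smul,
    Finset.sum_eq_zero, add_zero]
  · congr 1
    funext l
    refine Fin.cases ?_ (fun l => ?_) l
    · rw [Function.update_self]
      rfl
    · rw [Function.update_of_ne (Fin.succ_ne_zero l)]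
      rfl
  -- The other entries contribute `s T^I`, which is a combination of multiples of the field
  -- equations and is annihilated by `T`.
  · intro m _
    have h0 := 𝒯.update_eq_zero_of_mem (entries f (Fin.cons (.sub q) fun _ => .lag) (Fin.cons J I))
      m.succ (sPoly_lag_mem hf (I m))
    exact (congrArg _ h0).trans (smul_zero _)

/-- The gauge identity makes each bracket of the commutator formula of the form `X - X`. So all
graded commutators with fields vanish and irreducibility applies; the factor is read off from the
vacuum component. -/
theorem ChronologicalProducts.sT_eq_anomaly {f : Fin r → Fin r → Fin r → ℝ}
    (hf : ∀ a b c, f b a c = -f a b c ∧ f a c b = -f a b c) (𝒯 : ChronologicalProducts r) {n : ℕ}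
    (hG : GaugeRankOne f 𝒯 (n + 1)) (I : Fin (n + 1) → List (Fin 4)) (φ : 𝓢(Conf (n + 1), ℂ)) :
    sT f 𝒯 (fun _ => .lag) I φ = 𝒯.anomaly f I φ • (1 : Module.End ℂ (Fock r)) := by
  obtain ⟨K, hK⟩ := 𝒯.exists_pairing_sT f I φ
  refine eq_smul_one_of_gradedComm (fun p g => ?_) hK (𝒯.eval_zero_sT_vacuum f I φ)
    fun h => 𝒯.anomaly_eq_zero_of_odd f I h φ
  rw [𝒯.gradedComm_sT hf I p g φ, Finset.sum_eq_zero, smul_zero]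
  intro m _
  rw [finsum_eq_zero_of_forall_eq_zero]
  intro q
  have h0 : ∀ X : OpDist r (n + 1),
      mulAt m (pauliJordan p q g) (reorder m.cycleRange.symm (X - X)) φ = 0 := fun X =>
    sub_self (X _)
  rw [hG.sT_cons hf, h0, smul_zero]

end

end YangMills

theorem mainTheorem3 (r : ℕ) (f : Fin r → Fin r → Fin r → ℝ)
    (hf : ∀ a b c, f b a c = -f a b c ∧ f a c b = -f a b c)
    (𝒯 : ChronologicalProducts r) (n : ℕ) :
    (∀ (I : Fin (n + 1) → List (Fin 4)) (p : Jet r) (g : 𝓢(Mink, ℂ)) (φ : 𝓢(Conf (n + 1), ℂ)),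
      gradedComm p.parity (1 + ∑ l, (I l).length) (field p g)
          (sT f 𝒯 (fun _ => .lag) I φ) =
        (-Complex.I * (-1) ^ p.parity) • ∑ m, ∑ᶠ q : Jet r,
          ((∏ l, if l < m then (-1 : ℂ) ^ ((I l).length * (I m).length) else 1) *
              (-1) ^ (p.parity * (I m).length)) •
            mulAt m (pauliJordan p q g) (reorder m.cycleRange.symm
              (sT f 𝒯 (Fin.cons (.sub q) fun _ => .lag) (Fin.cons (I m) fun j => I (m.succAbove j))
                - 𝒯.T (n + 1) (Fin.cons (sPoly f (.sub q) (I m))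
                    fun j => lagr f (I (m.succAbove j))))) φ) ∧
    (GaugeRankOne f 𝒯 (n + 1) → ∀ I : Fin (n + 1) → List (Fin 4),
      ∃ 𝒜 : 𝓢(Conf (n + 1), ℂ) →L[ℂ] ℂ, ∀ φ : 𝓢(Conf (n + 1), ℂ),
        sT f 𝒯 (fun _ => .lag) I φ = 𝒜 φ • (1 : Module.End ℂ (Fock r))) := by
  exact ⟨fun I p g φ => 𝒯.gradedComm_sT hf I p g φ,
    fun hG I => ⟨𝒯.anomaly f I, fun φ => 𝒯.sT_eq_anomaly hf hG I φ⟩⟩
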